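/- **Proposition 6.1.** Let $n\ge 1$ and let $\tilde C_n$ be the affine Weyl group of $Sp_{2n}(\mathbb C)$: the Coxeter group with simple generators $s_0,\dots,s_n$ in which $s_is_j$ (for $i\neq j$) has order $2,3,4,6,\infty$ according as $a_{ij}a_{ji}$ is $0,1,2,3$ or $\ge 4$. Here $(a_{ij})_{0\le i,j\le n}$ is the affine Cartan matrix with $a_{ii}=2$; $a_{ij}=0$ if $|i-j|\ge 2$; and, for $|i-j|=1$, $a_{ij}=-2$ if $j\in\{0,n\}$ and $a_{ij}=-1$ otherwise. Let $\ell$ be the length function. The group acts on the root lattice $\bigoplus_i\mathbb Z\alpha_i$ by $s_i\alpha_j=\alpha_j-a_{ij}\alpha_i$ and on the coroot lattice $\bigoplus_i\mathbb Z\alpha_i^\vee$ by $s_i\alpha_j^\vee=\alpha_j^\vee-a_{ji}\alpha_i^\vee$. Let $K=\alpha_0^\vee+\cdots+\alpha_n^\vee$ be the canonical central element. Let $\mathcal Z\subset\tilde C_n$ be the set of elements that have a reduced word which is a (not necessarily contiguous) subword of a rotation (cyclic shift) of the word $1\,2\cdots(n-1)\,n\,(n-1)\cdots 1\,0$ of length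 $2n$. For $w\in\tilde C_n$ let $\mathrm{Supp}(w)\subset\{0,\dots,n\}$ be the set of letters occurring in any reduced word of $w$, and let $c(w)$ be the number of its components, that is, of its maximal nonempty subintervals. Write $v\lessdot w$ if $v^{-1}w$ is a reflection (a conjugate of a simple generator) and $\ell(w)=\ell(v)+1$. In that case let $\alpha_{vw}^\vee=u\alpha_i^\vee$, where $u\in\tilde C_n$ and $0\le i\le n$ are such that $v^{-1}w=us_iu^{-1}$ and $u\alpha_i$ is a positive root, i.e. a nonnegative integer combination of $\alpha_0,\dots,\alpha_n$. Let $v\in\mathcal Z$ with $\ell(v)<2n$, and let $\mathcal C_v=\{w\in\mathcal Z\mid v\lessdot w\}$. Then $\mathcal C_v$ is finite, the coroot $\alpha^\vee_{vw}$ exists and does not depend on the choice of $u$ and $i$ for each $w\in\mathcal C_v$, and $$\sum_{w\in\mathcal C_v}2^{c(w)-1}\,\alpha_{vw}^\vee=2^{c(v)}K .$$ -/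

import Mathlib

namespace AffineC

/-- The Cartan matrix of the untwisted affine algebra of `sp_{2n}`, with rows and columns indexed
by the affine Dynkin nodes `0, 1, …, n`; the entry at `(i, j)` is `⟨α_i^∨, α_j⟩`.  Adjacent nodes
`i, j` give `-2` if `j` is one of the end nodes `0, n` (these carry the long roots) and `-1`
otherwise.  For `n = 1` this is the Cartan matrix of affine `sl_2 = sp_2`. -/
def cartan (n : ℕ) : Matrix (Fin (n + 1)) (Fin (n + 1)) ℤ :=
  Matrix.of fun i j =>
    if i = j then 2
    else if i.val + 1 = j.val ∨ j.val + 1 = i.val then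
      (if j.val = 0 ∨ j.val = n then -2 else -1)
    else 0

/-- The order of `s_i s_j` (for `i ≠ j`) as a function of `a_{ij} a_{ji}`; the value `0` stands
for an infinite order, as is usual for Mathlib's Coxeter matrices. -/
def braidOrder (k : ℤ) : ℕ :=
  if k = 0 then 2 else if k = 1 then 3 else if k = 2 then 4 else if k = 3 then 6 else 0

lemma braidOrder_ne_one (k : ℤ) : braidOrder k ≠ 1 := by
  unfold braidOrder; split_ifs <;> decide

/-- The Coxeter matrix of the affine Weyl group of type `C`. -/
def coxeterMatrix (n : ℕ) : CoxeterMatrix (Fin (n + 1)) where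
  M := Matrix.of fun i j => if i = j then 1 else braidOrder (cartan n i j * cartan n j i)
  isSymm := by
    ext i j
    by_cases h : i = j
    · subst h; rfl
    · simp [Matrix.transpose_apply, Matrix.of_apply, h, Ne.symm h, mul_comm]
  diagonal := by intro i; simp
  off_diagonal := by intro i j h; simp [h, braidOrder_ne_one]

/-- The affine Weyl group of `Sp_{2n}`. -/
abbrev Weyl (n : ℕ) : Type := (coxeterMatrix n).Group

/-- The affine Weyl group with its simple reflections `s_0, …, s_n`. -/
abbrev sys (n : ℕ) : CoxeterSystem (coxeterMatrix n) (Weyl n) := (coxeterMatrix n).toCoxeterSystem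

/-! ### The root and coroot lattices and the action of the affine Weyl group -/

/-- The free abelian group on the affine Dynkin nodes.  It serves both as the affine coroot
lattice (with basis `α_i^∨`) and as the affine root lattice (with basis `α_i`). -/
abbrev Lattice (n : ℕ) : Type := Fin (n + 1) → ℤ

/-- The basis vector with index `i`, that is `α_i^∨` or `α_i`. -/
def basisVec {n : ℕ} (i : Fin (n + 1)) : Lattice n := Pi.single i 1

/-- `x ↦ x - (∑ j, x_j B_{ji}) e_i`. -/
def refl {n : ℕ} (B : Matrix (Fin (n + 1)) (Fin (n + 1)) ℤ) (i : Fin (n + 1)) :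
    Module.End ℤ (Lattice n) where
  toFun x := x - (∑ j, x j * B j i) • basisVec i
  map_add' x y := by
    simp only [Pi.add_apply, add_mul, Finset.sum_add_distrib, add_smul]; abel
  map_smul' c x := by
    simp only [Pi.smul_apply, smul_eq_mul, RingHom.id_apply, smul_sub, smul_smul, mul_assoc,
      Finset.mul_sum]

lemma refl_apply {n : ℕ} (B : Matrix (Fin (n + 1)) (Fin (n + 1)) ℤ) (i : Fin (n + 1))
    (x : Lattice n) : refl B i x = x - (∑ j, x j * B j i) • basisVec i := rfl

lemma sum_refl {n : ℕ} (B : Matrix (Fin (n + 1)) (Fin (n + 1)) ℤ) (x : Lattice n) (c : ℤ)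
    (i k : Fin (n + 1)) :
    ∑ j, (x - c • (basisVec i : Lattice n)) j * B j k = (∑ j, x j * B j k) - c * B i k := by
  simp [basisVec, sub_mul, Finset.sum_sub_distrib, Pi.single_apply]

lemma refl_pow {n : ℕ} (B : Matrix (Fin (n + 1)) (Fin (n + 1)) ℤ) (hd : ∀ i, B i i = 2)
    (h0 : ∀ i j, B i j = 0 ↔ B j i = 0) (i j : Fin (n + 1)) :
    (refl B i * refl B j) ^ (if i = j then 1 else braidOrder (B i j * B j i)) = 1 := by
  by_cases hij : i = j
  · subst hij
    rw [if_pos rfl, pow_one]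
    refine LinearMap.ext fun x => ?_
    rw [Module.End.mul_apply, refl_apply, refl_apply, sum_refl, hd, Module.End.one_apply]
    module
  · rw [if_neg hij]
    refine LinearMap.ext fun x => ?_
    obtain ⟨p, hp⟩ : ∃ p, p = ∑ k, x k * B k i := ⟨_, rfl⟩
    obtain ⟨q, hq⟩ : ∃ q, q = ∑ k, x k * B k j := ⟨_, rfl⟩
    obtain ⟨a, ha⟩ : ∃ a, a = B i j := ⟨_, rfl⟩
    obtain ⟨b, hb⟩ : ∃ b, b = B j i := ⟨_, rfl⟩
    have step : ∀ c d : ℤ,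
        (refl B i * refl B j) (x - c • basisVec i - d • basisVec j) =
          x - (c + (p - c * 2 - d * b) - (q - c * a - d * 2) * b) • basisVec i -
            (d + (q - c * a - d * 2)) • basisVec j := by
      intro c d
      rw [Module.End.mul_apply, refl_apply, refl_apply]
      simp only [sum_refl, hd, ← hp, ← hq, ← ha, ← hb]
      module
    have start : x = x - (0 : ℤ) • basisVec i - (0 : ℤ) • basisVec j := by simp
    have fin : ∀ c d : ℤ, c = 0 → d = 0 →
        x - c • basisVec i - d • basisVec j = (1 : Module.End ℤ (Lattice n)) x := by
      rintro c d rfl rfl; simp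
    have congr : ∀ c c' d d' : ℤ, c = c' → d = d' →
        x - c • basisVec i - d • basisVec j = x - c' • basisVec i - d' • basisVec j := by
      rintro c c' d d' rfl rfl; rfl
    have hz : a = 0 ↔ b = 0 := by rw [ha, hb]; exact h0 i j
    rw [← ha, ← hb]
    unfold braidOrder
    split_ifs with h1 h2 h3 h4
    · have hz' : a = 0 ∧ b = 0 := by
        rcases mul_eq_zero.mp h1 with h | h
        · exact ⟨h, hz.mp h⟩
        · exact ⟨hz.mpr h, h⟩
      rw [start, Module.End.pow_apply]
      simp only [Function.iterate_succ_apply, Function.iterate_zero_apply, step]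
      rw [← start]
      apply fin <;> rw [hz'.1, hz'.2] <;> ring
    · rw [start, Module.End.pow_apply]
      simp only [Function.iterate_succ_apply, Function.iterate_zero_apply, step]
      rw [← start]
      apply fin <;> clear step start fin congr <;> grind
    · rw [start, Module.End.pow_apply]
      simp only [Function.iterate_succ_apply, Function.iterate_zero_apply, step]
      rw [← start]
      apply fin <;> clear step start fin congr <;> grind
    · have step3 : ∀ c d : ℤ,
          ((refl B i * refl B j) ^ 3) (x - c • basisVec i - d • basisVec j) =
            x - (4 * p - 2 * b * q - c) • basisVec i - (4 * q - 2 * a * p - d) • basisVec j := by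
        intro c d
        rw [Module.End.pow_apply]
        simp only [Function.iterate_succ_apply, Function.iterate_zero_apply, step]
        refine congr _ _ _ _ ?_ ?_ <;> clear step start fin congr <;> grind
      rw [start, pow_mul _ 3 2, pow_two, Module.End.mul_apply, step3, step3, ← start]
      apply fin <;> ring
    · rw [pow_zero]

lemma cartan_diag (n : ℕ) (i : Fin (n + 1)) : cartan n i i = 2 := by simp [cartan]

lemma cartan_zero (n : ℕ) (i j : Fin (n + 1)) : cartan n i j = 0 ↔ cartan n j i = 0 := by
  unfold cartan
  simp only [Matrix.of_apply]
  split_ifs <;> simp_all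

lemma liftable_coroot (n : ℕ) : (coxeterMatrix n).IsLiftable (refl (cartan n)) := fun i j =>
  refl_pow _ (cartan_diag n) (cartan_zero n) i j

lemma liftable_root (n : ℕ) : (coxeterMatrix n).IsLiftable (refl (cartan n).transpose) :=
  fun i j => by
    have h := refl_pow (cartan n).transpose (cartan_diag n) (fun i j => cartan_zero n j i) i j
    rw [Matrix.transpose_apply, Matrix.transpose_apply, mul_comm (cartan n j i)] at h
    exact h

/-- The action of the affine Weyl group on the coroot lattice,
`s_i μ = μ - ⟨μ, α_i⟩ α_i^∨`. -/
def corootRep (n : ℕ) : Weyl n →* Module.End ℤ (Lattice n) :=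
  (sys n).lift ⟨refl (cartan n), liftable_coroot n⟩

/-- The action of the affine Weyl group on the root lattice,
`s_i λ = λ - ⟨α_i^∨, λ⟩ α_i`. -/
def rootRep (n : ℕ) : Weyl n →* Module.End ℤ (Lattice n) :=
  (sys n).lift ⟨refl (cartan n).transpose, liftable_root n⟩

/-- The canonical central element `K = α_0^∨ + ⋯ + α_n^∨`. -/
def central (n : ℕ) : Lattice n := ∑ i, basisVec i

/-- `β` is the coroot of a positive real root whose reflection is `t`: there are `u` and `i` such
that `t = u s_i u⁻¹`, the real root `u α_i` is positive, and `β = u α_i^∨`. -/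
def IsPosCoroot {n : ℕ} (t : Weyl n) (β : Lattice n) : Prop :=
  ∃ (u : Weyl n) (i : Fin (n + 1)), t = u * (sys n).simple i * u⁻¹ ∧
    0 ≤ rootRep n u (basisVec i) ∧ β = corootRep n u (basisVec i)

/-- `α_{vw}^∨`: the coroot of the positive real root with reflection `v⁻¹ w`. -/
noncomputable def coverCoroot {n : ℕ} (v w : Weyl n) : Lattice n :=
  Classical.epsilon (IsPosCoroot (v⁻¹ * w))

/-! ### The combinatorics -/

/-- Bruhat covers: `w` covers `v` if `v⁻¹ w` is a reflection and `ℓ(w) = ℓ(v) + 1`. -/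
def BruhatCovers {n : ℕ} (v w : Weyl n) : Prop :=
  (sys n).IsReflection (v⁻¹ * w) ∧ (sys n).length w = (sys n).length v + 1

/-- `ω` is a reduced word of `w`. -/
def IsReducedWord {n : ℕ} (w : Weyl n) (ω : List (Fin (n + 1))) : Prop :=
  (sys n).IsReduced ω ∧ (sys n).wordProd ω = w

/-- The word `1 2 ⋯ (n-1) n (n-1) ⋯ 1 0`, the reduced word of `ρ_{2n}`. -/
def rhoWord (n : ℕ) : List (Fin (n + 1)) :=
  (List.finRange (n + 1)).tail ++ (List.finRange (n + 1)).reverse.tail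

/-- The set `𝒵`: elements with a reduced word that is a subword (not necessarily contiguous) of
a rotation of the word of `ρ_{2n}`. -/
def zees (n : ℕ) : Set (Weyl n) :=
  {w | ∃ ω ω' : List (Fin (n + 1)), IsReducedWord w ω ∧ ω'.IsRotated (rhoWord n) ∧ ω.Sublist ω'}

/-- The support: the set of letters of the reduced words of `w` (any two reduced words of `w`
have the same letters). -/
def support {n : ℕ} (w : Weyl n) : Set (Fin (n + 1)) :=
  {i | ∃ ω, IsReducedWord w ω ∧ i ∈ ω}

/-- `c(w)`: the number of maximal nonempty subintervals of the support of `w`. -/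
noncomputable def numComponents {n : ℕ} (w : Weyl n) : ℕ :=
  Set.ncard {J : Set (Fin (n + 1)) |
    Maximal (fun J => J.Nonempty ∧ J.OrdConnected ∧ J ⊆ support w) J}

/-- `𝒞_v`: the Bruhat covers of `v` that lie in `𝒵`. -/
def zeeCovers {n : ℕ} (v : Weyl n) : Set (Weyl n) :=
  {w | w ∈ zees n ∧ BruhatCovers v w}

end AffineC

/-! The engine is a count of reduced subwords. For a word ω, `cnt ω w` counts the subwords (by
position) that are reduced words of w, and `coverSum ω v` adds the cover coroots of v over all
reduced subwords whose product covers v. Appending a letter changes both by explicit rules, and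
these preserve a closed form, `HasType`: coverSum ω v = cnt ω v • (a - v⁻¹ b). A letter i replaces a
by a + α_i^∨ if ⟨a, α_i⟩ = -1; a doubled letter ii replaces a by a + 2α_i^∨ if ⟨a, α_i⟩ = -2.

Fix a cut between the nodes p-1 and p, and put ε_p = α_p^∨ + ⋯ + α_n^∨ and T = ε_p - v⁻¹ ε_p. A
rotation of the given word consists of a low part p-1, …, 0, …, p-1 and a high part p, …, n, …, p,
in one of the two orders. Once the letters 0 and n are doubled, the order high-low has cover sum
cnt(v)(2K - T) and the order low-high has cnt(v)(2K + T). Doubling creates no new elements, since a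
reduced subword never uses both copies, but it gives a factor 2 for every component of the support.
An element w arising at the cut is counted 2^(c(w)+1) times by the two words together
(`cnt_add_cnt`): if both nodes at the cut lie in its support, one order alone produces it and the
cut splits a component; otherwise the factors commute and both orders produce it.

An element of 𝒵 that does not arise at the cut p is rigid (`zees_dichotomy`): it fixes ε_p, and each
of its cocovers involves both nodes at the cut. If v misses a node, cut next to that node. Then no
cover of v is rigid, v has the same count in both orders, T cancels, and the sum is four times the
claim. If v has full support, it arises from exactly one order at some cut and a term ±T is left
over. Exactly one cover of v in 𝒵 fixes ε_p; neither word counts it, and its coroot supplies the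
missing ±T. It exists because ℓ(v) < 2n (`exists_fixing_cover`), and it is unique because a coroot
determines its reflection (`eq_of_fix`).

The Coxeter theory behind this (signs of roots, strong exchange, supports) is derived from the
action on the two lattices. -/

namespace AffineC
variable {n : ℕ}

attribute [-simp] CoxeterMatrix.toCoxeterSystem_simple

local notation "𝐬" => CoxeterSystem.simple (sys _)
local notation "ℓ" => CoxeterSystem.length (sys _)
local notation "π" => CoxeterSystem.wordProd (sys _)
local notation "RD" => CoxeterSystem.IsRightDescent (sys _)

/-! ### Positivity of roots and coroots -/

/-- Both `cartan n` and its transpose satisfy this. -/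
def CartanLike (B : Matrix (Fin (n + 1)) (Fin (n + 1)) ℤ) : Prop :=
  (∀ i, B i i = 2) ∧ ∀ i j, i ≠ j → B i j ≤ 0 ∧ B j i ≤ 0 ∧
    (((coxeterMatrix n) i j = 2 ∧ B i j = 0 ∧ B j i = 0) ∨
      ((coxeterMatrix n) i j = 3 ∧ B i j * B j i = 1) ∨
      ((coxeterMatrix n) i j = 4 ∧ B i j * B j i = 2) ∨
      ((coxeterMatrix n) i j = 0 ∧ 4 ≤ B i j * B j i))

lemma coxeterMatrix_apply (i j : Fin (n + 1)) :
    (coxeterMatrix n) i j = if i = j then 1 else braidOrder (cartan n i j * cartan n j i) := rfl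

lemma cartanLike_cartan : CartanLike (cartan n) := by
  refine ⟨cartan_diag n, fun i j hij => ?_⟩
  rw [coxeterMatrix_apply, if_neg hij]
  have hv : i.val ≠ j.val := fun h => hij (Fin.ext h)
  unfold cartan braidOrder
  simp only [Matrix.of_apply, if_neg hij, if_neg hij.symm]
  split_ifs <;> omega

lemma cartanLike_transpose : CartanLike (cartan n).transpose := by
  refine ⟨cartan_diag n, fun i j hij => ?_⟩
  obtain ⟨h1, h2, h3⟩ := cartanLike_cartan.2 i j hij
  simp only [Matrix.transpose_apply]
  refine ⟨h2, h1, ?_⟩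
  rw [mul_comm (cartan n j i)]
  tauto

/-- A representation of the Weyl group through the reflections of a matrix. -/
structure ReflRep (B : Matrix (Fin (n + 1)) (Fin (n + 1)) ℤ)
    (ρ : Weyl n →* Module.End ℤ (Lattice n)) : Prop where
  cartanLike : CartanLike B
  simple : ∀ i, ρ (𝐬 i) = refl B i

lemma reflRep_coroot : ReflRep (cartan n) (corootRep n) :=
  ⟨cartanLike_cartan, fun i => (sys n).lift_apply_simple (liftable_coroot n) i⟩

lemma reflRep_root : ReflRep (cartan n).transpose (rootRep n) :=
  ⟨cartanLike_transpose, fun i => (sys n).lift_apply_simple (liftable_root n) i⟩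

lemma refl_basisVec (B : Matrix (Fin (n + 1)) (Fin (n + 1)) ℤ) (i j : Fin (n + 1)) :
    refl B i (basisVec j) = basisVec j - B j i • basisVec i := by
  rw [refl_apply]
  simp [basisVec, Pi.single_apply]

section Rep

variable {B : Matrix (Fin (n + 1)) (Fin (n + 1)) ℤ} {ρ : Weyl n →* Module.End ℤ (Lattice n)}

lemma ReflRep.simple_self (h : ReflRep B ρ) (i : Fin (n + 1)) :
    ρ (𝐬 i) (basisVec i) = -basisVec i := by
  rw [h.simple, refl_basisVec, h.cartanLike.1]; module

/-- Alternating words of length less than the order of the braid relation preserve positivity. -/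
lemma ReflRep.alternating (h : ReflRep B ρ) {i j : Fin (n + 1)} (hij : i ≠ j) (p : ℕ)
    (hp : p < (coxeterMatrix n) i j ∨ (coxeterMatrix n) i j = 0) :
    ∃ c d : ℤ, 0 ≤ c ∧ 0 ≤ d ∧
      ρ (π (CoxeterSystem.alternatingWord i j p)) (basisVec i) = c • basisVec i + d • basisVec j :=
          by
  obtain ⟨hd, hB⟩ := h.cartanLike
  obtain ⟨ha, hb, hm⟩ := hB i j hij
  have si : ∀ c d : ℤ, ρ (𝐬 i) (c • basisVec i + d • basisVec j)
      = (-c - d * B j i) • basisVec i + d • basisVec j := by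
    intro c d
    rw [map_add, map_smul, map_smul, h.simple, refl_basisVec, refl_basisVec, hd]; module
  have sj : ∀ c d : ℤ, ρ (𝐬 j) (c • basisVec i + d • basisVec j)
      = c • basisVec i + (-d - c * B i j) • basisVec j := by
    intro c d
    rw [map_add, map_smul, map_smul, h.simple, refl_basisVec, refl_basisVec, hd]; module
  have start : (basisVec i : Lattice n) = (1 : ℤ) • basisVec i + (0 : ℤ) • basisVec j := by simp
  obtain ⟨a, ha'⟩ : ∃ a, a = B i j := ⟨_, rfl⟩
  obtain ⟨b, hb'⟩ : ∃ b, b = B j i := ⟨_, rfl⟩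
  rw [← ha', ← hb'] at hm
  rw [← ha'] at ha sj
  rw [← hb'] at hb si
  have succ : ∀ p, π (CoxeterSystem.alternatingWord i j (p + 1)) =
      𝐬 (if Even p then j else i) * π (CoxeterSystem.alternatingWord i j p) := by
    intro p
    rw [CoxeterSystem.alternatingWord_succ', CoxeterSystem.wordProd_cons]
  by_cases h0 : (coxeterMatrix n) i j = 0
  · have hab : 4 ≤ a * b := by rcases hm with hm | hm | hm | hm <;> omega
    -- Nonnegativity alone is not inductive. The extra bound says that the coefficient changed by
    -- the next reflection does not decrease; 4 ≤ a * b hands the bound on to the other letter.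
    suffices H : ∃ c d : ℤ, 0 ≤ c ∧ 0 ≤ d ∧ (if Even p then 2 * d ≤ -a * c else 2 * c ≤ -b * d) ∧
      ρ (π (CoxeterSystem.alternatingWord i j p)) (basisVec i) = c • basisVec i + d • basisVec j by
      obtain ⟨c, d, h1, h2, -, h3⟩ := H; exact ⟨c, d, h1, h2, h3⟩
    clear hp
    induction p with
    | zero => exact ⟨1, 0, by simp, by simp, by simpa using ha, by simp
        [CoxeterSystem.alternatingWord]⟩
    | succ p ih =>
      obtain ⟨c, d, hc, hd', hcd, he⟩ := ih
      rw [succ, map_mul, Module.End.mul_apply, he]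
      by_cases hpe : Even p
      · rw [if_pos hpe] at hcd ⊢
        refine ⟨c, _, hc, ?_, ?_, sj c d⟩
        · linarith
        · rw [if_neg (by simpa [Nat.even_add_one] using hpe)]
          nlinarith
      · rw [if_neg hpe] at hcd ⊢
        refine ⟨_, d, ?_, hd', ?_, si c d⟩
        · linarith
        · rw [if_pos (by simpa [Nat.even_add_one] using hpe)]
          nlinarith
  · replace hp : p < (coxeterMatrix n) i j := by omega
    -- Finite bond orders are at most 4 under `CartanLike`, so only words of at most three letters
    -- occur.
    have hp4 : p < 4 := by rcases hm with hm | hm | hm | hm <;> omega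
    have h0 : π (CoxeterSystem.alternatingWord i j 0) = 1 := by simp [CoxeterSystem.alternatingWord]
    interval_cases p
    · exact ⟨1, 0, by simp, by simp, by simp [CoxeterSystem.alternatingWord]⟩
    · refine ⟨1, -a, by simp, by linarith, ?_⟩
      rw [succ, h0, mul_one, start]; simp only [Nat.even_iff]; norm_num; simpa using sj 1 0
    · refine ⟨-1 + a * b, -a, ?_, by linarith, ?_⟩
      · rcases hm with hm | hm | hm | hm <;> omega
      rw [succ, succ, h0, mul_one, start]; simp only [Nat.even_iff]; norm_num
      have := sj 1 0
      simp only [one_smul, zero_smul, add_zero] at this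
      rw [this]
      have := si 1 (- a)
      simp only [one_smul] at this
      convert this using 2 <;> simp
    · refine ⟨-1 + a * b, a * (2 - a * b), ?_, ?_, ?_⟩
      · rcases hm with hm | hm | hm | hm <;> omega
      · rcases hm with hm | hm | hm | hm
        · omega
        · omega
        · rw [hm.2]; simp
        · omega
      rw [succ, succ, succ, h0, mul_one, start]; simp only [Nat.even_iff]; norm_num
      have := sj 1 0
      simp only [one_smul, zero_smul, add_zero] at this
      rw [this]
      have := si 1 (- a)
      simp only [one_smul] at this
      have e2 : ρ (𝐬 i) (basisVec i + (-0 - 1 * a) • basisVec j) =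
        (-1 - -a * b) • basisVec i + -a • basisVec j := by rw [← this]; simp
      rw [e2, sj]
      congr 2 <;> ring

end Rep

/-- Strip the descents i and j until none is left. The stripped letters alternate, since a repeated
letter would cancel and contradict the length. The word `alternatingWord i j p` ends in j. -/
lemma exists_alternating_coset {i j : Fin (n + 1)} (w : Weyl n) :
    ∃ (v : Weyl n) (p : ℕ), (w = v * π (CoxeterSystem.alternatingWord i j p) ∨
      w = v * π (CoxeterSystem.alternatingWord j i p)) ∧ ℓ w = ℓ v + p ∧
      ¬ (sys n).IsRightDescent v i ∧ ¬ (sys n).IsRightDescent v j := by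
  induction hN : ℓ w using Nat.strong_induction_on generalizing w i j with
  | _ N ih =>
  by_cases hi : (sys n).IsRightDescent w i
  · have hlt := (sys n).isRightDescent_iff.1 hi
    obtain ⟨v, p, hw, hl, h1, h2⟩ := ih (ℓ (w * 𝐬 i)) (by omega) (i := i) (j := j) (w * 𝐬 i) rfl
    have hwe : w = w * 𝐬 i * 𝐬 i := by simp
    rcases hw with hw | hw
    · refine ⟨v, p + 1, Or.inr ?_, by omega, h1, h2⟩
      rw [CoxeterSystem.alternatingWord_succ, CoxeterSystem.wordProd_concat, ← mul_assoc, ← hw,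
          ← hwe]
    · cases p with
      | zero =>
        refine ⟨v, 1, Or.inr ?_, by omega, h1, h2⟩
        rw [CoxeterSystem.alternatingWord_succ, CoxeterSystem.wordProd_concat]
        rw [hwe, hw]; simp [CoxeterSystem.alternatingWord]
      | succ q =>
        exfalso
        rw [CoxeterSystem.alternatingWord_succ, CoxeterSystem.wordProd_concat, ← mul_assoc] at hw
        have h3 : w = v * π (CoxeterSystem.alternatingWord i j q) := by
          rw [hwe, hw]; simp
        have h4 := (sys n).length_mul_le v (π (CoxeterSystem.alternatingWord i j q))
        have h5 := (sys n).length_wordProd_le (CoxeterSystem.alternatingWord i j q)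
        rw [← h3] at h4
        simp at h5
        omega
  by_cases hj : (sys n).IsRightDescent w j
  · have hlt := (sys n).isRightDescent_iff.1 hj
    obtain ⟨v, p, hw, hl, h1, h2⟩ := ih (ℓ (w * 𝐬 j)) (by omega) (i := i) (j := j) (w * 𝐬 j) rfl
    have hwe : w = w * 𝐬 j * 𝐬 j := by simp
    rcases hw with hw | hw
    · cases p with
      | zero =>
        refine ⟨v, 1, Or.inl ?_, by omega, h1, h2⟩
        rw [CoxeterSystem.alternatingWord_succ, CoxeterSystem.wordProd_concat]
        rw [hwe, hw]; simp [CoxeterSystem.alternatingWord]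
      | succ q =>
        exfalso
        rw [CoxeterSystem.alternatingWord_succ, CoxeterSystem.wordProd_concat, ← mul_assoc] at hw
        have h3 : w = v * π (CoxeterSystem.alternatingWord j i q) := by
          rw [hwe, hw]; simp
        have h4 := (sys n).length_mul_le v (π (CoxeterSystem.alternatingWord j i q))
        have h5 := (sys n).length_wordProd_le (CoxeterSystem.alternatingWord j i q)
        rw [← h3] at h4
        simp at h5
        omega
    · refine ⟨v, p + 1, Or.inl ?_, by omega, h1, h2⟩
      rw [CoxeterSystem.alternatingWord_succ, CoxeterSystem.wordProd_concat, ← mul_assoc, ← hw,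
          ← hwe]
  · exact ⟨w, 0, by simp [CoxeterSystem.alternatingWord], by omega, hi, hj⟩

section Rep

variable {B : Matrix (Fin (n + 1)) (Fin (n + 1)) ℤ} {ρ : Weyl n →* Module.End ℤ (Lattice n)}

/-- If `ℓ (w s_i) > ℓ w` then `w α_i` is positive. -/
theorem ReflRep.nonneg (h : ReflRep B ρ) (w : Weyl n) (i : Fin (n + 1))
    (hw : ¬ (sys n).IsRightDescent w i) : 0 ≤ ρ w (basisVec i) := by
  induction hN : ℓ w using Nat.strong_induction_on generalizing w i with
  | _ N ih =>
  by_cases h1 : w = 1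
  · subst h1; simp [basisVec]
  obtain ⟨j, hj⟩ := (sys n).exists_rightDescent_of_ne_one h1
  have hij : i ≠ j := by rintro rfl; exact hw hj
  obtain ⟨v, p, hwv, hl, hvi, hvj⟩ := exists_alternating_coset (i := i) (j := j) w
  have hp : p ≠ 0 := by
    rintro rfl
    have : w = v := by simpa [CoxeterSystem.alternatingWord] using hwv
    exact hvj (this ▸ hj)
  have hwi := (sys n).not_isRightDescent_iff.1 hw
  rcases hwv with hwv | hwv
  -- If p reached the order of the bond, w s_i would be v times a non-reduced alternating word of
  -- length p + 1, against ℓ(w s_i) = ℓ(w) + 1.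
  · have hpm : p < (coxeterMatrix n) i j ∨ (coxeterMatrix n) i j = 0 := by
      by_contra! hcon
      have h2 : (coxeterMatrix n) j i = (coxeterMatrix n) i j := (coxeterMatrix n).symmetric j i
      have h3 := (sys n).not_isReduced_alternatingWord j i (m := p + 1) (by rw [h2]; exact hcon.2)
        (by omega)
      have h4 := (sys n).length_wordProd_le (CoxeterSystem.alternatingWord j i (p + 1))
      have h5 : ℓ (π (CoxeterSystem.alternatingWord j i (p + 1))) ≠ p + 1 := by
        intro h; exact h3 (by rw [CoxeterSystem.IsReduced, h]; simp)
      have h6 : w * 𝐬 i = v * π (CoxeterSystem.alternatingWord j i (p + 1)) := by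
        rw [CoxeterSystem.alternatingWord_succ, CoxeterSystem.wordProd_concat, ← mul_assoc, ← hwv]
      have h7 := (sys n).length_mul_le v (π (CoxeterSystem.alternatingWord j i (p + 1)))
      rw [← h6] at h7
      simp only [CoxeterSystem.length_alternatingWord] at h4
      omega
    obtain ⟨c, d, hc, hd, he⟩ := h.alternating hij p hpm
    rw [hwv, map_mul, Module.End.mul_apply, he, map_add, map_smul, map_smul]
    exact add_nonneg (smul_nonneg hc (ih _ (by omega) v i hvi rfl))
      (smul_nonneg hd (ih _ (by omega) v j hvj rfl))
  -- A nonempty alternating word ending in i would make i a descent of w.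
  · exfalso
    obtain ⟨q, rfl⟩ := Nat.exists_eq_succ_of_ne_zero hp
    rw [Nat.succ_eq_add_one, CoxeterSystem.alternatingWord_succ, CoxeterSystem.wordProd_concat,
      ← mul_assoc] at hwv
    have h3 : w * 𝐬 i = v * π (CoxeterSystem.alternatingWord i j q) := by rw [hwv]; simp
    have h4 := (sys n).length_mul_le v (π (CoxeterSystem.alternatingWord i j q))
    have h5 := (sys n).length_wordProd_le (CoxeterSystem.alternatingWord i j q)
    rw [← h3] at h4
    simp at h5
    omega

lemma ReflRep.nonpos (h : ReflRep B ρ) (w : Weyl n) (i : Fin (n + 1))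
    (hw : (sys n).IsRightDescent w i) : ρ w (basisVec i) ≤ 0 := by
  have h1 := h.nonneg (w * 𝐬 i) i ((sys n).isRightDescent_iff_not_isRightDescent_mul.1 hw)
  rw [map_mul, Module.End.mul_apply, h.simple_self, map_neg] at h1
  exact neg_nonneg.1 h1

lemma ReflRep.inv_apply (ρ : Weyl n →* Module.End ℤ (Lattice n)) (w : Weyl n) (x : Lattice n) :
    ρ w⁻¹ (ρ w x) = x := by
  rw [← Module.End.mul_apply, ← map_mul]; simp

lemma ReflRep.apply_inv (ρ : Weyl n →* Module.End ℤ (Lattice n)) (w : Weyl n) (x : Lattice n) :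
    ρ w (ρ w⁻¹ x) = x := by
  rw [← Module.End.mul_apply, ← map_mul]; simp

lemma basisVec_ne_zero (i : Fin (n + 1)) : (basisVec i : Lattice n) ≠ 0 := by
  simp [basisVec]

lemma ReflRep.ne_zero (ρ : Weyl n →* Module.End ℤ (Lattice n)) (w : Weyl n) (i : Fin (n + 1)) :
    ρ w (basisVec i) ≠ 0 := by
  intro h0
  have := ReflRep.inv_apply ρ w (basisVec i)
  rw [h0, map_zero] at this
  exact basisVec_ne_zero i this.symm

/-- Since no root has mixed signs, descents and signs determine each other. This holds for roots and
coroots alike, so positivity can be moved between the two lattices. -/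
lemma ReflRep.nonneg_iff (h : ReflRep B ρ) (w : Weyl n) (i : Fin (n + 1)) :
    0 ≤ ρ w (basisVec i) ↔ ¬ (sys n).IsRightDescent w i := by
  refine ⟨fun h1 h2 => ReflRep.ne_zero ρ w i (le_antisymm (h.nonpos w i h2) h1), h.nonneg w i⟩

lemma ReflRep.injective (h : ReflRep B ρ) : Function.Injective ρ := by
  rw [injective_iff_map_eq_one]
  intro w hw
  by_contra h1
  obtain ⟨j, hj⟩ := (sys n).exists_rightDescent_of_ne_one h1
  have := h.nonneg_iff w j
  rw [hw] at this
  exact this.1 (by simp [basisVec]) hj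

end Rep

/-! ### Reflections and the strong exchange property -/

/-- The pairing between the coroot lattice and the root lattice. -/
def pairing (n : ℕ) : Lattice n →ₗ[ℤ] Lattice n →ₗ[ℤ] ℤ := Matrix.toLinearMap₂' ℤ (cartan n)

lemma pairing_basisVec_right (x : Lattice n) (i : Fin (n + 1)) :
    pairing n x (basisVec i) = ∑ j, x j * cartan n j i := by
  simp [pairing, Matrix.toLinearMap₂'_apply, basisVec, Pi.single_apply]

lemma pairing_basisVec_left (x : Lattice n) (i : Fin (n + 1)) :
    pairing n (basisVec i) x = ∑ j, x j * cartan n i j := by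
  simp [pairing, Matrix.toLinearMap₂'_apply, basisVec, Pi.single_apply]

lemma corootRep_simple (i : Fin (n + 1)) (x : Lattice n) :
    corootRep n (𝐬 i) x = x - pairing n x (basisVec i) • basisVec i := by
  rw [reflRep_coroot.simple, refl_apply, pairing_basisVec_right]

lemma rootRep_simple (i : Fin (n + 1)) (x : Lattice n) :
    rootRep n (𝐬 i) x = x - pairing n (basisVec i) x • basisVec i := by
  rw [reflRep_root.simple, refl_apply, pairing_basisVec_left]; rfl

lemma pairing_self (i : Fin (n + 1)) : pairing n (basisVec i) (basisVec i) = 2 := by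
  rw [pairing_basisVec_left]; simp [basisVec, Pi.single_apply, cartan_diag]

lemma pairing_invariant (w : Weyl n) (x y : Lattice n) :
    pairing n (corootRep n w x) (rootRep n w y) = pairing n x y := by
  induction w using (sys n).simple_induction_left with
  | one => simp
  | mul_simple_left w i ih =>
    rw [map_mul, map_mul, Module.End.mul_apply, Module.End.mul_apply, corootRep_simple,
      rootRep_simple]
    simp only [map_sub, map_smul, LinearMap.sub_apply, LinearMap.smul_apply, smul_eq_mul, ih,
      pairing_self]
    ring

lemma corootRep_reflection (u : Weyl n) (i : Fin (n + 1)) (x : Lattice n) :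
    corootRep n (u * 𝐬 i * u⁻¹) x =
      x - pairing n x (rootRep n u (basisVec i)) • corootRep n u (basisVec i) := by
  rw [map_mul, map_mul, Module.End.mul_apply, Module.End.mul_apply, corootRep_simple, map_sub,
    map_smul, ReflRep.apply_inv]
  congr 2
  rw [← pairing_invariant u, ReflRep.apply_inv]

section Rep
variable {B : Matrix (Fin (n + 1)) (Fin (n + 1)) ℤ} {ρ : Weyl n →* Module.End ℤ (Lattice n)}

lemma refl_apply_of_ne (i k : Fin (n + 1)) (h : k ≠ i) (x : Lattice n) : refl B i x k = x k := by
  rw [refl_apply]; simp [basisVec, h]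

/-- The reflection s_p changes only the coordinate p, so a positive vector that it makes negative is
a multiple of e_p; the factor is 1 because g⁻¹ is integral. -/
lemma ReflRep.eq_basisVec (h : ReflRep B ρ) {g : Weyl n} {i p : Fin (n + 1)} (h1 : ¬ RD g i)
    (h2 : RD (𝐬 p * g) i) : ρ g (basisVec i) = basisVec p := by
  have h3 := h.nonneg g i h1
  have h4 := h.nonpos _ i h2
  rw [map_mul, Module.End.mul_apply, h.simple] at h4
  have h5 : ρ g (basisVec i) = (ρ g (basisVec i) p) • basisVec p := by
    ext k
    by_cases hk : k = p
    · subst hk; simp [basisVec]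
    · have h6 := h4 k
      rw [refl_apply_of_ne p k hk] at h6
      have h7 := h3 k
      simp only [Pi.zero_apply] at h6 h7
      rw [Pi.smul_apply, smul_eq_mul, show (basisVec p : Lattice n) k = 0 by simp [basisVec, hk],
        mul_zero]
      exact le_antisymm h6 h7
  obtain ⟨c, hc⟩ : ∃ c, c = ρ g (basisVec i) p := ⟨_, rfl⟩
  rw [← hc] at h5
  have hc0 : 0 ≤ c := by rw [hc]; exact h3 p
  have h6 := ReflRep.inv_apply ρ g (basisVec i)
  rw [h5, map_smul] at h6
  have h7 := congrFun h6 i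
  simp [basisVec] at h7
  have := Int.eq_one_of_mul_eq_one_right hc0 h7
  rw [h5, this, one_smul]

end Rep

/-- By `ReflRep.eq_basisVec`, g carries both the root and the coroot of i to those of p. Hence g s_i
g⁻¹ and s_p act in the same way, and the action is faithful. -/
lemma mul_simple_eq_simple_mul {g : Weyl n} {i p : Fin (n + 1)} (h1 : ¬ RD g i)
    (h2 : RD (𝐬 p * g) i) : g * 𝐬 i = 𝐬 p * g := by
  have h3 := reflRep_coroot.eq_basisVec h1 h2
  have h4 := reflRep_root.eq_basisVec h1 h2
  have h5 : g * 𝐬 i * g⁻¹ = 𝐬 p := by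
    apply reflRep_coroot.injective
    refine LinearMap.ext fun x => ?_
    rw [corootRep_reflection, h3, h4, corootRep_simple]
  rw [← h5]; group

/-- The strong exchange property. -/
lemma strong_exchange (ω : List (Fin (n + 1))) {u : Weyl n} {i : Fin (n + 1)} (h1 : ¬ RD u i)
    (h2 : RD (π ω * u) i) :
    ∃ A k C, ω = A ++ k :: C ∧ u * 𝐬 i * u⁻¹ = (π C)⁻¹ * 𝐬 k * π C := by
  induction ω with
  | nil => simp at h2; exact absurd h2 h1
  | cons k ω ih =>
    by_cases h3 : RD (π ω * u) i
    · obtain ⟨A, l, C, h, h'⟩ := ih h3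
      exact ⟨k :: A, l, C, by simp [h], h'⟩
    -- Reading the word from the right, k is the letter at which the root u α_i turns negative; just
    -- before that letter the root is α_k.
    · refine ⟨[], k, ω, rfl, ?_⟩
      rw [CoxeterSystem.wordProd_cons, mul_assoc] at h2
      have := mul_simple_eq_simple_mul h3 h2
      rw [← mul_assoc, mul_assoc (π ω) u] at this
      have h5 : u * 𝐬 i = (π ω)⁻¹ * (𝐬 k * π ω * u) := by rw [← this]; group
      rw [h5]; group

/-! ### Reflections and their positive coroots -/

lemma exists_positive_conj {t : Weyl n} (ht : (sys n).IsReflection t) :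
    ∃ u i, t = u * 𝐬 i * u⁻¹ ∧ ¬ RD u i := by
  obtain ⟨u, i, rfl⟩ := ht
  by_cases h : RD u i
  · refine ⟨u * 𝐬 i, i, by simp [mul_assoc], (sys n).isRightDescent_iff_not_isRightDescent_mul.1 h⟩
  · exact ⟨u, i, rfl, h⟩

/-- Strong exchange deletes a letter when w makes the positive root of t negative. The converse is
the same fact for w t, which acts on that root with the opposite sign. -/
lemma length_mul_reflection_lt {w u : Weyl n} {i : Fin (n + 1)} (h1 : ¬ RD u i) :
    ℓ (w * (u * 𝐬 i * u⁻¹)) < ℓ w ↔ RD (w * u) i := by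
  have key : ∀ w : Weyl n, RD (w * u) i → ℓ (w * (u * 𝐬 i * u⁻¹)) < ℓ w := by
    intro w hw
    obtain ⟨ω, hω, rfl⟩ := (sys n).exists_isReduced w
    obtain ⟨A, k, C, rfl, h⟩ := strong_exchange ω h1 hw
    rw [h, hω]
    have : π (A ++ k :: C) * ((π C)⁻¹ * 𝐬 k * π C) = π (A ++ C) := by
      simp only [CoxeterSystem.wordProd_append, CoxeterSystem.wordProd_cons]
      simp [mul_assoc]
    rw [this]
    refine lt_of_le_of_lt ((sys n).length_wordProd_le _) (by simp)
  refine ⟨fun h => ?_, key w⟩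
  by_contra h2
  have h3 := key (w * (u * 𝐬 i * u⁻¹)) (by
    have : w * (u * 𝐬 i * u⁻¹) * u = w * u * 𝐬 i := by group
    rw [this]
    by_contra h4
    exact h2 ((sys n).isRightDescent_iff_not_isRightDescent_mul.2 h4))
  have : w * (u * 𝐬 i * u⁻¹) * (u * 𝐬 i * u⁻¹) = w := by simp [mul_assoc]
  rw [this] at h3
  omega

lemma isPosCoroot_iff {t : Weyl n} {β : Lattice n} :
    IsPosCoroot t β ↔ ∃ u i, t = u * 𝐬 i * u⁻¹ ∧ ¬ RD u i ∧ β = corootRep n u (basisVec i) := by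
  unfold IsPosCoroot
  simp only [reflRep_root.nonneg_iff]

lemma IsPosCoroot.nonneg {t : Weyl n} {β : Lattice n} (h : IsPosCoroot t β) : 0 ≤ β := by
  obtain ⟨u, i, -, h', rfl⟩ := isPosCoroot_iff.1 h
  exact reflRep_coroot.nonneg u i h'

lemma IsPosCoroot.ne_zero {t : Weyl n} {β : Lattice n} (h : IsPosCoroot t β) : β ≠ 0 := by
  obtain ⟨u, i, -, h, rfl⟩ := isPosCoroot_iff.1 h
  exact ReflRep.ne_zero _ u i

/-- A positive coroot is primitive. -/
lemma IsPosCoroot.dvd {t : Weyl n} {β γ : Lattice n} (h : IsPosCoroot t β) {a m : ℤ}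
    (hm : a • β = m • γ) : m ∣ a := by
  obtain ⟨u, i, -, h, rfl⟩ := isPosCoroot_iff.1 h
  have h1 := congrArg (corootRep n u⁻¹) hm
  rw [map_smul, map_smul, ReflRep.inv_apply] at h1
  have h2 := congrFun h1 i
  simp [basisVec] at h2
  exact ⟨_, h2⟩

/-- Proportional primitive vectors agree up to sign, and positivity settles the sign. -/
lemma IsPosCoroot.eq_of_smul {t t' : Weyl n} {β β' : Lattice n} (h : IsPosCoroot t β)
    (h' : IsPosCoroot t' β') {a b : ℤ} (ha : a ≠ 0) (hm : a • β = b • β') : β = β' := by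
  obtain ⟨d, hd⟩ := h.dvd hm
  obtain ⟨e, he⟩ := h'.dvd hm.symm
  have h1 : d * e = 1 := by
    have : a * (d * e) = a * 1 := by rw [mul_one]; nth_rw 2 [hd]; rw [he]; ring
    exact mul_left_cancel₀ ha this
  rcases Int.eq_one_or_neg_one_of_mul_eq_one h1 with rfl | rfl
  · rw [mul_one] at hd; subst hd
    exact smul_right_injective _ ha hm
  · exfalso
    have h2 : a = -b := by rw [hd]; ring
    subst h2
    have h3 : β = -β' := smul_right_injective _ ha (by simpa using hm)
    have h4 : β = 0 := le_antisymm (by rw [h3]; exact neg_nonpos.2 h'.nonneg) h.nonneg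
    exact h.ne_zero h4

lemma IsPosCoroot.reflection {t : Weyl n} {β : Lattice n} (h : IsPosCoroot t β) (x : Lattice n) :
    ∃ c : ℤ, corootRep n t x = x - c • β := by
  obtain ⟨u, i, rfl, -, rfl⟩ := h
  exact ⟨_, corootRep_reflection u i x⟩

lemma IsPosCoroot.reflection_self {t : Weyl n} {β : Lattice n} (h : IsPosCoroot t β) :
    corootRep n t β = -β := by
  obtain ⟨u, i, rfl, -, rfl⟩ := h
  rw [corootRep_reflection, pairing_invariant, pairing_self]; module

/-- Evaluating t at β in two ways gives -β = β - cβ', so 2β = cβ'. -/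
lemma IsPosCoroot.unique {t : Weyl n} {β β' : Lattice n} (h : IsPosCoroot t β)
    (h' : IsPosCoroot t β') : β = β' := by
  obtain ⟨c, hc⟩ := h'.reflection β
  rw [h.reflection_self] at hc
  refine h.eq_of_smul h' (a := 2) (b := c) (by norm_num) ?_
  rw [two_smul]
  linear_combination (exp := 1) -hc

/-- If u α_i^∨ = u' α_j^∨, then u'⁻¹ u carries α_i^∨ to α_j^∨ and therefore intertwines s_i and s_j.
-/
lemma IsPosCoroot.reflection_unique {t t' : Weyl n} {β : Lattice n} (h : IsPosCoroot t β)
    (h' : IsPosCoroot t' β) : t = t' := by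
  obtain ⟨u, i, rfl, -, hb⟩ := h
  obtain ⟨u', j, rfl, -, hb'⟩ := h'
  have h1 : corootRep n (u'⁻¹ * u) (basisVec i) = basisVec j := by
    rw [map_mul, Module.End.mul_apply, ← hb, hb', ReflRep.inv_apply]
  have h2 : ¬ RD (u'⁻¹ * u) i := by
    rw [← reflRep_coroot.nonneg_iff, h1]; simp [basisVec]
  have h3 : RD (𝐬 j * (u'⁻¹ * u)) i := by
    by_contra h3
    rw [← reflRep_coroot.nonneg_iff, map_mul, Module.End.mul_apply, h1,
      reflRep_coroot.simple_self] at h3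
    have := h3 j
    simp [basisVec] at this
  have h4 := mul_simple_eq_simple_mul h2 h3
  have h5 : u * 𝐬 i = u' * (u'⁻¹ * u * 𝐬 i) := by group
  rw [h5, h4]; group

lemma exists_isPosCoroot {t : Weyl n} (ht : (sys n).IsReflection t) : ∃ β, IsPosCoroot t β := by
  obtain ⟨u, i, h, h'⟩ := exists_positive_conj ht
  exact ⟨_, isPosCoroot_iff.2 ⟨u, i, h, h', rfl⟩⟩

/-! ### Bruhat covers and their coroots -/

lemma BruhatCovers.isPosCoroot {v w : Weyl n} (h : BruhatCovers v w) :
    IsPosCoroot (v⁻¹ * w) (coverCoroot v w) :=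
  Classical.epsilon_spec (exists_isPosCoroot h.1)

lemma coverCoroot_eq {v w : Weyl n} {β : Lattice n} (h : IsPosCoroot (v⁻¹ * w) β) :
    coverCoroot v w = β :=
  (Classical.epsilon_spec (p := IsPosCoroot (v⁻¹ * w)) ⟨β, h⟩ : IsPosCoroot _ _).unique h

lemma bruhatCovers_mul_simple {v : Weyl n} {i : Fin (n + 1)} (h : ¬ RD v i) :
    BruhatCovers v (v * 𝐬 i) ∧ coverCoroot v (v * 𝐬 i) = basisVec i := by
  refine ⟨⟨by simpa using (sys n).isReflection_simple i, (sys n).not_isRightDescent_iff.1 h⟩, ?_⟩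
  exact coverCoroot_eq (isPosCoroot_iff.2
    ⟨1, i, by simp, (sys n).not_isRightDescent_one i, by simp⟩)

lemma isReduced_append {A C : List (Fin (n + 1))} (h : (sys n).IsReduced (A ++ C)) :
    (sys n).IsReduced A ∧ (sys n).IsReduced C :=
  ⟨by simpa using h.take A.length, by simpa using h.drop A.length⟩

lemma isReduced_concat_iff {A : List (Fin (n + 1))} {i : Fin (n + 1)} :
    (sys n).IsReduced (A ++ [i]) ↔ (sys n).IsReduced A ∧ ¬ RD (π A) i := by
  constructor
  · intro h
    refine ⟨(isReduced_append h).1, ?_⟩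
    have h1 := (isReduced_append h).1
    rw [(sys n).not_isRightDescent_iff]
    simp only [CoxeterSystem.IsReduced, CoxeterSystem.wordProd_append,
      CoxeterSystem.wordProd_singleton, List.length_append, List.length_singleton] at h h1
    omega
  · rintro ⟨h1, h2⟩
    rw [(sys n).not_isRightDescent_iff] at h2
    simp only [CoxeterSystem.IsReduced, CoxeterSystem.wordProd_append,
      CoxeterSystem.wordProd_singleton, List.length_append, List.length_singleton] at h1 ⊢
    omega

lemma isReduced_cons_iff {A : List (Fin (n + 1))} {i : Fin (n + 1)} :
    (sys n).IsReduced (i :: A) ↔ (sys n).IsReduced A ∧ ¬ RD (π A)⁻¹ i := by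
  rw [← (sys n).isReduced_reverse_iff, List.reverse_cons, isReduced_concat_iff,
    (sys n).isReduced_reverse_iff, CoxeterSystem.wordProd_reverse]

/-- A Bruhat cover deletes one letter of any given reduced word. -/
lemma BruhatCovers.exists_deletion {v : Weyl n} {ω : List (Fin (n + 1))}
    (hω : (sys n).IsReduced ω) (h : BruhatCovers v (π ω)) :
    ∃ A k C, ω = A ++ k :: C ∧ v = π (A ++ C) ∧ (sys n).IsReduced (A ++ C) ∧
      v⁻¹ * π ω = (π C)⁻¹ * 𝐬 k * π C ∧
      coverCoroot v (π ω) = corootRep n (π C)⁻¹ (basisVec k) := by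
  obtain ⟨u, i, hu, hi⟩ := exists_positive_conj h.1
  have hinv := h.1.inv
  have hv : v = π ω * (u * 𝐬 i * u⁻¹) := by
    rw [← hu, ← hinv]; group
  have h1 : RD (π ω * u) i := by
    rw [← length_mul_reflection_lt hi, ← hv]; have := h.2; omega
  obtain ⟨A, k, C, rfl, h2⟩ := strong_exchange ω hi h1
  have h3 : v = π (A ++ C) := by
    rw [hv, h2]
    simp only [CoxeterSystem.wordProd_append, CoxeterSystem.wordProd_cons]
    simp [mul_assoc]
  refine ⟨A, k, C, rfl, h3, ?_, by rw [hu, h2], ?_⟩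
  · have := h.2
    rw [CoxeterSystem.IsReduced] at hω ⊢
    rw [← h3]
    rw [hω] at this
    simp at this ⊢; omega
  · apply coverCoroot_eq
    rw [isPosCoroot_iff]
    refine ⟨(π C)⁻¹, k, by rw [hu, h2]; simp, ?_, rfl⟩
    exact (isReduced_cons_iff.1 (isReduced_append hω).2).2

/-- The reflection of the inverse pair is the conjugate by v of the original one. The coroot moved
by v stays positive because the length goes up. -/
lemma BruhatCovers.inv {v w : Weyl n} (h : BruhatCovers v w) :
    BruhatCovers v⁻¹ w⁻¹ ∧ coverCoroot v⁻¹ w⁻¹ = corootRep n v (coverCoroot v w) := by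
  obtain ⟨u, i, hu, hi⟩ := exists_positive_conj h.1
  have hw : w = v * (u * 𝐬 i * u⁻¹) := by rw [← hu]; group
  have e : v⁻¹⁻¹ * w⁻¹ = (v * u) * 𝐬 i * (v * u)⁻¹ := by rw [hw]; simp [mul_assoc]
  have hl := h.2
  refine ⟨⟨by rw [e]; exact ⟨_, _, rfl⟩, by simpa using hl⟩, ?_⟩
  have h1 : coverCoroot v w = corootRep n u (basisVec i) :=
    coverCoroot_eq (isPosCoroot_iff.2 ⟨u, i, hu, hi, rfl⟩)
  rw [h1, ← Module.End.mul_apply, ← map_mul]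
  refine coverCoroot_eq (isPosCoroot_iff.2 ⟨v * u, i, e, ?_, rfl⟩)
  rw [← length_mul_reflection_lt hi, ← hw]; omega

/-! ### Parabolic subgroups and supports -/

/-- `w` is a product of simple reflections indexed by `J`. -/
def InPar (J : Set (Fin (n + 1))) (w : Weyl n) : Prop := ∃ ω : List (Fin (n + 1)), (∀ i ∈ ω, i ∈ J)
    ∧ π ω = w

namespace InPar
variable {J J' : Set (Fin (n + 1))} {v w : Weyl n}

lemma one (J : Set (Fin (n + 1))) : InPar J 1 := ⟨[], by simp, by simp⟩

lemma simple {i : Fin (n + 1)} (h : i ∈ J) : InPar J (𝐬 i) := ⟨[i], by simpa, by simp⟩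

lemma mul (hv : InPar J v) (hw : InPar J w) : InPar J (v * w) := by
  obtain ⟨ω, h, rfl⟩ := hv
  obtain ⟨ω', h', rfl⟩ := hw
  exact ⟨ω ++ ω', by simp; grind, by rw [CoxeterSystem.wordProd_append]⟩

lemma inv (hv : InPar J v) : InPar J v⁻¹ := by
  obtain ⟨ω, h, rfl⟩ := hv
  exact ⟨ω.reverse, by simpa, by simp⟩

lemma mono (h : J ⊆ J') (hv : InPar J v) : InPar J' v := by
  obtain ⟨ω, h', rfl⟩ := hv
  exact ⟨ω, fun i hi => h (h' i hi), rfl⟩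

lemma induction {p : Weyl n → Prop} (one : p 1) (cons : ∀ i ∈ J, ∀ w, p w → p (𝐬 i * w))
    (h : InPar J w) : p w := by
  obtain ⟨ω, h, rfl⟩ := h
  induction ω with
  | nil => simpa using one
  | cons i ω ih =>
    rw [CoxeterSystem.wordProd_cons]
    exact cons i (h i (by simp)) _ (ih fun j hj => h j (by simp [hj]))

/-- Coordinates outside `J` are preserved. -/
lemma rep_apply {B : Matrix (Fin (n + 1)) (Fin (n + 1)) ℤ}
    {ρ : Weyl n →* Module.End ℤ (Lattice n)} (hρ : ReflRep B ρ) (h : InPar J w)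
    {k : Fin (n + 1)} (hk : k ∉ J) (x : Lattice n) : ρ w x k = x k := by
  refine InPar.induction (p := fun w => ρ w x k = x k) (by simp) (fun i hi w ih => ?_) h
  rw [map_mul, Module.End.mul_apply, hρ.simple, refl_apply_of_ne i k (by grind), ih]

/-- Split the word as A, k, C at the first occurrence of a letter k outside J. The vector π(A) α_k^∨
has k-coordinate 1, and the inverse of the whole word sends it to -π(C)⁻¹ α_k^∨, whose k-coordinate
is not positive by reducedness. An element of the parabolic subgroup of J cannot change that
coordinate. -/
lemma subset_of_isReduced {ω : List (Fin (n + 1))} (hω : (sys n).IsReduced ω)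
    (h : InPar J (π ω)) : ∀ i ∈ ω, i ∈ J := by
  intro k hk
  by_contra hkJ
  obtain ⟨A, C, rfl, hA⟩ := List.eq_append_cons_of_mem hk
  have h1 := h.inv.rep_apply reflRep_coroot hkJ (corootRep n (π A) (basisVec k))
  have h2 : InPar {i | i ∈ A} (π A) := ⟨A, by simp, rfl⟩
  rw [h2.rep_apply reflRep_coroot hA] at h1
  have h3 : (π (A ++ k :: C))⁻¹ = (π C)⁻¹ * 𝐬 k * (π A)⁻¹ := by
    rw [CoxeterSystem.wordProd_append, CoxeterSystem.wordProd_cons]; simp [mul_assoc]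
  rw [h3, map_mul, Module.End.mul_apply, ReflRep.inv_apply, map_mul, Module.End.mul_apply,
    reflRep_coroot.simple_self, map_neg] at h1
  have h4 := reflRep_coroot.nonneg _ _ (isReduced_cons_iff.1 (isReduced_append hω).2).2 k
  simp [basisVec] at h1 h4
  omega

end InPar

lemma exists_isReducedWord (w : Weyl n) : ∃ ω, IsReducedWord w ω := by
  obtain ⟨ω, h, rfl⟩ := (sys n).exists_isReduced w
  exact ⟨ω, h, rfl⟩

lemma IsReducedWord.mem_support {w : Weyl n} {ω : List (Fin (n + 1))} (h : IsReducedWord w ω)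
    {i : Fin (n + 1)} : i ∈ support w ↔ i ∈ ω := by
  refine ⟨?_, fun hi => ⟨ω, h, hi⟩⟩
  rintro ⟨ω', h', hi⟩
  have : InPar {i | i ∈ ω} (π ω') := ⟨ω, by simp, by rw [h.2, h'.2]⟩
  exact this.subset_of_isReduced h'.1 i hi

lemma inPar_iff_support {J : Set (Fin (n + 1))} {w : Weyl n} : InPar J w ↔ support w ⊆ J := by
  obtain ⟨ω, h, rfl⟩ := exists_isReducedWord w
  constructor
  · intro h' i hi
    exact h'.subset_of_isReduced h i ((show IsReducedWord (π ω) ω from ⟨h, rfl⟩).mem_support.1 hi)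
  · intro h'
    exact ⟨ω, fun i hi => h' ⟨ω, ⟨h, rfl⟩, hi⟩, rfl⟩

lemma inPar_support (w : Weyl n) : InPar (support w) w := inPar_iff_support.2 subset_rfl

lemma support_mul {x y : Weyl n} (h : ℓ (x * y) = ℓ x + ℓ y) :
    support (x * y) = support x ∪ support y := by
  obtain ⟨ω, hω, rfl⟩ := exists_isReducedWord x
  obtain ⟨ω', hω', rfl⟩ := exists_isReducedWord y
  have h1 : IsReducedWord (π ω * π ω') (ω ++ ω') :=
    ⟨by rw [CoxeterSystem.IsReduced, CoxeterSystem.wordProd_append, h, hω, hω']; simp,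
      by rw [CoxeterSystem.wordProd_append]⟩
  ext i
  rw [h1.mem_support, Set.mem_union, IsReducedWord.mem_support ⟨hω, rfl⟩,
    IsReducedWord.mem_support ⟨hω', rfl⟩, List.mem_append]

@[simp] lemma support_one : support (1 : Weyl n) = ∅ := by
  have := inPar_iff_support.1 (InPar.one (n := n) ∅)
  exact Set.subset_empty_iff.1 this

@[simp] lemma support_simple (i : Fin (n + 1)) : support (𝐬 i) = {i} := by
  have h : IsReducedWord (𝐬 i) [i] := ⟨by simp [CoxeterSystem.IsReduced], by simp⟩
  ext j; rw [h.mem_support]; simp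

@[simp] lemma support_inv (w : Weyl n) : support w⁻¹ = support w := by
  have key : ∀ w : Weyl n, support w⁻¹ ⊆ support w := fun w =>
    inPar_iff_support.1 (inPar_support w).inv
  exact (key w).antisymm (by simpa using key w⁻¹)

lemma BruhatCovers.support_subset {v w : Weyl n} (h : BruhatCovers v w) :
    support v ⊆ support w := by
  obtain ⟨ω, hω, rfl⟩ := exists_isReducedWord w
  obtain ⟨A, k, C, rfl, rfl, h1, -⟩ := h.exists_deletion hω
  intro i hi
  rw [IsReducedWord.mem_support ⟨h1, rfl⟩] at hi
  rw [IsReducedWord.mem_support ⟨hω, rfl⟩]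
  simp at hi ⊢; tauto

/-! ### Products over disjoint sets of nodes -/

section Product
variable {J I : Set (Fin (n + 1))} {x y : Weyl n}

/-- The vector x α_i^∨ has a nonzero coordinate in I, whose sign decides about the descent and which
y leaves alone. No commutation between J and I is needed. -/
lemma isRightDescent_mul_iff (hJI : Disjoint J I) (hy : InPar J y) (hx : InPar I x)
    {i : Fin (n + 1)} (hi : i ∈ I) : RD (y * x) i ↔ RD x i := by
  have key : ∃ k ∈ I, corootRep n x (basisVec i) k ≠ 0 := by
    by_contra! hcon
    apply ReflRep.ne_zero (corootRep n) x i
    ext k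
    by_cases hk : k ∈ I
    · exact hcon k hk
    · rw [hx.rep_apply reflRep_coroot hk]
      have : k ≠ i := by rintro rfl; exact hk hi
      simp [basisVec, this]
  obtain ⟨k, hk, hk0⟩ := key
  have hkJ : k ∉ J := fun h => Set.disjoint_left.1 hJI h hk
  have h1 : corootRep n (y * x) (basisVec i) k = corootRep n x (basisVec i) k := by
    rw [map_mul, Module.End.mul_apply, hy.rep_apply reflRep_coroot hkJ]
  constructor
  · intro h2
    by_contra h3
    have h4 := reflRep_coroot.nonpos _ i h2 k
    have h5 := reflRep_coroot.nonneg _ i h3 k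
    rw [h1] at h4
    exact hk0 (le_antisymm h4 h5)
  · intro h2
    by_contra h3
    have h4 := reflRep_coroot.nonpos _ i h2 k
    have h5 := reflRep_coroot.nonneg _ i h3 k
    rw [h1] at h5
    exact hk0 (le_antisymm h4 h5)

lemma isReduced_append_of_disjoint {ω ω' : List (Fin (n + 1))} (hJI : Disjoint J I)
    (hω : ∀ i ∈ ω, i ∈ J) (hω' : ∀ i ∈ ω', i ∈ I) (h : (sys n).IsReduced ω)
    (h' : (sys n).IsReduced ω') : (sys n).IsReduced (ω ++ ω') := by
  induction ω' using List.reverseRecOn with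
  | nil => simpa
  | append_singleton ω' i ih =>
    rw [isReduced_concat_iff] at h'
    rw [← List.append_assoc, isReduced_concat_iff]
    refine ⟨ih (fun j hj => hω' j (by simp [hj])) h'.1, ?_⟩
    rw [CoxeterSystem.wordProd_append, isRightDescent_mul_iff hJI ⟨ω, hω, rfl⟩
      ⟨ω', fun j hj => hω' j (by simp [hj]), rfl⟩ (hω' i (by simp))]
    exact h'.2

lemma length_mul_of_disjoint (hJI : Disjoint J I) (hy : InPar J y) (hx : InPar I x) :
    ℓ (y * x) = ℓ y + ℓ x := by
  obtain ⟨ω, hω, rfl⟩ := exists_isReducedWord x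
  obtain ⟨ω', hω', rfl⟩ := exists_isReducedWord y
  have := isReduced_append_of_disjoint hJI (hy.subset_of_isReduced hω')
    (hx.subset_of_isReduced hω) hω' hω
  rw [CoxeterSystem.IsReduced, CoxeterSystem.wordProd_append] at this
  rw [this, hω, hω']; simp

lemma support_mul_of_disjoint (hJI : Disjoint J I) (hy : InPar J y) (hx : InPar I x) :
    support (y * x) = support y ∪ support x := support_mul (length_mul_of_disjoint hJI hy hx)

lemma InPar.eq_one_of_disjoint (hJI : Disjoint J I) (h1 : InPar J x) (h2 : InPar I x) : x = 1 := by
  have h3 := length_mul_of_disjoint hJI h1 h2.inv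
  simp only [mul_inv_cancel, CoxeterSystem.length_one, CoxeterSystem.length_inv] at h3
  exact (sys n).length_eq_zero_iff.1 (by omega)

lemma simple_commute {i j : Fin (n + 1)} (h : i.val + 1 < j.val ∨ j.val + 1 < i.val) :
    Commute (𝐬 i) (𝐬 j) := by
  have h1 := (sys n).simple_mul_simple_pow i j
  have hij : i ≠ j := by rintro rfl; omega
  have h2 : (coxeterMatrix n) i j = 2 := by
    rw [coxeterMatrix_apply, if_neg hij]
    have : cartan n i j = 0 := by
      simp only [cartan, Matrix.of_apply, if_neg hij]
      rw [if_neg (by omega)]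
    simp [this, braidOrder]
  rw [h2, pow_two] at h1
  have h3 := eq_inv_of_mul_eq_one_left h1
  rw [mul_inv_rev, CoxeterSystem.inv_simple, CoxeterSystem.inv_simple] at h3
  exact h3

/-- Parabolic subgroups of index sets without bonds between them commute. -/
lemma InPar.commute (hJI : ∀ i ∈ J, ∀ j ∈ I, i.val + 1 < j.val ∨ j.val + 1 < i.val)
    (hy : InPar J y) (hx : InPar I x) : Commute y x := by
  refine InPar.induction (p := fun y => Commute y x) (Commute.one_left _) (fun i hi y ihy => ?_) hy
  refine Commute.mul_left ?_ ihy
  refine InPar.induction (p := fun x => Commute (𝐬 i) x) (Commute.one_right _)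
    (fun j hj x ihx => ?_) hx
  exact Commute.mul_right (simple_commute (hJI i hi j hj)) ihx

end Product

/-- An antidominant vector moves up; the support is visible in the difference. -/
lemma InPar.rep_sub_nonneg {B : Matrix (Fin (n + 1)) (Fin (n + 1)) ℤ}
    {ρ : Weyl n →* Module.End ℤ (Lattice n)} (hρ : ReflRep B ρ) {J : Set (Fin (n + 1))}
    {μ : Lattice n} {c : Fin (n + 1) → ℤ} (hc : ∀ i ∈ J, 0 ≤ c i)
    (hμ : ∀ i ∈ J, ρ (𝐬 i) μ = μ + c i • basisVec i) {w : Weyl n} (hw : InPar J w) :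
    0 ≤ ρ w μ - μ ∧ ∀ j ∈ support w, 0 < c j → 0 < (ρ w μ - μ) j := by
  obtain ⟨ω, hω, rfl⟩ := exists_isReducedWord w
  have hJ := hw.subset_of_isReduced hω
  simp only [IsReducedWord.mem_support ⟨hω, rfl⟩]
  clear hw
  induction ω using List.reverseRecOn with
  | nil => simp
  | append_singleton ω i ih =>
    obtain ⟨h1, h2⟩ := ih (isReduced_append hω).1 fun j hj => hJ j (by simp [hj])
    have hi : i ∈ J := hJ i (by simp)
    have h3 := hρ.nonneg _ _ (isReduced_concat_iff.1 hω).2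
    -- Appending i adds c_i times the positive vector π(ω) e_i; when i is new to the word, the
    -- i-coordinate of this vector is 1.
    have e : ρ (π (ω ++ [i])) μ - μ = (ρ (π ω) μ - μ) + c i • ρ (π ω) (basisVec i) := by
      rw [CoxeterSystem.wordProd_append, CoxeterSystem.wordProd_singleton, map_mul,
        Module.End.mul_apply, hμ i hi, map_add, map_smul]
      abel
    rw [e]
    have h4 := smul_nonneg (hc i hi) h3
    refine ⟨add_nonneg h1 h4, fun j hj hcj => ?_⟩
    rw [Pi.add_apply]
    by_cases hjω : j ∈ ω
    · exact add_pos_of_pos_of_nonneg (h2 j hjω hcj) (h4 j)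
    · have hji : j = i := by simpa [hjω] using hj
      subst hji
      have h5 : InPar {i | i ∈ ω} (π ω) := ⟨ω, by simp, rfl⟩
      refine add_pos_of_nonneg_of_pos (h1 j) ?_
      rw [Pi.smul_apply, h5.rep_apply hρ hjω]
      simpa [basisVec] using hcj

/-! ### Counting reduced subwords -/

section SublistSum
variable {α M : Type*} [AddCommMonoid M]

/-- The sum of `f` over all sublists of `ω`, with multiplicity. -/
def sublistSum (f : List α → M) (ω : List α) : M := (ω.sublists.map f).sum

lemma sublistSum_nil (f : List α → M) : sublistSum f [] = f [] := by simp [sublistSum]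

lemma sublistSum_concat (f : List α → M) (ω : List α) (i : α) :
    sublistSum f (ω ++ [i]) = sublistSum f ω + sublistSum (fun σ => f (σ ++ [i])) ω := by
  simp [sublistSum, List.sublists_concat, Function.comp_def]

lemma sublistSum_cons (f : List α → M) (ω : List α) (i : α) :
    sublistSum f (i :: ω) = sublistSum f ω + sublistSum (fun σ => f (i :: σ)) ω := by
  have h : ∀ (f : List α → M) (ω : List α), sublistSum f ω = (ω.sublists'.map f).sum :=
    fun f ω => ((List.sublists_perm_sublists' ω).map f).sum_eq
  rw [h, h, h, List.sublists'_cons, List.map_append, List.sum_append, List.map_map]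
  rfl

lemma sublistSum_add (f g : List α → M) (ω : List α) :
    sublistSum (fun σ => f σ + g σ) ω = sublistSum f ω + sublistSum g ω := by
  simp [sublistSum, List.sum_map_add]

lemma sublistSum_zero (ω : List α) : sublistSum (fun _ => (0 : M)) ω = 0 := by
  simp [sublistSum]

lemma sublistSum_hom {N : Type*} [AddCommMonoid N] (φ : M →+ N) (f : List α → M) (ω : List α) :
    sublistSum (fun σ => φ (f σ)) ω = φ (sublistSum f ω) := by
  simp [sublistSum, map_list_sum, Function.comp_def]

lemma sublistSum_ite (p : Prop) [Decidable p] (f : List α → M) (ω : List α) :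
    sublistSum (fun σ => if p then f σ else 0) ω = if p then sublistSum f ω else 0 := by
  split_ifs with h
  · rfl
  · exact sublistSum_zero ω

end SublistSum

lemma isReducedWord_concat_iff {w : Weyl n} {σ : List (Fin (n + 1))} {i : Fin (n + 1)} :
    IsReducedWord w (σ ++ [i]) ↔ RD w i ∧ IsReducedWord (w * 𝐬 i) σ := by
  unfold IsReducedWord
  rw [isReduced_concat_iff, CoxeterSystem.wordProd_append, CoxeterSystem.wordProd_singleton]
  constructor
  · rintro ⟨⟨h1, h2⟩, rfl⟩
    refine ⟨?_, h1, by simp⟩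
    rw [(sys n).isRightDescent_iff_not_isRightDescent_mul]; simpa using h2
  · rintro ⟨h1, h2, h3⟩
    rw [h3]
    exact ⟨⟨h2, (sys n).isRightDescent_iff_not_isRightDescent_mul.1 h1⟩, by simp⟩

lemma isReducedWord_reverse_iff {w : Weyl n} {σ : List (Fin (n + 1))} :
    IsReducedWord w σ.reverse ↔ IsReducedWord w⁻¹ σ := by
  unfold IsReducedWord
  rw [(sys n).isReduced_reverse_iff, CoxeterSystem.wordProd_reverse, inv_eq_iff_eq_inv]

lemma isReducedWord_cons_iff {w : Weyl n} {σ : List (Fin (n + 1))} {i : Fin (n + 1)} :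
    IsReducedWord w (i :: σ) ↔ RD w⁻¹ i ∧ IsReducedWord (𝐬 i * w) σ := by
  have h := isReducedWord_reverse_iff (w := w⁻¹) (σ := i :: σ)
  rw [inv_inv] at h
  rw [← h, List.reverse_cons, isReducedWord_concat_iff, isReducedWord_reverse_iff]
  simp

open Classical in
/-- The number of reduced subwords of `ω` (counted by positions) with product `w`. -/
noncomputable def cnt (ω : List (Fin (n + 1))) (w : Weyl n) : ℤ :=
  sublistSum (fun σ => if IsReducedWord w σ then 1 else 0) ω

open Classical in
/-- The sum of the coroots of the covers of `v` that are products of reduced subwords of `ω`. -/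
noncomputable def coverSum (ω : List (Fin (n + 1))) (v : Weyl n) : Lattice n :=
  sublistSum (fun σ => if (sys n).IsReduced σ ∧ BruhatCovers v (π σ) then coverCoroot v (π σ)
    else 0) ω

open Classical in
lemma cnt_nil (w : Weyl n) : cnt [] w = if w = 1 then 1 else 0 := by
  rw [cnt, sublistSum_nil]
  have : IsReducedWord w [] ↔ w = 1 := by
    simp [IsReducedWord, CoxeterSystem.IsReduced, eq_comm]
  simp [this]

open Classical in
lemma cnt_concat (ω : List (Fin (n + 1))) (i : Fin (n + 1)) (w : Weyl n) :
    cnt (ω ++ [i]) w = cnt ω w + if RD w i then cnt ω (w * 𝐬 i) else 0 := by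
  simp only [cnt]
  rw [sublistSum_concat, ← sublistSum_ite]
  simp only [isReducedWord_concat_iff, ite_and]

open Classical in
lemma cnt_cons (ω : List (Fin (n + 1))) (i : Fin (n + 1)) (w : Weyl n) :
    cnt (i :: ω) w = cnt ω w + if RD w⁻¹ i then cnt ω (𝐬 i * w) else 0 := by
  simp only [cnt]
  rw [sublistSum_cons, ← sublistSum_ite]
  simp only [isReducedWord_cons_iff, ite_and]

lemma sublistSum_indicator {α : Type*} (p : List α → Prop) [DecidablePred p] (ω : List α) :
    0 ≤ sublistSum (fun σ => if p σ then (1 : ℤ) else 0) ω ∧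
      (sublistSum (fun σ => if p σ then (1 : ℤ) else 0) ω ≠ 0 ↔ ∃ σ, σ.Sublist ω ∧ p σ) := by
  have h : ∀ L : List (List α), 0 ≤ (L.map (fun σ => if p σ then (1 : ℤ) else 0)).sum ∧
      ((L.map (fun σ => if p σ then (1 : ℤ) else 0)).sum ≠ 0 ↔ ∃ σ ∈ L, p σ) := by
    intro L
    induction L with
    | nil => simp
    | cons a L ih =>
      obtain ⟨h1, h2⟩ := ih
      rw [List.map_cons, List.sum_cons]
      by_cases ha : p a
      · simp only [ha, if_true, List.mem_cons, exists_eq_or_imp, true_or, iff_true]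
        omega
      · simpa [ha] using ⟨h1, by simpa using h2⟩
  obtain ⟨h1, h2⟩ := h ω.sublists
  exact ⟨h1, by rw [sublistSum, h2]; simp⟩

lemma cnt_ne_zero_iff (ω : List (Fin (n + 1))) (w : Weyl n) :
    cnt ω w ≠ 0 ↔ ∃ σ, σ.Sublist ω ∧ IsReducedWord w σ := by
  classical
  convert (sublistSum_indicator (fun σ => IsReducedWord w σ) ω).2 using 2
  unfold cnt; congr

open Classical in
/-- How the covers of `v` change when one multiplies by a simple reflection on the right. -/
lemma coverCoroot_mul_simple (v w : Weyl n) (i : Fin (n + 1)) :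
    (if ¬ RD w i ∧ BruhatCovers v (w * 𝐬 i) then coverCoroot v (w * 𝐬 i) else 0) =
      (if w = v then basisVec i else 0) + if RD v i then
        (if BruhatCovers (v * 𝐬 i) w then corootRep n (𝐬 i) (coverCoroot (v * 𝐬 i) w) else 0)
        else 0 := by
  by_cases hw : RD w i
  · rw [if_neg (by tauto)]
    by_cases hwv : w = v
    · subst hwv
      -- For w = v the summand α_i^∨ cancels against the cover w s_i ⋖ w, whose coroot α_i^∨ is
      -- negated by s_i.
      have h := bruhatCovers_mul_simple ((sys n).isRightDescent_iff_not_isRightDescent_mul.1 hw)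
      rw [CoxeterSystem.simple_mul_simple_cancel_right] at h
      rw [if_pos rfl, if_pos hw, if_pos h.1, h.2, reflRep_coroot.simple_self, add_neg_cancel]
    · rw [if_neg hwv, zero_add]
      split_ifs with h1 h2
      · exfalso
        obtain ⟨ω, hω, hωw⟩ := exists_isReducedWord (w * 𝐬 i)
        have h3 : IsReducedWord w (ω ++ [i]) := isReducedWord_concat_iff.2 ⟨hw, hω, hωw⟩
        rw [← h3.2] at h2
        obtain ⟨A, k, C, h4, h5, h6, -⟩ := h2.exists_deletion h3.1
        -- Deleting the last letter would give w = v. Deleting an earlier one leaves a reduced word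
        -- of v s_i that ends in i, although i is a descent of v.
        rcases List.eq_nil_or_concat' C with rfl | ⟨C', j, rfl⟩
        · obtain ⟨rfl, -⟩ := List.append_inj' h4 (by simp)
          rw [List.append_nil, hωw] at h5
          exact hwv (mul_right_cancel h5).symm
        · have h7 : (A ++ k :: C') ++ [j] = ω ++ [i] := by rw [h4]; simp
          obtain ⟨-, h8⟩ := List.append_inj' h7 (by simp)
          obtain rfl : j = i := by simpa using h8
          rw [← List.append_assoc] at h5 h6
          have h9 := (isReduced_concat_iff.1 h6).2
          rw [CoxeterSystem.wordProd_append, CoxeterSystem.wordProd_singleton] at h5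
          rw [← mul_right_cancel h5] at h9
          exact h9 h1
      · rfl
      · rfl
  · obtain ⟨ω, hω, rfl⟩ := exists_isReducedWord w
    have h3 : IsReducedWord (π ω * 𝐬 i) (ω ++ [i]) := isReducedWord_concat_iff.2
      ⟨by rw [(sys n).isRightDescent_iff_not_isRightDescent_mul]; simpa using hw, by simpa, by simp⟩
    by_cases h1 : BruhatCovers v (π ω * 𝐬 i)
    · rw [if_pos ⟨hw, h1⟩]
      rw [← h3.2] at h1
      obtain ⟨A, k, C, h4, h5, h6, h7, h8⟩ := h1.exists_deletion h3.1
      rw [h3.2] at h8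
      -- Deleting the last letter gives v = w with coroot α_i^∨. Deleting an earlier one keeps the
      -- final i, so the same deletion shows v s_i ⋖ w, with coroots related by s_i.
      rcases List.eq_nil_or_concat' C with rfl | ⟨C', j, rfl⟩
      · obtain ⟨rfl, h9⟩ := List.append_inj' h4 (by simp)
        obtain rfl : k = i := by simpa using h9.symm
        rw [List.append_nil] at h5
        subst h5
        rw [h8, if_pos rfl, if_neg hw]; simp
      · have h7' : (A ++ k :: C') ++ [j] = ω ++ [i] := by rw [h4]; simp
        obtain ⟨rfl, h9⟩ := List.append_inj' h7' (by simp)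
        obtain rfl : j = i := by simpa using h9
        rw [← List.append_assoc, isReduced_concat_iff] at h6
        rw [← List.append_assoc, CoxeterSystem.wordProd_append,
          CoxeterSystem.wordProd_singleton] at h5
        have h10 : v * 𝐬 j = π (A ++ C') := by rw [h5]; simp
        have hv : RD v j := by
          rw [(sys n).isRightDescent_iff_not_isRightDescent_mul, h10]; exact h6.2
        have h11 : (v * 𝐬 j)⁻¹ * π (A ++ k :: C') = (π C')⁻¹ * 𝐬 k * ((π C')⁻¹)⁻¹ := by
          rw [h10]
          simp only [CoxeterSystem.wordProd_append, CoxeterSystem.wordProd_cons]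
          simp [mul_assoc]
        have h12 : BruhatCovers (v * 𝐬 j) (π (A ++ k :: C')) := by
          refine ⟨by rw [h11]; exact ⟨_, _, rfl⟩, ?_⟩
          rw [h10, hω, h6.1]; simp; omega
        have h13 : coverCoroot (v * 𝐬 j) (π (A ++ k :: C')) = corootRep n (π C')⁻¹ (basisVec k) :=
            by
          refine coverCoroot_eq (isPosCoroot_iff.2 ⟨(π C')⁻¹, k, h11, ?_, rfl⟩)
          exact (isReduced_cons_iff.1 (isReduced_append hω).2).2
        rw [if_neg, if_pos hv, if_pos h12, h8, h13, zero_add,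
          CoxeterSystem.wordProd_append, CoxeterSystem.wordProd_singleton, mul_inv_rev,
          CoxeterSystem.inv_simple, map_mul, Module.End.mul_apply]
        · intro h; exact hw (h ▸ hv)
    · rw [if_neg (by tauto), if_neg, zero_add]
      · split_ifs with h4 h5
        · exfalso
          apply h1
          have e : v⁻¹ * (π ω * 𝐬 i) = 𝐬 i * ((v * 𝐬 i)⁻¹ * π ω) * (𝐬 i)⁻¹ := by
            simp [mul_assoc]
          refine ⟨by rw [e]; exact h5.1.conj _, ?_⟩
          have h6 := h5.2
          rw [(sys n).isRightDescent_iff] at h4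
          rw [(sys n).not_isRightDescent_iff] at hw
          omega
        · rfl
        · rfl
      · rintro rfl
        exact h1 (bruhatCovers_mul_simple hw).1

open Classical in
lemma coverSum_concat (ω : List (Fin (n + 1))) (i : Fin (n + 1)) (v : Weyl n) :
    coverSum (ω ++ [i]) v = coverSum ω v + cnt ω v • basisVec i +
      if RD v i then corootRep n (𝐬 i) (coverSum ω (v * 𝐬 i)) else 0 := by
  simp only [coverSum, cnt]
  rw [sublistSum_concat, add_assoc]
  congr 1
  have h1 := sublistSum_hom (corootRep n (𝐬 i)).toAddMonoidHom
    (fun σ => if (sys n).IsReduced σ ∧ BruhatCovers (v * 𝐬 i) (π σ) then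
      coverCoroot (v * 𝐬 i) (π σ) else 0) ω
  have h2 := sublistSum_hom ((smulAddHom ℤ (Lattice n)).flip (basisVec i))
    (fun σ => if IsReducedWord v σ then (1 : ℤ) else 0) ω
  simp only [LinearMap.toAddMonoidHom_coe] at h1
  simp only [AddMonoidHom.flip_apply, smulAddHom_apply] at h2
  rw [← h1, ← h2, ← sublistSum_ite, ← sublistSum_add]
  congr 1
  funext σ
  by_cases hσ : (sys n).IsReduced σ
  · have := coverCoroot_mul_simple v (π σ) i
    simp only [isReduced_concat_iff, CoxeterSystem.wordProd_append,
      CoxeterSystem.wordProd_singleton, hσ, true_and, IsReducedWord]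
    rw [this, apply_ite (corootRep n (𝐬 i)), map_zero, ite_smul, one_smul, zero_smul]
  · simp [isReduced_concat_iff, hσ, IsReducedWord]

/-- The sum of the cover coroots along subwords of `ω` is governed by two vectors `a`, `b`. -/
def HasType (ω : List (Fin (n + 1))) (a b : Lattice n) : Prop :=
  ∀ v : Weyl n, coverSum ω v = cnt ω v • (a - corootRep n v⁻¹ b)

lemma hasType_nil (a : Lattice n) : HasType [] a a := by
  intro v
  rw [coverSum, sublistSum_nil, if_neg, cnt_nil]
  · split_ifs with h
    · simp [h]
    · simp
  · rintro ⟨-, h⟩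
    have := h.2
    simp at this

/-- The hypothesis says ⟨a, α_i⟩ = -1. Then s_i (a - s_i v⁻¹ b) = a + α_i^∨ - v⁻¹ b, so the
contributions of v and of v s_i carry the same vector and their counts add up as in `cnt_concat`. -/
lemma HasType.concat {ω : List (Fin (n + 1))} {a b : Lattice n} (h : HasType ω a b)
    {i : Fin (n + 1)} (hi : corootRep n (𝐬 i) a = a + basisVec i) :
    HasType (ω ++ [i]) (a + basisVec i) b := by
  intro v
  rw [coverSum_concat, cnt_concat, h, h]
  split_ifs
  · rw [map_smul, map_sub, hi, ← Module.End.mul_apply, ← map_mul]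
    simp only [mul_inv_rev, CoxeterSystem.inv_simple, CoxeterSystem.simple_mul_simple_cancel_left]
    module
  · module

/-- Here ⟨a, α_i⟩ = -2. After one letter i the contribution of v carries a + α_i^∨ while that of v
s_i carries a + 2α_i^∨; the second copy makes them equal. This is why 0 and n are doubled in the
words below. -/
lemma HasType.concat_concat {ω : List (Fin (n + 1))} {a b : Lattice n} (h : HasType ω a b)
    {i : Fin (n + 1)} (hi : corootRep n (𝐬 i) a = a + (2 : ℤ) • basisVec i) :
    HasType (ω ++ [i] ++ [i]) (a + (2 : ℤ) • basisVec i) b := by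
  intro v
  simp only [coverSum_concat, cnt_concat, h _]
  by_cases hv : RD v i
  · have hv' := (sys n).isRightDescent_iff_not_isRightDescent_mul.1 hv
    simp only [if_pos hv, if_neg hv', map_add, map_smul, map_sub, hi, add_zero,
      reflRep_coroot.simple_self]
    rw [← Module.End.mul_apply, ← map_mul]
    simp only [mul_inv_rev, CoxeterSystem.inv_simple, CoxeterSystem.simple_mul_simple_cancel_left]
    module
  · simp only [if_neg hv]
    module

/-! ### The vectors `eps p` and the two families of words -/

/-- The node with index `k ≤ n`. -/
def node (k : ℕ) : Fin (n + 1) := Fin.ofNat (n + 1) k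

lemma node_val {k : ℕ} (h : k ≤ n) : (node k : Fin (n + 1)).val = k :=
  Nat.mod_eq_of_lt (by omega)

lemma node_self (i : Fin (n + 1)) : node i.val = i := Fin.ext (node_val (Nat.lt_succ_iff.1 i.isLt))

lemma rev_node {k : ℕ} (h : k ≤ n) : (node k : Fin (n + 1)).rev = node (n - k) := by
  ext; rw [Fin.val_rev, node_val h, node_val (by omega)]; omega

/-- The sum `α_p^∨ + ⋯ + α_n^∨`. -/
def eps (p : ℕ) : Lattice n := fun i => if p ≤ i.val then 1 else 0

lemma eps_zero : (eps 0 : Lattice n) = central n := by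
  ext i; simp [eps, central, basisVec, Pi.single_apply]

lemma eps_eq {p : ℕ} (hp : p ≤ n) : (eps p : Lattice n) = eps (p + 1) + basisVec (node p) := by
  ext i
  simp only [eps, basisVec, Pi.add_apply, Pi.single_apply, Fin.ext_iff, node_val hp]
  split_ifs <;> omega

lemma eps_top : (eps (n + 1) : Lattice n) = 0 := by
  ext i; have := i.isLt; simp [eps]; omega

lemma pairing_basisVec (i j : Fin (n + 1)) :
    pairing n (basisVec i) (basisVec j) = cartan n i j := by
  rw [pairing_basisVec_left]; simp [basisVec, Pi.single_apply]

/-- Only the two nodes next to the cut see ε_p. The values ±2 at the ends of the diagram are those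
that call for doubled letters. -/
lemma pairing_eps {p : ℕ} (h1 : 1 ≤ p) (hp : p ≤ n) (i : Fin (n + 1)) :
    pairing n (eps p) (basisVec i) =
      (if i.val = p then (if p = n then 2 else 1) else 0) -
      (if i.val + 1 = p then (if i.val = 0 then 2 else 1) else 0) := by
  induction hd : n - p generalizing p with
  | zero =>
    obtain rfl : p = n := by omega
    rw [eps_eq le_rfl, eps_top, zero_add, pairing_basisVec]
    simp only [cartan, Matrix.of_apply, Fin.ext_iff, node_val le_rfl]
    split_ifs <;> omega
  | succ d ih =>
    rw [eps_eq hp, map_add, LinearMap.add_apply, ih (by omega) (by omega) (by omega),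
      pairing_basisVec]
    simp only [cartan, Matrix.of_apply, Fin.ext_iff, node_val hp]
    have := i.isLt
    split_ifs <;> omega

lemma pairing_central (hn : 1 ≤ n) (i : Fin (n + 1)) : pairing n (central n) (basisVec i) = 0 := by
  rw [← eps_zero, eps_eq (Nat.zero_le n), map_add, LinearMap.add_apply,
    pairing_eps (by omega) (by omega), pairing_basisVec]
  simp only [cartan, Matrix.of_apply, Fin.ext_iff, node_val (Nat.zero_le n)]
  have := i.isLt
  split_ifs <;> first | omega | grind

lemma corootRep_central (hn : 1 ≤ n) (w : Weyl n) : corootRep n w (central n) = central n := by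
  induction w using (sys n).simple_induction_left with
  | one => simp
  | mul_simple_left w i ih =>
    rw [map_mul, Module.End.mul_apply, ih, corootRep_simple, pairing_central hn]; simp

section Eps
variable {p : ℕ}

lemma simple_eps_of_ne (h1 : 1 ≤ p) (hp : p ≤ n) {i : Fin (n + 1)} (h : i.val ≠ p)
    (h' : i.val + 1 ≠ p) : corootRep n (𝐬 i) (eps p) = eps p := by
  rw [corootRep_simple, pairing_eps h1 hp, if_neg h, if_neg h']; simp

lemma simple_eps_self (h1 : 1 ≤ p) (hp : p < n) : corootRep n (𝐬 (node p)) (eps p) = eps (p + 1) :=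
    by
  rw [corootRep_simple, pairing_eps h1 hp.le, node_val hp.le, eps_eq hp.le]
  simp [hp.ne]

lemma simple_eps_succ (h1 : 1 ≤ p) (hp : p < n) :
    corootRep n (𝐬 (node p)) (eps (p + 1)) = eps p := by
  rw [← simple_eps_self h1 hp, ← Module.End.mul_apply, ← map_mul]; simp

lemma simple_eps_top (h1 : 1 ≤ n) :
    corootRep n (𝐬 (node n)) (eps n) = -eps n := by
  rw [corootRep_simple, pairing_eps h1 le_rfl, node_val le_rfl, if_pos rfl, if_pos rfl,
    if_neg (by omega), eps_eq le_rfl, eps_top]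
  module

lemma simple_eps_one (hn : 1 ≤ n) :
    corootRep n (𝐬 (node 0)) (eps 1) = (2 : ℤ) • central n - eps 1 := by
  rw [corootRep_simple, pairing_eps le_rfl hn, node_val (Nat.zero_le n),
    if_neg (by omega), if_pos rfl, if_pos rfl, ← eps_zero, eps_eq (Nat.zero_le n)]
  module

lemma InPar.fix_eps (h1 : 1 ≤ p) (hp : p ≤ n) {w : Weyl n}
    (h : InPar {i | i.val ≠ p ∧ i.val + 1 ≠ p} w) : corootRep n w (eps p) = eps p := by
  refine InPar.induction (p := fun w => corootRep n w (eps p) = eps p) (by simp)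
    (fun i hi w ih => ?_) h
  rw [map_mul, Module.End.mul_apply, ih, simple_eps_of_ne h1 hp hi.1 hi.2]

end Eps

/-- The word `d-1, …, 1, 0, 0, 1, …, d-1`. -/
def lowWord : ℕ → List (Fin (n + 1))
  | 0 => []
  | d + 1 => node d :: (lowWord d ++ [node d])

/-- The word `n-d+1, …, n, n, …, n-d+1`. -/
def highWord (d : ℕ) : List (Fin (n + 1)) := (lowWord d).map Fin.rev

lemma highWord_succ {d : ℕ} (hd : d ≤ n) :
    (highWord (d + 1) : List (Fin (n + 1))) = node (n - d) :: (highWord d ++ [node (n - d)]) := by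
  simp [highWord, lowWord, rev_node hd]

/-- The letters p-1, …, 1 raise ε_p to ε_1, the doubled 0 carries ε_1 to 2K - ε_1, and 1, …, p-1
lead on to 2K - ε_p. Multiples of K ride along, as K pairs to zero with every root. -/
lemma HasType.append_lowWord {ω : List (Fin (n + 1))} {b : Lattice n} {c : ℤ} {p : ℕ} (hp : 1 ≤ p)
    (hpn : p ≤ n) (h : HasType ω (c • central n + eps p) b) :
    HasType (ω ++ lowWord p) ((c + 2) • central n - eps p) b := by
  have hn : 1 ≤ n := by omega
  induction p, hp using Nat.le_induction generalizing ω c with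
  | base =>
    have h1 := h.concat_concat (i := node 0) (by
      rw [map_add, map_smul, corootRep_central hn, simple_eps_one hn, ← eps_zero,
        eps_eq (Nat.zero_le n)]; module)
    convert h1 using 1
    · simp [lowWord]
    · rw [← eps_zero, eps_eq (Nat.zero_le n)]; module
  | succ p hp ih =>
    have h1 := h.concat (i := node p) (by
      rw [map_add, map_smul, corootRep_central hn, simple_eps_succ hp hpn,
        eps_eq (p := p) (by omega)]; module)
    have e : c • central n + eps (p + 1) + basisVec (node p) = c • central n + eps p := by
      rw [eps_eq (p := p) (by omega)]; module
    rw [e] at h1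
    have h2 := (ih (by omega) h1).concat (i := node p) (by
      rw [map_sub, map_smul, corootRep_central hn, simple_eps_self hp hpn,
        eps_eq (p := p) (by omega)]; module)
    convert h2 using 1
    · simp [lowWord]
    · rw [eps_eq (p := p) (by omega)]; module

/-- With q = n + 1 - d, the letters q, …, n-1 raise -ε_q to -ε_n, the doubled n crosses to ε_n, and
the way back leads to ε_q. -/
lemma HasType.append_highWord {ω : List (Fin (n + 1))} {b : Lattice n} {c : ℤ} {d : ℕ} (hd : 1 ≤ d)
    (hdn : d ≤ n) (h : HasType ω (c • central n - eps (n + 1 - d)) b) :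
    HasType (ω ++ highWord d) (c • central n + eps (n + 1 - d)) b := by
  have hn : 1 ≤ n := by omega
  induction d, hd using Nat.le_induction generalizing ω with
  | base =>
    simp only [Nat.add_sub_cancel] at h ⊢
    have e := eps_eq (n := n) le_rfl
    rw [eps_top, zero_add] at e
    have h1 := h.concat_concat (i := node n) (by
      rw [map_sub, map_smul, corootRep_central hn, simple_eps_top hn, e]; module)
    convert h1 using 1
    · simp [highWord, lowWord, rev_node]
    · rw [e]; module
  | succ d hd ih =>
    have e1 : n + 1 - (d + 1) = n - d := by omega
    have e2 : n + 1 - d = n - d + 1 := by omega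
    rw [e1] at h ⊢
    rw [e2] at ih
    have h1 := h.concat (i := node (n - d)) (by
      rw [map_sub, map_smul, corootRep_central hn, simple_eps_self (by omega) (by omega),
        eps_eq (p := n - d) (by omega)]; module)
    have e : c • central n - eps (n - d) + basisVec (node (n - d)) =
        c • central n - eps (n - d + 1) := by
      rw [eps_eq (p := n - d) (by omega)]; module
    rw [e] at h1
    have h2 := (ih (by omega) h1).concat (i := node (n - d)) (by
      rw [map_add, map_smul, corootRep_central hn, simple_eps_succ (by omega) (by omega),
        eps_eq (p := n - d) (by omega)]; module)
    convert h2 using 1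
    · simp [highWord_succ (show d ≤ n by omega)]
    · rw [eps_eq (p := n - d) (by omega)]; module

/-- The path starts at -ε_p here and at ε_p for the opposite order, so ε_p - v⁻¹ ε_p enters the two
cover sums with opposite signs. -/
lemma hasType_high_low {p : ℕ} (h1 : 1 ≤ p) (hp : p ≤ n) :
    HasType (highWord (n + 1 - p) ++ lowWord p) ((2 : ℤ) • central n - eps p) (-eps p) := by
  have h2 := hasType_nil (n := n) ((0 : ℤ) • central n - eps p)
  have e : n + 1 - (n + 1 - p) = p := by omega
  have h3 := HasType.append_highWord (ω := []) (c := 0) (b := (0 : ℤ) • central n - eps p) (d := n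
      + 1 - p) (by omega) (by omega) (by rwa [e])
  rw [e] at h3
  simpa using h3.append_lowWord h1 hp

lemma hasType_low_high {p : ℕ} (h1 : 1 ≤ p) (hp : p ≤ n) :
    HasType (lowWord p ++ highWord (n + 1 - p)) ((2 : ℤ) • central n + eps p) (eps p) := by
  have h2 := hasType_nil (n := n) ((0 : ℤ) • central n + eps p)
  have e : n + 1 - (n + 1 - p) = p := by omega
  have h3 := HasType.append_highWord (ω := lowWord p) (c := 2) (b := (0 : ℤ) • central n + eps p)
      (d := n + 1 - p) (by omega) (by omega)
    (by rw [e]; simpa using h2.append_lowWord h1 hp)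
  rw [e] at h3
  simpa using h3

/-! ### Components of subsets of the diagram -/

/-- The number of maximal nonempty subintervals of `A`. -/
noncomputable def compNum (A : Set (Fin (n + 1))) : ℕ :=
  Set.ncard {J : Set (Fin (n + 1)) |
    Maximal (fun J => J.Nonempty ∧ J.OrdConnected ∧ J ⊆ A) J}

lemma numComponents_eq (w : Weyl n) : numComponents w = compNum (support w) := rfl

/-- The right ends of the components of `A`. -/
def rightEnds (A : Set (Fin (n + 1))) : Set (Fin (n + 1)) :=
  {i | i ∈ A ∧ ∀ j ∈ A, j.val ≠ i.val + 1}

/-- A component is determined by its right end: `f i` is the longest interval of A that ends at i.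
-/
lemma compNum_eq_ncard (A : Set (Fin (n + 1))) : compNum A = (rightEnds A).ncard := by
  let f : Fin (n + 1) → Set (Fin (n + 1)) := fun i => {j | j ≤ i ∧ Set.Icc j i ⊆ A}
  have hP : ∀ i ∈ A, (f i).Nonempty ∧ (f i).OrdConnected ∧ f i ⊆ A := by
    intro i hi
    refine ⟨⟨i, le_rfl, by simpa using hi⟩, ⟨?_⟩, fun j hj => hj.2 (by simpa using hj.1)⟩
    rintro j ⟨-, h2⟩ l ⟨h3, -⟩ k ⟨h5, h6⟩
    exact ⟨h6.trans h3, (Set.Icc_subset_Icc_left h5).trans h2⟩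
  refine (Set.ncard_congr (fun i _ => f i) ?_ ?_ ?_).symm
  · rintro i ⟨hi, hi'⟩
    refine ⟨hP i hi, ?_⟩
    rintro J ⟨-, h2, h3⟩ hJ k hk
    have hiJ : i ∈ J := hJ ⟨le_rfl, by simpa using hi⟩
    rcases le_or_gt k i with h | h
    · exact ⟨h, (h2.out hk hiJ).trans h3⟩
    · exfalso
      have h4 : i.val + 1 ≤ k.val := h
      let j : Fin (n + 1) := ⟨i.val + 1, by omega⟩
      exact hi' j (h3 (h2.out hiJ hk ⟨by simp [j, Fin.le_def], h4⟩)) rfl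
  · rintro i i' ⟨hi, -⟩ ⟨hi', -⟩ h
    have h1 : i ∈ f i' := h ▸ (⟨le_rfl, by simpa using hi⟩ : i ∈ f i)
    have h2 : i' ∈ f i := h ▸ (⟨le_rfl, by simpa using hi'⟩ : i' ∈ f i')
    exact le_antisymm h1.1 h2.1
  · rintro J ⟨⟨h1, h2, h3⟩, h4⟩
    obtain ⟨i, hi, hmax⟩ := J.toFinite.exists_maximalFor id J h1
    have hmax' : ∀ k ∈ J, k ≤ i := fun k hk => by
      by_contra h
      exact h (hmax hk (le_of_lt (not_le.1 h)))
    have hJf : J ⊆ f i := fun k hk => ⟨hmax' k hk, (h2.out hk hi).trans h3⟩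
    have hfJ : f i ⊆ J := h4 (hP i (h3 hi)) hJf
    refine ⟨i, ⟨h3 hi, fun j hj hji => ?_⟩, hfJ.antisymm hJf⟩
    have h5 : J ⊆ f j := by
      intro k hk
      obtain ⟨h6, h7⟩ := hJf hk
      refine ⟨by rw [Fin.le_def] at h6 ⊢; omega, ?_⟩
      rintro l ⟨h8, h9⟩
      rcases le_or_gt l i with h | h
      · exact h7 ⟨h8, h⟩
      · have : l = j := by
          ext; rw [Fin.le_def] at h9; rw [Fin.lt_def] at h; omega
        rwa [this]
    have h6 := hmax' j (h4 (hP j hj) h5 ⟨le_rfl, by simpa using hj⟩)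
    rw [Fin.le_def] at h6; omega

/-- The only right end of A that can be lost is p - 1, and it is lost exactly if p lies in C. -/
lemma rightEnds_union {A C : Set (Fin (n + 1))} {p : ℕ} (hA : ∀ i ∈ A, i.val < p)
    (hC : ∀ i ∈ C, p ≤ i.val) :
    rightEnds (A ∪ C) = (rightEnds A \ {i | i.val + 1 = p ∧ ∃ j ∈ C, j.val = p}) ∪ rightEnds C := by
  ext i
  simp only [rightEnds, Set.mem_union, Set.mem_sdiff, Set.mem_ofPred_eq]
  constructor
  · rintro ⟨hi | hi, h⟩
    · refine Or.inl ⟨⟨hi, fun j hj => h j (Or.inl hj)⟩, ?_⟩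
      rintro ⟨h1, j, hj, h2⟩
      exact h j (Or.inr hj) (by omega)
    · exact Or.inr ⟨hi, fun j hj => h j (Or.inr hj)⟩
  · rintro (⟨⟨hi, h⟩, h'⟩ | ⟨hi, h⟩)
    · refine ⟨Or.inl hi, ?_⟩
      rintro j (hj | hj) hji
      · exact h j hj hji
      · have := hA i hi; have := hC j hj
        exact h' ⟨by omega, j, hj, by omega⟩
    · refine ⟨Or.inr hi, ?_⟩
      rintro j (hj | hj) hji
      · have := hC i hi; have := hA j hj; omega
      · exact h j hj hji

lemma compNum_union_of_adjacent {A C : Set (Fin (n + 1))} {p : ℕ} (hA : ∀ i ∈ A, i.val < p)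
    (hC : ∀ i ∈ C, p ≤ i.val) {a c : Fin (n + 1)} (ha : a ∈ A) (hap : a.val + 1 = p) (hc : c ∈ C)
    (hcp : c.val = p) : compNum (A ∪ C) + 1 = compNum A + compNum C := by
  simp only [compNum_eq_ncard, rightEnds_union hA hC]
  have h1 : rightEnds A \ {i | i.val + 1 = p ∧ ∃ j ∈ C, j.val = p} = rightEnds A \ {a} := by
    ext i
    simp only [Set.mem_sdiff, Set.mem_ofPred_eq, Set.mem_singleton_iff, Fin.ext_iff]
    refine and_congr_right fun _ => not_congr ⟨fun h => by omega, fun h => ⟨by omega, c, hc, hcp⟩⟩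
  have h2 : a ∈ rightEnds A := ⟨ha, fun j hj hja => by have := hA j hj; omega⟩
  rw [h1, Set.ncard_union_eq, ← Set.ncard_sdiff_singleton_add_one h2]
  · ring
  · rw [Set.disjoint_left]
    rintro i ⟨⟨hi, -⟩, -⟩ ⟨hi', -⟩
    have := hA i hi; have := hC i hi'; omega

lemma compNum_union_of_not_adjacent {A C : Set (Fin (n + 1))} {p : ℕ} (hA : ∀ i ∈ A, i.val < p)
    (hC : ∀ i ∈ C, p ≤ i.val) (h : (∀ i ∈ A, i.val + 1 ≠ p) ∨ ∀ i ∈ C, i.val ≠ p) :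
    compNum (A ∪ C) = compNum A + compNum C := by
  simp only [compNum_eq_ncard, rightEnds_union hA hC]
  have h1 : rightEnds A \ {i | i.val + 1 = p ∧ ∃ j ∈ C, j.val = p} = rightEnds A := by
    rw [sdiff_eq_left, Set.disjoint_left]
    rintro i ⟨hi, -⟩ ⟨h1, j, hj, h2⟩
    rcases h with h | h
    · exact h i hi h1
    · exact h j hj h2
  rw [h1, Set.ncard_union_eq]
  rw [Set.disjoint_left]
  rintro i ⟨hi, -⟩ ⟨hi', -⟩
  have := hA i hi; have := hC i hi'; omega

lemma compNum_empty : compNum (∅ : Set (Fin (n + 1))) = 0 := by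
  rw [compNum_eq_ncard, Set.ncard_eq_zero]; ext; simp [rightEnds]

lemma compNum_singleton (i : Fin (n + 1)) : compNum {i} = 1 := by
  rw [compNum_eq_ncard, Set.ncard_eq_one]
  refine ⟨i, ?_⟩
  ext j
  simp only [rightEnds, Set.mem_singleton_iff, Set.mem_ofPred_eq, forall_eq]
  refine ⟨fun h => h.1, fun h => ⟨h, by subst h; omega⟩⟩

/-! ### Conjugation by a simple reflection -/

/-- The nodes with index less than `d`. -/
def below (d : ℕ) : Set (Fin (n + 1)) := {i | i.val < d}

/-- The nodes with index at least `d`. -/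
def above (d : ℕ) : Set (Fin (n + 1)) := {i | d ≤ i.val}

lemma disjoint_above_below (d : ℕ) : Disjoint (above d : Set (Fin (n + 1))) (below d) := by
  rw [Set.disjoint_left]; intro i hi hi'
  exact absurd (show i.val < d from hi') (by have : d ≤ i.val := hi; omega)

lemma not_isRightDescent_of_inPar {J : Set (Fin (n + 1))} {x : Weyl n} (h : InPar J x)
    {i : Fin (n + 1)} (hi : i ∉ J) : ¬ RD x i := by
  intro h1
  have h2 := reflRep_coroot.nonpos x i h1 i
  rw [h.rep_apply reflRep_coroot hi] at h2
  simp [basisVec] at h2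

lemma InPar.length_mul_simple {J : Set (Fin (n + 1))} {x : Weyl n} (h : InPar J x)
    {i : Fin (n + 1)} (hi : i ∉ J) :
    ℓ (x * 𝐬 i) = ℓ x + 1 ∧ support (x * 𝐬 i) = support x ∪ {i} := by
  have h1 := (sys n).not_isRightDescent_iff.1 (not_isRightDescent_of_inPar h hi)
  refine ⟨h1, ?_⟩
  rw [support_mul (by simpa using h1), support_simple]

lemma InPar.length_simple_mul {J : Set (Fin (n + 1))} {x : Weyl n} (h : InPar J x)
    {i : Fin (n + 1)} (hi : i ∉ J) :
    ℓ (𝐬 i * x) = ℓ x + 1 ∧ support (𝐬 i * x) = support x ∪ {i} := by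
  have h1 := h.inv.length_mul_simple hi
  rw [(sys n).length_inv, support_inv] at h1
  constructor
  · rw [← (sys n).length_inv]; simpa using h1.1
  · rw [← support_inv]; simpa using h1.2

/-- Conjugating by a reflection adjacent to the support adds two to the length. -/
lemma InPar.length_conj {J : Set (Fin (n + 1))} {x : Weyl n} (h : InPar J x)
    {i j : Fin (n + 1)} (hi : i ∉ J) (hj : j ∈ support x) (hij : cartan n i j < 0) :
    ℓ (𝐬 i * x * 𝐬 i) = ℓ x + 2 ∧ support (𝐬 i * x * 𝐬 i) = support x ∪ {i} := by
  have hJj : j ∈ J := inPar_iff_support.1 h hj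
  have hne : ∀ k ∈ J, k ≠ i := by rintro k hk rfl; exact hi hk
  have h1 : ¬ RD (𝐬 i * x) i := by
    rw [← reflRep_coroot.nonneg_iff, map_mul, Module.End.mul_apply]
    -- The element x moves α_i^∨ upwards, strictly at the neighbour j. Under s_i only the coordinate
    -- i could become negative; then i would be a descent of s_i x, which forces x α_i^∨ = α_i^∨.
    have key := h.rep_sub_nonneg reflRep_coroot (μ := basisVec i) (c := fun k => - cartan n i k)
      (fun k hk => by
        have := (cartanLike_cartan.2 i k (hne k hk).symm).1; omega)
      (fun k _ => by rw [reflRep_coroot.simple, refl_basisVec]; module)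
    have h2 := key.2 j hj (by omega)
    intro k
    by_cases hk : k = i
    · subst hk
      by_contra hcon
      have h3 : RD (𝐬 k * x) k := by
        by_contra h4
        have h5 := reflRep_coroot.nonneg _ _ h4 k
        rw [map_mul, Module.End.mul_apply] at h5
        exact hcon h5
      have h4 := reflRep_coroot.eq_basisVec (not_isRightDescent_of_inPar h hi) h3
      rw [h4] at h2
      simp at h2
    · rw [reflRep_coroot.simple, refl_apply_of_ne _ _ hk]
      have := key.1 k
      simp [basisVec, hk] at this
      simpa [basisVec] using this
  have h2 := (sys n).not_isRightDescent_iff.1 h1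
  have h3 := h.length_simple_mul hi
  refine ⟨by omega, ?_⟩
  rw [support_mul (by simpa using h2), support_simple, h3.2]
  simp

lemma cartan_neg {i j : Fin (n + 1)} (h : i.val + 1 = j.val ∨ j.val + 1 = i.val) :
    cartan n i j < 0 := by
  have : i ≠ j := by rintro rfl; omega
  simp only [cartan, Matrix.of_apply, if_neg this, if_pos h]
  split_ifs <;> norm_num

/-! ### Elements with reduced words in the words `lowWord d` -/

/-- The products of reduced subwords of `lowWord d`. -/
def low : ℕ → Set (Weyl n)
  | 0 => {1}
  | d + 1 => {w | ∃ x ∈ low d, w = x ∨ w = 𝐬 (node d) * x ∨ w = x * 𝐬 (node d) ∨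
      (w = 𝐬 (node d) * x * 𝐬 (node d) ∧ ∃ i ∈ support x, i.val + 1 = d)}

lemma low_subset_succ (d : ℕ) : (low d : Set (Weyl n)) ⊆ low (d + 1) :=
  fun x hx => ⟨x, hx, Or.inl rfl⟩

lemma low_mono {d e : ℕ} (h : d ≤ e) : (low d : Set (Weyl n)) ⊆ low e :=
  monotone_nat_of_le_succ (f := low) low_subset_succ h

lemma below_mono {d e : ℕ} (h : d ≤ e) : (below d : Set (Fin (n + 1))) ⊆ below e :=
  fun _ hi => lt_of_lt_of_le hi h

lemma node_mem_below {d e : ℕ} (hd : d ≤ n) (h : d < e) : (node d : Fin (n + 1)) ∈ below e := by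
  change (node d : Fin (n + 1)).val < e; rwa [node_val hd]

lemma node_notMem_below {d : ℕ} (hd : d ≤ n) : (node d : Fin (n + 1)) ∉ below d := by
  change ¬ (node d : Fin (n + 1)).val < d; rw [node_val hd]; omega

lemma inPar_of_mem_low {d : ℕ} (hd : d ≤ n + 1) {w : Weyl n} (hw : w ∈ low d) :
    InPar (below d) w := by
  induction d generalizing w with
  | zero => rw [show w = 1 from hw]; exact InPar.one _
  | succ d ih =>
    have hs : InPar (below (d + 1)) (𝐬 (node d) : Weyl n) :=
      InPar.simple (node_mem_below (by omega) (by omega))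
    obtain ⟨x, hx, h⟩ := hw
    have hx' := (ih (by omega) hx).mono (below_mono (Nat.le_succ d))
    rcases h with rfl | rfl | rfl | ⟨rfl, -⟩
    · exact hx'
    · exact hs.mul hx'
    · exact hx'.mul hs
    · exact (hs.mul hx').mul hs

lemma one_mem_low (d : ℕ) : (1 : Weyl n) ∈ low d := low_mono (Nat.zero_le d) rfl

lemma inv_mem_low {d : ℕ} {w : Weyl n} (hw : w ∈ low d) : w⁻¹ ∈ low d := by
  induction d generalizing w with
  | zero => rw [show w = 1 from hw]; simp [low]
  | succ d ih =>
    obtain ⟨x, hx, h⟩ := hw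
    refine ⟨x⁻¹, ih hx, ?_⟩
    rcases h with rfl | rfl | rfl | ⟨rfl, h⟩
    · simp
    · right; right; left; simp
    · right; left; simp
    · right; right; right; simpa [mul_assoc] using h

/-- Either `x` commutes with the next simple reflection, or conjugation is length additive. -/
lemma commute_or_exists {d : ℕ} (hd : d ≤ n) {x : Weyl n} (hx : InPar (below d) x) :
    Commute x (𝐬 (node d)) ∧ (∀ i ∈ support x, i.val + 1 ≠ d) ∨ ∃ i ∈ support x, i.val + 1 = d := by
  by_cases h : ∃ i ∈ support x, i.val + 1 = d
  · exact Or.inr h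
  · push Not at h
    refine Or.inl ⟨InPar.commute (J := support x) (I := {node d}) ?_ (inPar_support x)
      (InPar.simple rfl), h⟩
    rintro i hi j rfl
    have h1 := h i hi
    have h2 : i.val < d := inPar_iff_support.1 hx hi
    rw [node_val hd]; omega

open Classical in
-- The word for d + 1 has the letter d on both sides of the word for d. If s_d commutes with x, then
-- x s_d is obtained from both sides and gains a component, so count and weight double. Otherwise
-- s_d x, x s_d and s_d x s_d are each obtained in one way from x, and the component of d - 1 merely
-- grows.
lemma cnt_lowWord {d : ℕ} (hd : d ≤ n + 1) (w : Weyl n) :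
    cnt (lowWord d) w = if w ∈ low d then 2 ^ numComponents w else 0 := by
  induction d generalizing w with
  | zero =>
    simp only [lowWord, cnt_nil, low, Set.mem_singleton_iff]
    split_ifs with h
    · subst h; simp [numComponents_eq, compNum_empty]
    · rfl
  | succ d ih =>
    specialize ih (by omega)
    have hdn : d ≤ n := by omega
    have hnd : (node d : Fin (n + 1)) ∉ below d := node_notMem_below hdn
    -- The inner word lacks the letter d; this removes most of the terms of the expansion below.
    have hzero : ∀ x : Weyl n, node d ∈ support x → cnt (lowWord d) x = 0 := by
      intro x hx
      rw [ih, if_neg]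
      exact fun h => hnd (inPar_iff_support.1 (inPar_of_mem_low (by omega) h) hx)
    rw [lowWord, cnt_cons, cnt_concat, cnt_concat]
    have hcomp : ∀ x : Weyl n, InPar (below d) x → ∀ y : Weyl n, support y = support x ∪ {node d} →
        ((∃ i ∈ support x, i.val + 1 = d) → numComponents y = numComponents x) ∧
        ((∀ i ∈ support x, i.val + 1 ≠ d) → numComponents y = numComponents x + 1) := by
      intro x hx y hy
      have h1 : ∀ i ∈ support x, i.val < d := fun i hi => inPar_iff_support.1 hx hi
      have h2 : ∀ i ∈ ({node d} : Set (Fin (n + 1))), d ≤ i.val := by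
        rintro i rfl; rw [node_val hdn]
      rw [numComponents_eq, numComponents_eq, hy]
      constructor
      · rintro ⟨i, hi, hid⟩
        have := compNum_union_of_adjacent h1 h2 hi hid rfl (node_val hdn)
        rw [compNum_singleton] at this
        omega
      · intro h
        rw [compNum_union_of_not_adjacent h1 h2 (Or.inl h), compNum_singleton]
    by_cases hw : w ∈ low (d + 1)
    · rw [if_pos hw]
      obtain ⟨x, hx, h⟩ := hw
      have hxp := inPar_of_mem_low (by omega) hx
      have e1 := hxp.length_mul_simple hnd
      have e2 := hxp.length_simple_mul hnd
      have r1 := not_isRightDescent_of_inPar hxp hnd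
      have r2 := not_isRightDescent_of_inPar hxp.inv hnd
      have r3 : RD (x * 𝐬 (node d)) (node d) := by
        rw [(sys n).isRightDescent_iff_not_isRightDescent_mul]; simpa using r1
      have r4 : RD (𝐬 (node d) * x)⁻¹ (node d) := by
        rw [(sys n).isRightDescent_iff_not_isRightDescent_mul]; simpa using r2
      rcases h with rfl | h
      · rw [if_neg r1, if_neg r2, ih, if_pos hx]; simp
      rcases commute_or_exists hdn hxp with ⟨hc, hx'⟩ | ⟨i, hi, hid⟩
      · have hwx : w = x * 𝐬 (node d) := by
          rcases h with rfl | rfl | ⟨rfl, i, hi, hid⟩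
          · exact hc.eq.symm
          · rfl
          · exact absurd hid (hx' i hi)
        subst hwx
        have r5 : RD (x * 𝐬 (node d))⁻¹ (node d) := by rw [hc.eq]; exact r4
        rw [if_pos r3, if_pos r5, hzero _ (by rw [e1.2]; simp),
          CoxeterSystem.simple_mul_simple_cancel_right, hc.eq,
          CoxeterSystem.simple_mul_simple_cancel_left, if_neg r1, ih, if_pos hx,
          (hcomp x hxp _ e2.2).2 hx']
        ring
      · have e3 := hxp.length_conj hnd hi (cartan_neg (by rw [node_val hdn]; omega))
        rcases h with rfl | rfl | ⟨rfl, -⟩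
        · rw [hzero _ (by rw [e2.2]; simp), hzero _ (by rw [e3.2]; simp), if_pos r4,
            CoxeterSystem.simple_mul_simple_cancel_left, if_neg r1, ih, if_pos hx,
            (hcomp x hxp _ e2.2).1 ⟨i, hi, hid⟩]
          simp
        · rw [hzero (x * 𝐬 (node d)) (by rw [e1.2]; simp), ← mul_assoc,
            hzero (𝐬 (node d) * x * 𝐬 (node d)) (by rw [e3.2]; simp),
            if_pos r3, CoxeterSystem.simple_mul_simple_cancel_right,
            CoxeterSystem.simple_mul_simple_cancel_right,
            hzero (𝐬 (node d) * x) (by rw [e2.2]; simp), ih, if_pos hx,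
            (hcomp x hxp _ e1.2).1 ⟨i, hi, hid⟩]
          simp
        · have r5 : RD (𝐬 (node d) * x * 𝐬 (node d))⁻¹ (node d) := by
            rw [CoxeterSystem.IsRightDescent, (sys n).length_inv, ← (sys n).length_inv (_ * _)]
            simp only [mul_inv_rev, CoxeterSystem.inv_simple, inv_inv, ← mul_assoc]
            simp only [CoxeterSystem.simple_mul_simple_self, one_mul]
            omega
          rw [hzero _ (by rw [e3.2]; simp), CoxeterSystem.simple_mul_simple_cancel_right,
            hzero (𝐬 (node d) * x) (by rw [e2.2]; simp), if_pos r5, mul_assoc (𝐬 (node d)),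
            CoxeterSystem.simple_mul_simple_cancel_left,
            hzero (x * 𝐬 (node d)) (by rw [e1.2]; simp),
            if_pos r3, CoxeterSystem.simple_mul_simple_cancel_right, ih, if_pos hx, ← mul_assoc,
            (hcomp x hxp _ e3.2).1 ⟨i, hi, hid⟩]
          simp
    · rw [if_neg hw]
      have f1 : cnt (lowWord d) w = 0 := by
        rw [ih, if_neg]; exact fun h => hw (low_subset_succ d h)
      have f2 : cnt (lowWord d) (w * 𝐬 (node d)) = 0 := by
        rw [ih, if_neg]; intro h; apply hw
        exact ⟨_, h, Or.inr (Or.inr (Or.inl (by simp)))⟩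
      have f3 : cnt (lowWord d) (𝐬 (node d) * w) = 0 := by
        rw [ih, if_neg]; intro h; apply hw
        exact ⟨_, h, Or.inr (Or.inl (by simp))⟩
      have f4 : cnt (lowWord d) (𝐬 (node d) * w * 𝐬 (node d)) = 0 := by
        rw [ih, if_neg]; intro h; apply hw
        rcases commute_or_exists hdn (inPar_of_mem_low (by omega) h) with ⟨hc, -⟩ | h'
        · refine ⟨_, h, Or.inl ?_⟩
          have := hc.eq
          rw [CoxeterSystem.simple_mul_simple_cancel_right, ← mul_assoc, ← mul_assoc,
            CoxeterSystem.simple_mul_simple_self, one_mul] at this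
          rw [this, CoxeterSystem.simple_mul_simple_cancel_right]
        · exact ⟨_, h, Or.inr (Or.inr (Or.inr ⟨by simp [mul_assoc], h'⟩))⟩
      rw [f1, f2, f3, f4]; simp

/-! ### The diagram automorphism -/

lemma cartan_rev (i j : Fin (n + 1)) : cartan n i.rev j.rev = cartan n i j := by
  simp only [cartan, Matrix.of_apply, Fin.rev_inj, Fin.val_rev]
  have := i.isLt
  have := j.isLt
  split_ifs <;> omega

lemma coxeterMatrix_rev (i j : Fin (n + 1)) :
    (coxeterMatrix n) i.rev j.rev = (coxeterMatrix n) i j := by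
  rw [coxeterMatrix_apply, coxeterMatrix_apply, cartan_rev, cartan_rev]
  simp [Fin.rev_inj]

/-- The automorphism induced by the symmetry `i ↦ n - i` of the diagram. -/
def tau : Weyl n →* Weyl n :=
  (sys n).lift ⟨fun i => 𝐬 i.rev, fun i j => by
    rw [← coxeterMatrix_rev]; exact (sys n).simple_mul_simple_pow _ _⟩

lemma tau_simple (i : Fin (n + 1)) : tau (𝐬 i) = 𝐬 i.rev :=
  (sys n).lift_apply_simple _ i

@[simp] lemma tau_tau (w : Weyl n) : tau (tau w) = w := by
  induction w using (sys n).simple_induction_left with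
  | one => simp
  | mul_simple_left w i ih => rw [map_mul, map_mul, ih, tau_simple, tau_simple, Fin.rev_rev]

lemma tau_wordProd (ω : List (Fin (n + 1))) : tau (π ω) = π (ω.map Fin.rev) := by
  induction ω with
  | nil => simp
  | cons i ω ih =>
    rw [List.map_cons, CoxeterSystem.wordProd_cons, CoxeterSystem.wordProd_cons, map_mul, ih,
      tau_simple]

@[simp] lemma length_tau (w : Weyl n) : ℓ (tau w) = ℓ w := by
  have key : ∀ w : Weyl n, ℓ (tau w) ≤ ℓ w := by
    intro w
    obtain ⟨ω, hω, rfl⟩ := exists_isReducedWord w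
    rw [tau_wordProd, hω]
    exact ((sys n).length_wordProd_le _).trans (by simp)
  exact (key w).antisymm (by simpa using key (tau w))

lemma IsReducedWord.tau {w : Weyl n} {ω : List (Fin (n + 1))} (h : IsReducedWord w ω) :
    IsReducedWord (tau w) (ω.map Fin.rev) := by
  obtain ⟨h, rfl⟩ := h
  refine ⟨?_, (tau_wordProd ω).symm⟩
  rw [CoxeterSystem.IsReduced, ← tau_wordProd, length_tau, h]; simp

lemma mem_support_tau {w : Weyl n} {i : Fin (n + 1)} : i ∈ support (tau w) ↔ i.rev ∈ support w := by
  have key : ∀ (w : Weyl n) (i : Fin (n + 1)), i ∈ support w → i.rev ∈ support (tau w) := by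
    rintro w i ⟨ω, h, hi⟩
    exact ⟨_, h.tau, List.mem_map_of_mem hi⟩
  refine ⟨fun h => by simpa using key _ _ h, fun h => by simpa using key _ _ h⟩

lemma isRightDescent_tau {w : Weyl n} {i : Fin (n + 1)} : RD (tau w) i ↔ RD w i.rev := by
  have : tau w * 𝐬 i = tau (w * 𝐬 i.rev) := by rw [map_mul, tau_simple, Fin.rev_rev]
  rw [CoxeterSystem.IsRightDescent, this, length_tau, length_tau, CoxeterSystem.IsRightDescent]

lemma map_rev_map_rev (ω : List (Fin (n + 1))) : (ω.map Fin.rev).map Fin.rev = ω := by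
  simp [Function.comp_def]

open Classical in
lemma cnt_map_rev (ω : List (Fin (n + 1))) (w : Weyl n) : cnt (ω.map Fin.rev) w = cnt ω (tau w) :=
    by
  induction ω using List.reverseRecOn generalizing w with
  | nil =>
    rw [List.map_nil, cnt_nil, cnt_nil]
    have : w = 1 ↔ tau w = 1 :=
      ⟨fun h => by simp [h], fun h => by rw [← tau_tau w, h, map_one]⟩
    simp [this]
  | append_singleton ω i ih =>
    rw [List.map_append, List.map_singleton, cnt_concat, cnt_concat, ih, ih, map_mul, tau_simple,
      Fin.rev_rev]
    simp only [isRightDescent_tau]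

open Classical in
lemma cnt_reverse (ω : List (Fin (n + 1))) (w : Weyl n) : cnt ω.reverse w = cnt ω w⁻¹ := by
  induction ω generalizing w with
  | nil => simp [cnt_nil]
  | cons i ω ih =>
    rw [List.reverse_cons, cnt_cons, cnt_concat, ih, ih]
    simp

/-- The action of the diagram automorphism on the lattices. -/
def flip : Lattice n →ₗ[ℤ] Lattice n := LinearMap.funLeft ℤ ℤ Fin.rev

lemma flip_apply (x : Lattice n) (i : Fin (n + 1)) : flip x i = x i.rev := rfl

lemma flip_basisVec (i : Fin (n + 1)) : flip (basisVec i : Lattice n) = basisVec i.rev := by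
  ext j
  simp [flip_apply, basisVec, Pi.single_apply, Fin.rev_eq_iff]

lemma corootRep_tau (w : Weyl n) (x : Lattice n) :
    corootRep n (tau w) (flip x) = flip (corootRep n w x) := by
  induction w using (sys n).simple_induction_left with
  | one => simp
  | mul_simple_left w i ih =>
    rw [map_mul, map_mul, map_mul, Module.End.mul_apply, Module.End.mul_apply, ih, tau_simple]
    generalize corootRep n w x = y
    rw [corootRep_simple, corootRep_simple, map_sub, map_smul, flip_basisVec]
    congr 2
    rw [pairing_basisVec_right, pairing_basisVec_right,
      ← Equiv.sum_comp (Fin.revPerm : Equiv.Perm (Fin (n + 1)))]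
    simp [flip_apply, cartan_rev]

/-- The symmetry moves the cut p to n + 1 - p and replaces ε by its complement in K. -/
lemma flip_eps {p : ℕ} (hp : p ≤ n + 1) : flip (eps p : Lattice n) = central n - eps (n + 1 - p) :=
    by
  rw [← eps_zero]; ext i
  simp only [flip_apply, eps, Fin.val_rev, Pi.sub_apply]
  have := i.isLt
  split_ifs <;> omega

lemma IsPosCoroot.tau {t : Weyl n} {β : Lattice n} (h : IsPosCoroot t β) :
    IsPosCoroot (tau t) (flip β) := by
  obtain ⟨u, i, rfl, h1, rfl⟩ := isPosCoroot_iff.1 h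
  refine isPosCoroot_iff.2 ⟨AffineC.tau u, i.rev, ?_, ?_, ?_⟩
  · rw [map_mul, map_mul, map_inv, tau_simple]
  · rwa [isRightDescent_tau, Fin.rev_rev]
  · rw [← corootRep_tau, flip_basisVec]

lemma BruhatCovers.tau {v w : Weyl n} (h : BruhatCovers v w) :
    BruhatCovers (tau v) (tau w) ∧ coverCoroot (tau v) (tau w) = flip (coverCoroot v w) := by
  have e : (AffineC.tau v)⁻¹ * AffineC.tau w = AffineC.tau (v⁻¹ * w) := by rw [map_mul, map_inv]
  obtain ⟨⟨u, i, hu⟩, hl⟩ := h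
  refine ⟨⟨⟨AffineC.tau u, i.rev, ?_⟩, by simpa using hl⟩, ?_⟩
  · rw [e, hu, map_mul, map_mul, map_inv, tau_simple]
  · apply coverCoroot_eq
    rw [e]
    exact (BruhatCovers.isPosCoroot ⟨⟨u, i, hu⟩, hl⟩).tau

/-! ### Products of elements with disjoint supports -/

/-- The products of reduced subwords of `highWord d`. -/
def high (d : ℕ) : Set (Weyl n) := {w | tau w ∈ low d}

lemma inPar_above_of_mem_high {d : ℕ} (hd : d ≤ n + 1) {w : Weyl n} (hw : w ∈ high d) :
    InPar (above (n + 1 - d)) w := by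
  rw [inPar_iff_support]
  intro i hi
  have h1 := inPar_iff_support.1 (inPar_of_mem_low hd hw)
    (show i.rev ∈ support (tau w) by rw [mem_support_tau]; simpa)
  have h2 : i.rev.val < d := h1
  rw [Fin.val_rev] at h2
  change n + 1 - d ≤ i.val
  omega

lemma inv_mem_high {d : ℕ} {w : Weyl n} (hw : w ∈ high d) : w⁻¹ ∈ high d := by
  change tau w⁻¹ ∈ low d
  rw [map_inv]; exact inv_mem_low hw

lemma compNum_tau (w : Weyl n) : numComponents (tau w) = numComponents w := by
  have key : ∀ w : Weyl n, numComponents w ≤ numComponents (tau w) := by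
    intro w
    unfold numComponents
    refine Set.ncard_le_ncard_of_injOn (fun J => Fin.rev ⁻¹' J) ?_ ?_ (Set.toFinite _)
    · rintro J ⟨⟨h1, h2, h3⟩, h4⟩
      have hP : ∀ (w : Weyl n) (J : Set (Fin (n + 1))), J.Nonempty ∧ J.OrdConnected ∧ J ⊆ support w
          →
          (Fin.rev ⁻¹' J).Nonempty ∧ (Fin.rev ⁻¹' J).OrdConnected ∧
            Fin.rev ⁻¹' J ⊆ support (tau w) := by
        rintro w J ⟨⟨i, hi⟩, h2, h3⟩
        refine ⟨⟨i.rev, by simpa⟩, ⟨?_⟩, fun i hi => mem_support_tau.2 (h3 hi)⟩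
        intro a ha b hb c hc
        exact h2.out hb ha ⟨by simpa using hc.2, by simpa using hc.1⟩
      refine ⟨hP w J ⟨h1, h2, h3⟩, ?_⟩
      intro J' hJ' hJJ'
      have h5 := h4 (by simpa using hP _ J' hJ') (fun i hi => by
        have := hJJ' (show i.rev ∈ Fin.rev ⁻¹' J by simpa)
        simpa using this)
      intro i hi
      exact h5 (by simpa)
    · intro J _ J' _ h
      have : Function.Surjective (Fin.rev : Fin (n + 1) → Fin (n + 1)) := Fin.rev_surjective
      exact this.preimage_injective h
  exact (by simpa using key (tau w) : _ ≤ _).antisymm (key w)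

open Classical in
lemma cnt_highWord {d : ℕ} (hd : d ≤ n + 1) (w : Weyl n) :
    cnt (highWord d) w = if w ∈ high d then 2 ^ numComponents w else 0 := by
  rw [highWord, cnt_map_rev, cnt_lowWord hd, compNum_tau]; rfl

lemma mem_lowWord {d : ℕ} (hd : d ≤ n + 1) : ∀ i ∈ (lowWord d : List (Fin (n + 1))), i ∈ below d :=
    by
  induction d with
  | zero => simp [lowWord]
  | succ d ih =>
    intro i hi
    simp only [lowWord, List.mem_cons, List.mem_append, List.not_mem_nil, or_false] at hi
    rcases hi with rfl | hi | rfl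
    · exact node_mem_below (by omega) (by omega)
    · exact below_mono (Nat.le_succ d) (ih (by omega) i hi)
    · exact node_mem_below (by omega) (by omega)

lemma mem_highWord {d : ℕ} (hd : d ≤ n + 1) :
    ∀ i ∈ (highWord d : List (Fin (n + 1))), i ∈ above (n + 1 - d) := by
  intro i hi
  obtain ⟨j, hj, rfl⟩ := List.mem_map.1 hi
  have h1 : j.val < d := mem_lowWord hd j hj
  change n + 1 - d ≤ j.rev.val
  rw [Fin.val_rev]; omega

lemma lowWord_reverse (d : ℕ) : (lowWord d : List (Fin (n + 1))).reverse = lowWord d := by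
  induction d with
  | zero => rfl
  | succ d ih => simp [lowWord, ih]

lemma highWord_reverse (d : ℕ) : (highWord d : List (Fin (n + 1))).reverse = highWord d := by
  rw [highWord, ← List.map_reverse, lowWord_reverse]

lemma inPar_of_cnt_ne_zero {J : Set (Fin (n + 1))} {ω : List (Fin (n + 1))} (hω : ∀ i ∈ ω, i ∈ J)
    {w : Weyl n} (h : cnt ω w ≠ 0) : InPar J w := by
  obtain ⟨σ, h1, h2⟩ := (cnt_ne_zero_iff ω w).1 h
  exact ⟨σ, fun i hi => hω i (h1.subset hi), h2.2⟩

open Classical in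
-- Letters are peeled off the end of ω', where the descents of y x in I are those of x. In the base
-- case the two parabolic subgroups meet trivially.
lemma cnt_append {J I : Set (Fin (n + 1))} (hJI : Disjoint J I) {ω ω' : List (Fin (n + 1))}
    (hω : ∀ i ∈ ω, i ∈ J) (hω' : ∀ i ∈ ω', i ∈ I) {y x : Weyl n} (hy : InPar J y)
    (hx : InPar I x) : cnt (ω ++ ω') (y * x) = cnt ω y * cnt ω' x := by
  induction ω' using List.reverseRecOn generalizing x with
  | nil =>
    rw [List.append_nil, cnt_nil]
    split_ifs with h
    · simp [h]
    · rw [mul_zero]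
      by_contra h1
      have h2 := hy.inv.mul (inPar_of_cnt_ne_zero hω h1)
      rw [inv_mul_cancel_left] at h2
      exact h (h2.eq_one_of_disjoint hJI hx)
  | append_singleton ω' i ih =>
    have hi : i ∈ I := hω' i (by simp)
    have h := fun j hj => hω' j (List.mem_append_left _ hj)
    rw [← List.append_assoc, cnt_concat, cnt_concat, ih h hx, mul_assoc y,
      ih h (hx.mul (InPar.simple hi))]
    simp only [isRightDescent_mul_iff hJI hy hx hi]
    split_ifs <;> ring

lemma exists_of_cnt_append_ne_zero {ω ω' : List (Fin (n + 1))} {w : Weyl n}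
    (h : cnt (ω ++ ω') w ≠ 0) : ∃ y x, w = y * x ∧ cnt ω y ≠ 0 ∧ cnt ω' x ≠ 0 := by
  obtain ⟨σ, h1, h2, rfl⟩ := (cnt_ne_zero_iff _ w).1 h
  obtain ⟨σ₁, σ₂, rfl, h3, h4⟩ := List.sublist_append_iff.1 h1
  have h5 := isReduced_append h2
  exact ⟨π σ₁, π σ₂, CoxeterSystem.wordProd_append _ _ _, (cnt_ne_zero_iff _ _).2 ⟨σ₁, h3, h5.1,
      rfl⟩,
    (cnt_ne_zero_iff _ _).2 ⟨σ₂, h4, h5.2, rfl⟩⟩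

/-- The products of reduced subwords of `highWord (n + 1 - p) ++ lowWord p`. -/
def highLow (p : ℕ) : Set (Weyl n) := {w | ∃ y ∈ high (n + 1 - p), ∃ x ∈ low p, w = y * x}

/-- The products of reduced subwords of `lowWord p ++ highWord (n + 1 - p)`. -/
def lowHigh (p : ℕ) : Set (Weyl n) := {w | ∃ y ∈ high (n + 1 - p), ∃ x ∈ low p, w = x * y}

lemma inv_mem_highLow {p : ℕ} {w : Weyl n} : w⁻¹ ∈ highLow p ↔ w ∈ lowHigh p := by
  constructor
  · rintro ⟨y, hy, x, hx, h⟩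
    exact ⟨y⁻¹, inv_mem_high hy, x⁻¹, inv_mem_low hx, by rw [← inv_inv w, h, mul_inv_rev]⟩
  · rintro ⟨y, hy, x, hx, rfl⟩
    exact ⟨y⁻¹, inv_mem_high hy, x⁻¹, inv_mem_low hx, mul_inv_rev _ _⟩

lemma inv_mem_lowHigh {p : ℕ} {w : Weyl n} : w⁻¹ ∈ lowHigh p ↔ w ∈ highLow p := by
  rw [← inv_mem_highLow, inv_inv]

/-- The symmetry keeps the order of the factors but exchanges high and low. -/
lemma tau_mem_lowHigh {p : ℕ} (hp : p ≤ n + 1) {w : Weyl n} :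
    tau w ∈ lowHigh (n + 1 - p) ↔ w ∈ highLow p := by
  have e : n + 1 - (n + 1 - p) = p := by omega
  constructor
  · rintro ⟨y, hy, x, hx, h⟩
    rw [e] at hy
    refine ⟨tau x, by simpa [high] using hx, tau y, hy, ?_⟩
    rw [← tau_tau w, h, map_mul]
  · rintro ⟨y, hy, x, hx, rfl⟩
    refine ⟨tau x, by simpa [high, e] using hx, tau y, hy, map_mul _ _ _⟩

lemma tau_mem_highLow {p : ℕ} (hp : p ≤ n + 1) {w : Weyl n} :
    tau w ∈ highLow (n + 1 - p) ↔ w ∈ lowHigh p := by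
  rw [← inv_mem_lowHigh, ← map_inv, tau_mem_lowHigh hp, inv_mem_highLow]

/-! ### Counting subwords at a fixed cut -/

section Mult
variable {p : ℕ}

lemma mem_par_of_mem (hp : p ≤ n + 1) {x y : Weyl n} (hy : y ∈ high (n + 1 - p))
    (hx : x ∈ low p) : InPar (above p) y ∧ InPar (below p) x := by
  have e : n + 1 - (n + 1 - p) = p := by omega
  refine ⟨?_, inPar_of_mem_low hp hx⟩
  have := inPar_above_of_mem_high (by omega) hy
  rwa [e] at this

lemma cnt_high_low (hp : p ≤ n + 1) {x y : Weyl n} (hy : y ∈ high (n + 1 - p)) (hx : x ∈ low p) :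
    cnt (highWord (n + 1 - p) ++ lowWord p) (y * x) = 2 ^ (numComponents y + numComponents x) ∧
    cnt (lowWord p ++ highWord (n + 1 - p)) (x * y) = 2 ^ (numComponents y + numComponents x) := by
  have e : n + 1 - (n + 1 - p) = p := by omega
  obtain ⟨h1, h2⟩ := mem_par_of_mem hp hy hx
  have h3 := mem_highWord (n := n) (d := n + 1 - p) (by omega)
  rw [e] at h3
  rw [cnt_append (disjoint_above_below p) h3 (mem_lowWord hp) h1 h2,
    cnt_append (disjoint_above_below p).symm (mem_lowWord hp) h3 h2 h1,
    cnt_highWord (by omega), cnt_lowWord hp, if_pos hx, if_pos hy, pow_add]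
  exact ⟨rfl, mul_comm _ _⟩

lemma cnt_highLow_ne_zero (hp : p ≤ n + 1) {w : Weyl n} :
    cnt (highWord (n + 1 - p) ++ lowWord p) w ≠ 0 ↔ w ∈ highLow p := by
  constructor
  · intro h
    obtain ⟨y, x, rfl, h1, h2⟩ := exists_of_cnt_append_ne_zero h
    rw [cnt_highWord (by omega)] at h1
    rw [cnt_lowWord hp] at h2
    exact ⟨y, by by_contra h; simp [h] at h1, x, by by_contra h; simp [h] at h2, rfl⟩
  · rintro ⟨y, hy, x, hx, rfl⟩
    rw [(cnt_high_low hp hy hx).1]; positivity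

lemma cnt_lowHigh_eq (w : Weyl n) : cnt (lowWord p ++ highWord (n + 1 - p)) w =
    cnt (highWord (n + 1 - p) ++ lowWord p) w⁻¹ := by
  rw [← cnt_reverse, List.reverse_append, lowWord_reverse, highWord_reverse]

lemma cnt_lowHigh_ne_zero (hp : p ≤ n + 1) {w : Weyl n} :
    cnt (lowWord p ++ highWord (n + 1 - p)) w ≠ 0 ↔ w ∈ lowHigh p := by
  rw [cnt_lowHigh_eq, cnt_highLow_ne_zero hp, inv_mem_highLow]

/-- If both bond nodes occur, the two orders of the factors give different elements. -/
lemma not_commuting_products (h1 : 1 ≤ p) (hp : p ≤ n) {x y x' y' : Weyl n}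
    (hy : InPar (above p) y) (hx : InPar (below p) x) (hy' : InPar (above p) y')
    (hx' : InPar (below p) x') (hpy : node p ∈ support y) (hpx : node (p - 1) ∈ support x) :
    y * x ≠ x' * y' := by
  intro h
  have hpn : (node p : Fin (n + 1)).val = p := node_val hp
  have hpn' : (node (p - 1) : Fin (n + 1)).val = p - 1 := node_val (by omega)
  have nb : (node p : Fin (n + 1)) ∉ below p := node_notMem_below hp
  have na : (node (p - 1) : Fin (n + 1)) ∉ above p := by
    change ¬ p ≤ (node (p - 1) : Fin (n + 1)).val; omega
  -- Both sides are applied to ε_p and compared at the coordinate p - 1. On the right, x⁻¹ makes it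
  -- positive and y' does not touch it. On the left, y yields a vector z that vanishes below p and
  -- has z_p ≤ 0, and x'⁻¹ can only lower z.
  have e : x'⁻¹ * y = y' * x⁻¹ := by
    rw [inv_mul_eq_iff_eq_mul, ← mul_assoc, ← h]; simp
  obtain ⟨z, hz⟩ : ∃ z, z = corootRep n y (eps p) := ⟨_, rfl⟩
  have hz0 : ∀ j : Fin (n + 1), j.val < p → z j = 0 := by
    intro j hj
    rw [hz, hy.rep_apply reflRep_coroot (by change ¬ p ≤ j.val; omega)]
    simp [eps]; omega
  have hzp : z (node p) ≤ 0 := by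
    have := (hy.rep_sub_nonneg reflRep_coroot (μ := -eps p)
      (c := fun i => pairing n (eps p) (basisVec i)) (fun i hi => by
        have hi' : p ≤ i.val := hi
        rw [pairing_eps h1 hp, if_neg (c := i.val + 1 = p) (by omega)]
        split_ifs <;> norm_num)
      (fun i _ => by rw [map_neg, corootRep_simple]; module)).2 (node p) hpy (by
        rw [pairing_eps h1 hp, hpn]; simp; split_ifs <;> norm_num)
    rw [map_neg, ← hz] at this
    simp [eps, hpn] at this
    omega
  have hx1 := (hx.inv.rep_sub_nonneg reflRep_coroot (μ := eps p)
    (c := fun i => -pairing n (eps p) (basisVec i)) (fun i hi => by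
        have hi' : i.val < p := hi
        rw [pairing_eps h1 hp, if_neg (c := i.val = p) (by omega)]
        split_ifs <;> norm_num)
    (fun i _ => by rw [corootRep_simple]; module)).2 (node (p - 1)) (by rwa [support_inv]) (by
        rw [pairing_eps h1 hp, hpn', if_neg (by omega), if_pos (by omega)]
        split_ifs <;> norm_num)
  -- Among the nodes from p on, only p itself is bonded to a node below p.
  have hpair : ∀ i : Fin (n + 1), i.val < p →
      pairing n z (basisVec i) = z (node p) * cartan n (node p) i := by
    intro i hi
    rw [pairing_basisVec_right]
    refine Finset.sum_eq_single _ (fun j _ hj => ?_) (by simp)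
    rcases lt_or_ge j.val p with h2 | h2
    · rw [hz0 j h2, zero_mul]
    · have h3 : j.val ≠ p := fun h3 => hj (Fin.ext (by rw [h3, hpn]))
      have : cartan n j i = 0 := by
        simp only [cartan, Matrix.of_apply]
        rw [if_neg (fun h4 => by rw [h4] at h2; omega), if_neg (by omega)]
      rw [this, mul_zero]
  have hx2 := (hx'.inv.rep_sub_nonneg reflRep_coroot (μ := -z)
    (c := fun i => pairing n z (basisVec i)) (fun i hi => by
      have hi' : i.val < p := hi
      rw [hpair i hi']
      refine mul_nonneg_of_nonpos_of_nonpos hzp ?_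
      exact (cartanLike_cartan.2 (node p) i (by rintro rfl; omega)).1)
    (fun i _ => by rw [map_neg, corootRep_simple]; module)).1 (node (p - 1))
  have h2 := congrArg (fun w => corootRep n w (eps p) (node (p - 1))) e
  simp only [map_mul, Module.End.mul_apply] at h2
  rw [hy'.rep_apply reflRep_coroot na, ← hz] at h2
  have h3 := hz0 (node (p - 1)) (by omega)
  have h4 : (eps p : Lattice n) (node (p - 1)) = 0 := by simp [eps]; omega
  simp only [map_neg, Pi.sub_apply, Pi.neg_apply, Pi.zero_apply] at hx1 hx2
  omega

/-- Counting reduced subwords for an element of `highLow p`. -/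
lemma highLow_cases (h1 : 1 ≤ p) (hp : p ≤ n) {w : Weyl n} (hw : w ∈ highLow p) :
    (node (p - 1) ∈ support w ∧ node p ∈ support w ∧ w ∉ lowHigh p ∧
      cnt (highWord (n + 1 - p) ++ lowWord p) w = 2 ^ (numComponents w + 1)) ∨
    (¬ (node (p - 1) ∈ support w ∧ node p ∈ support w) ∧ w ∈ lowHigh p ∧
      cnt (highWord (n + 1 - p) ++ lowWord p) w = 2 ^ numComponents w ∧
      cnt (lowWord p ++ highWord (n + 1 - p)) w = 2 ^ numComponents w) := by
  obtain ⟨y, hy, x, hx, rfl⟩ := hw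
  obtain ⟨hyp, hxp⟩ := mem_par_of_mem (by omega) hy hx
  obtain ⟨hc, hc'⟩ := cnt_high_low (by omega) hy hx
  have hpn : (node p : Fin (n + 1)).val = p := node_val hp
  have hpn' : (node (p - 1) : Fin (n + 1)).val = p - 1 := node_val (by omega)
  have hys : ∀ i ∈ support y, p ≤ i.val := fun i hi => inPar_iff_support.1 hyp hi
  have hxs : ∀ i ∈ support x, i.val < p := fun i hi => inPar_iff_support.1 hxp hi
  have hsup := support_mul_of_disjoint (disjoint_above_below p) hyp hxp
  have hm1 : node (p - 1) ∈ support (y * x) ↔ node (p - 1) ∈ support x := by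
    rw [hsup]
    refine ⟨?_, Or.inr⟩
    rintro (h | h)
    · have := hys _ h; omega
    · exact h
  have hm2 : node p ∈ support (y * x) ↔ node p ∈ support y := by
    rw [hsup]
    refine ⟨?_, Or.inl⟩
    rintro (h | h)
    · exact h
    · have := hxs _ h; omega
  rw [hm1, hm2]
  by_cases h : node (p - 1) ∈ support x ∧ node p ∈ support y
  · left
    refine ⟨h.1, h.2, ?_, ?_⟩
    · rintro ⟨y', hy', x', hx', h2⟩
      obtain ⟨hyp', hxp'⟩ := mem_par_of_mem (by omega) hy' hx'
      exact not_commuting_products h1 hp hyp hxp hyp' hxp' h.2 h.1 h2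
    -- The cut splits one component of the support, which accounts for the extra factor 2.
    · have h2 := compNum_union_of_adjacent hxs hys h.1 (by omega) h.2 hpn
      rw [hc]
      simp only [numComponents_eq] at h2 ⊢
      rw [hsup, Set.union_comm, h2, add_comm]
  · right
    have hor : (∀ i ∈ support x, i.val + 1 ≠ p) ∨ ∀ i ∈ support y, i.val ≠ p := by
      by_contra! hcon
      obtain ⟨⟨i, hi, hi'⟩, j, hj, hj'⟩ := hcon
      refine h ⟨?_, ?_⟩
      · convert hi using 1; ext; omega
      · convert hj using 1; ext; omega
    have hcomm : y * x = x * y := by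
      refine InPar.commute (J := support y) (I := support x) ?_ (inPar_support y) (inPar_support x)
      intro i hi j hj
      have := hys i hi; have := hxs j hj
      rcases hor with h | h
      · have := h j hj; omega
      · have := h i hi; omega
    have h2 := compNum_union_of_not_adjacent hxs hys hor
    refine ⟨h, ⟨y, hy, x, hx, hcomm⟩, ?_, ?_⟩
    · rw [hc]; simp only [numComponents_eq] at h2 ⊢; rw [hsup, Set.union_comm, h2, add_comm]
    · rw [hcomm, hc', ← hcomm]
      simp only [numComponents_eq] at h2 ⊢; rw [hsup, Set.union_comm, h2, add_comm]

lemma numComponents_inv (w : Weyl n) : numComponents w⁻¹ = numComponents w := by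
  rw [numComponents_eq, numComponents_eq, support_inv]

lemma lowHigh_cases (h1 : 1 ≤ p) (hp : p ≤ n) {w : Weyl n} (hw : w ∈ lowHigh p) :
    (node (p - 1) ∈ support w ∧ node p ∈ support w ∧ w ∉ highLow p ∧
      cnt (lowWord p ++ highWord (n + 1 - p)) w = 2 ^ (numComponents w + 1)) ∨
    (¬ (node (p - 1) ∈ support w ∧ node p ∈ support w) ∧ w ∈ highLow p ∧
      cnt (highWord (n + 1 - p) ++ lowWord p) w = 2 ^ numComponents w ∧
      cnt (lowWord p ++ highWord (n + 1 - p)) w = 2 ^ numComponents w) := by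
  have h := highLow_cases h1 hp (inv_mem_highLow.2 hw)
  rw [← cnt_lowHigh_eq, cnt_lowHigh_eq w⁻¹, inv_inv, support_inv, numComponents_inv,
    ← inv_mem_highLow, inv_inv] at h
  tauto

/-- Both orders together count every element with the weight of the theorem. -/
lemma cnt_add_cnt (h1 : 1 ≤ p) (hp : p ≤ n) {w : Weyl n} (hw : w ∈ highLow p ∨ w ∈ lowHigh p) :
    cnt (highWord (n + 1 - p) ++ lowWord p) w + cnt (lowWord p ++ highWord (n + 1 - p)) w =
      2 ^ (numComponents w + 1) := by
  rcases hw with hw | hw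
  · rcases highLow_cases h1 hp hw with ⟨-, -, h2, h3⟩ | ⟨-, -, h2, h3⟩
    · rw [← cnt_lowHigh_ne_zero (by omega), not_not] at h2
      rw [h2, h3, add_zero]
    · rw [h2, h3]; ring
  · rcases lowHigh_cases h1 hp hw with ⟨-, -, h2, h3⟩ | ⟨-, -, h2, h3⟩
    · rw [← cnt_highLow_ne_zero (by omega), not_not] at h2
      rw [h2, h3, zero_add]
    · rw [h2, h3]; ring

end Mult

/-! ### The elements of `zees n` -/

/-- The word `d-1, …, 1, 0, 1, …, d-1`. -/
def lowPath : ℕ → List (Fin (n + 1))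
  | 0 => []
  | 1 => [node 0]
  | d + 2 => node (d + 1) :: (lowPath (d + 1) ++ [node (d + 1)])

/-- The word `n+1-d, …, n-1, n, n-1, …, n+1-d`. -/
def highPath (d : ℕ) : List (Fin (n + 1)) := (lowPath d).map Fin.rev

lemma lowPath_succ {d : ℕ} (hd : 1 ≤ d) :
    (lowPath (d + 1) : List (Fin (n + 1))) = node d :: (lowPath d ++ [node d]) := by
  obtain ⟨d, rfl⟩ := Nat.exists_eq_add_of_le' hd; rfl

lemma highPath_succ {p : ℕ} (h1 : 1 ≤ p) (hp : p < n) :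
    (highPath (n + 1 - p) : List (Fin (n + 1))) =
      node p :: (highPath (n + 1 - (p + 1)) ++ [node p]) := by
  have e : n + 1 - p = (n + 1 - (p + 1)) + 1 := by omega
  have e' : (node (n + 1 - (p + 1)) : Fin (n + 1)).rev = node p := by
    rw [rev_node (by omega)]; congr 1; omega
  rw [highPath, e, lowPath_succ (by omega), List.map_cons, List.map_append, List.map_singleton, e']
  rfl

lemma highPath_one : (highPath (n + 1 - n) : List (Fin (n + 1))) = [node n] := by
  have e : n + 1 - n = 1 := by omega
  rw [e]
  change [(node 0 : Fin (n + 1)).rev] = _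
  rw [rev_node (by omega)]; rfl

lemma lowPath_eq (d : ℕ) : (lowPath (d + 1) : List (Fin (n + 1))) =
    (List.range (d + 1)).reverse.map node ++ (List.range (d + 1)).tail.map node := by
  induction d with
  | zero => rfl
  | succ d ih =>
    rw [lowPath_succ (by omega), ih, List.range_succ (n := d + 1), List.reverse_append,
      List.tail_append_of_ne_nil (by simp)]
    simp

lemma finRange_eq : List.finRange (n + 1) = (List.range (n + 1)).map node := by
  rw [← List.map_coe_finRange_eq_range, List.map_map]
  conv_lhs => rw [← List.map_id (List.finRange (n + 1))]
  exact List.map_congr_left fun i _ => (node_self i).symm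

/-- The given word is the rotation in high-low order at the cut p = 1. The check is made on its
image under the symmetry of the diagram. -/
lemma rhoWord_eq (hn : 1 ≤ n) : rhoWord n = highPath (n + 1 - 1) ++ lowPath 1 := by
  have key : (rhoWord n).map Fin.rev = lowPath n ++ [node n] := by
    obtain ⟨m, rfl⟩ := Nat.exists_eq_add_of_le' hn
    rw [lowPath_eq, rhoWord, List.map_append, List.map_tail, List.map_tail,
      List.map_reverse, ← List.finRange_reverse, List.reverse_reverse, finRange_eq,
      List.range_succ (n := m + 1)]
    simp [← List.map_tail]
  rw [← map_rev_map_rev (rhoWord n), key, List.map_append, List.map_singleton, rev_node le_rfl]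
  simp [highPath, lowPath]

/-- The rotations of `rhoWord n`. -/
def IsCut (ω : List (Fin (n + 1))) : Prop :=
  ∃ p, 1 ≤ p ∧ p ≤ n ∧ (ω = highPath (n + 1 - p) ++ lowPath p ∨ ω = lowPath p ++ highPath (n + 1 -
      p))

/-- Rotating by one letter shifts the cut by one node, upwards in high-low order and downwards in
low-high order. At the extreme cut the order of the parts is exchanged instead. -/
lemma isCut_rotate_one (hn : 1 ≤ n) {ω : List (Fin (n + 1))} (h : IsCut ω) : IsCut (ω.rotate 1) :=
    by
  obtain ⟨p, h1, hp, rfl | rfl⟩ := h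
  · rcases hp.lt_or_eq with hp | rfl
    · refine ⟨p + 1, by omega, by omega, Or.inl ?_⟩
      rw [highPath_succ h1 hp, lowPath_succ h1]
      simp
    · refine ⟨p, h1, le_rfl, Or.inr ?_⟩
      rw [highPath_one]; simp
  · rcases h1.lt_or_eq with h1 | rfl
    · obtain ⟨q, rfl⟩ := Nat.exists_eq_add_of_le' h1.le
      refine ⟨q, by omega, by omega, Or.inr ?_⟩
      rw [highPath_succ (p := q) (by omega) (by omega), lowPath_succ (by omega)]
      simp
    · exact ⟨1, le_rfl, hn, Or.inl (by simp [lowPath])⟩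

lemma isRotated_high_low {p : ℕ} (h1 : 1 ≤ p) (hp : p ≤ n) :
    (highPath (n + 1 - p) ++ lowPath p).IsRotated (rhoWord n) := by
  induction p, h1 using Nat.le_induction with
  | base => rw [rhoWord_eq hp]
  | succ p h1 ih =>
    refine List.IsRotated.trans ?_ (ih (by omega))
    refine List.IsRotated.symm ⟨1, ?_⟩
    rw [highPath_succ h1 (by omega), lowPath_succ h1]
    simp

lemma isRotated_iff (hn : 1 ≤ n) {ω : List (Fin (n + 1))} : ω.IsRotated (rhoWord n) ↔ IsCut ω := by
  constructor
  · intro h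
    obtain ⟨k, rfl⟩ := h.symm
    induction k with
    | zero => rw [List.rotate_zero]; exact ⟨1, le_rfl, hn, Or.inl (rhoWord_eq hn)⟩
    | succ k ih =>
      rw [← List.rotate_rotate]
      exact isCut_rotate_one hn (ih (List.IsRotated.symm ⟨k, rfl⟩))
  · rintro ⟨p, h1, hp, rfl | rfl⟩
    · exact isRotated_high_low h1 hp
    · exact List.isRotated_append.trans (isRotated_high_low h1 hp)

lemma exists_lowPath_split {d : ℕ} (hd : 1 ≤ d) : ∃ (A B : List (Fin (n + 1))) (i : Fin (n + 1)),
    lowPath d = A ++ [i] ++ B ∧ lowWord d = A ++ [i, i] ++ B := by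
  induction d, hd using Nat.le_induction with
  | base => exact ⟨[], [], node 0, rfl, rfl⟩
  | succ d hd ih =>
    obtain ⟨A, B, i, h1, h2⟩ := ih
    refine ⟨node d :: A, B ++ [node d], i, ?_, ?_⟩
    · rw [lowPath_succ hd, h1]; simp
    · rw [lowWord, h2]; simp

lemma exists_highPath_split {d : ℕ} (hd : 1 ≤ d) : ∃ (A B : List (Fin (n + 1))) (i : Fin (n + 1)),
    highPath d = A ++ [i] ++ B ∧ highWord d = A ++ [i, i] ++ B := by
  obtain ⟨A, B, i, h1, h2⟩ := exists_lowPath_split (n := n) hd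
  exact ⟨A.map Fin.rev, B.map Fin.rev, i.rev, by simp [highPath, h1], by simp [highWord, h2]⟩

lemma lowPath_sublist (d : ℕ) : (lowPath d : List (Fin (n + 1))).Sublist (lowWord d) := by
  rcases Nat.eq_zero_or_pos d with rfl | hd
  · exact List.Sublist.refl _
  · obtain ⟨A, B, i, h1, h2⟩ := exists_lowPath_split (n := n) hd
    rw [h1, h2]
    exact (List.Sublist.append_left (by simp) A).append_right B

lemma highPath_sublist (d : ℕ) : (highPath d : List (Fin (n + 1))).Sublist (highWord d) :=
  (lowPath_sublist d).map _

/-- A reduced subword cannot use both of two equal adjacent letters. -/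
lemma sublist_of_isReduced {A B σ : List (Fin (n + 1))} {i : Fin (n + 1)}
    (h : (sys n).IsReduced σ) (hσ : σ.Sublist (A ++ [i, i] ++ B)) : σ.Sublist (A ++ [i] ++ B) := by
  obtain ⟨σ', σ₃, rfl, h', h3⟩ := List.sublist_append_iff.1 hσ
  obtain ⟨σ₁, σ₂, rfl, h1, h2⟩ := List.sublist_append_iff.1 h'
  refine (h1.append ?_).append h3
  have h4 := (isReduced_append (isReduced_append h).1).2
  rcases List.sublist_cons_iff.1 h2 with h5 | ⟨r, rfl, h5⟩
  · exact h5
  · rcases List.sublist_cons_iff.1 h5 with h6 | ⟨r, rfl, -⟩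
    · rw [List.sublist_nil.1 h6]
    · have h6 := (isReduced_append (A := [i, i]) (C := r) (by simpa using h4)).1
      simp [CoxeterSystem.IsReduced, CoxeterSystem.wordProd_cons] at h6

/-- Doubling the turning letters 0 and n adds no reduced subwords, so membership in 𝒵 can be read
off from the doubled words, whose counts are known. -/
lemma mem_zees_iff (hn : 1 ≤ n) {w : Weyl n} :
    w ∈ zees n ↔ ∃ p, 1 ≤ p ∧ p ≤ n ∧ (w ∈ highLow p ∨ w ∈ lowHigh p) := by
  have fwd : ∀ {p : ℕ} {σ : List (Fin (n + 1))}, 1 ≤ p → p ≤ n → (sys n).IsReduced σ →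
      (σ.Sublist (highWord (n + 1 - p) ++ lowWord p) →
        σ.Sublist (highPath (n + 1 - p) ++ lowPath p)) ∧
      (σ.Sublist (lowWord p ++ highWord (n + 1 - p)) →
        σ.Sublist (lowPath p ++ highPath (n + 1 - p))) := by
    intro p σ h1 hp hσ
    obtain ⟨A, B, i, e1, e2⟩ := exists_lowPath_split (n := n) h1
    obtain ⟨A', B', i', e1', e2'⟩ := exists_highPath_split (n := n) (d := n + 1 - p) (by omega)
    rw [e1, e2, e1', e2']
    constructor
    · intro h
      have h2 := sublist_of_isReduced (A := A') (i := i') (B := B' ++ (A ++ [i, i] ++ B)) hσ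
        (by simpa using h)
      simpa using sublist_of_isReduced (A := A' ++ [i'] ++ B' ++ A) (i := i) (B := B) hσ
        (by simpa using h2)
    · intro h
      have h2 := sublist_of_isReduced (A := A) (i := i) (B := B ++ (A' ++ [i', i'] ++ B')) hσ
        (by simpa using h)
      simpa using sublist_of_isReduced (A := A ++ [i] ++ B ++ A') (i := i') (B := B') hσ
        (by simpa using h2)
  constructor
  · rintro ⟨σ, ω, h1, h2, h3⟩
    obtain ⟨p, hp1, hp, rfl | rfl⟩ := (isRotated_iff hn).1 h2
    · exact ⟨p, hp1, hp, Or.inl ((cnt_highLow_ne_zero (by omega)).1 ((cnt_ne_zero_iff _ _).2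
        ⟨σ, h3.trans ((highPath_sublist _).append (lowPath_sublist _)), h1⟩))⟩
    · exact ⟨p, hp1, hp, Or.inr ((cnt_lowHigh_ne_zero (by omega)).1 ((cnt_ne_zero_iff _ _).2
        ⟨σ, h3.trans ((lowPath_sublist _).append (highPath_sublist _)), h1⟩))⟩
  · rintro ⟨p, hp1, hp, h | h⟩
    · obtain ⟨σ, h1, h2⟩ := (cnt_ne_zero_iff _ _).1 ((cnt_highLow_ne_zero (by omega)).2 h)
      exact ⟨σ, _, h2, (isRotated_iff hn).2 ⟨p, hp1, hp, Or.inl rfl⟩, (fwd hp1 hp h2.1).1 h1⟩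
    · obtain ⟨σ, h1, h2⟩ := (cnt_ne_zero_iff _ _).1 ((cnt_lowHigh_ne_zero (by omega)).2 h)
      exact ⟨σ, _, h2, (isRotated_iff hn).2 ⟨p, hp1, hp, Or.inr rfl⟩, (fwd hp1 hp h2.1).2 h1⟩

lemma inv_mem_zees (hn : 1 ≤ n) {w : Weyl n} (hw : w ∈ zees n) : w⁻¹ ∈ zees n := by
  rw [mem_zees_iff hn] at hw ⊢
  obtain ⟨p, h1, hp, h⟩ := hw
  refine ⟨p, h1, hp, ?_⟩
  rw [inv_mem_highLow, inv_mem_lowHigh]; exact h.symm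

lemma tau_mem_zees (hn : 1 ≤ n) {w : Weyl n} (hw : w ∈ zees n) : tau w ∈ zees n := by
  rw [mem_zees_iff hn] at hw ⊢
  obtain ⟨p, h1, hp, h⟩ := hw
  refine ⟨n + 1 - p, by omega, by omega, ?_⟩
  rw [tau_mem_highLow (by omega), tau_mem_lowHigh (by omega)]; exact h.symm

lemma finite_zees : (zees n).Finite := by
  have h : zees n ⊆ (fun l => π l) '' {l : List (Fin (n + 1)) | l.length ≤ (rhoWord n).length} := by
    rintro w ⟨σ, ω, h1, h2, h3⟩
    exact ⟨σ, h2.perm.length_eq ▸ h3.length_le, h1.2⟩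
  exact ((List.finite_length_le _ _).image _).subset h

/-! ### Ascending products -/

/-- The product `s_j s_{j+1} ⋯ s_{j+m-1}`. -/
def up (j m : ℕ) : Weyl n := π ((List.range' j m).map node)

lemma up_zero (j : ℕ) : (up j 0 : Weyl n) = 1 := by simp [up]

lemma up_succ (j m : ℕ) : (up j (m + 1) : Weyl n) = up j m * 𝐬 (node (j + m)) := by
  rw [up, List.range'_concat, List.map_append, CoxeterSystem.wordProd_append]
  simp [up]

lemma up_succ_left (j m : ℕ) : (up j (m + 1) : Weyl n) = 𝐬 (node j) * up (j + 1) m := by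
  rw [up, List.range'_succ, List.map_cons, CoxeterSystem.wordProd_cons, up]

lemma conj_up_succ (j m : ℕ) (x : Weyl n) : (up j (m + 1))⁻¹ * x * up j (m + 1) =
    𝐬 (node (j + m)) * ((up j m)⁻¹ * x * up j m) * 𝐬 (node (j + m)) := by
  rw [up_succ]; simp [mul_assoc]

lemma conj_up_succ_left (j m : ℕ) (y : Weyl n) : up j (m + 1) * y * (up j (m + 1))⁻¹ =
    𝐬 (node j) * (up (j + 1) m * y * (up (j + 1) m)⁻¹) * 𝐬 (node j) := by
  rw [up_succ_left]; simp [mul_assoc]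

lemma inPar_up {j m : ℕ} (h : j + m ≤ n + 1) :
    InPar {i | j ≤ i.val ∧ i.val < j + m} (up j m : Weyl n) := by
  refine ⟨_, fun i hi => ?_, rfl⟩
  obtain ⟨k, hk, rfl⟩ := List.mem_map.1 hi
  rw [List.mem_range'_1] at hk
  change j ≤ (node k : Fin (n + 1)).val ∧ (node k : Fin (n + 1)).val < j + m
  rwa [node_val (by omega)]

lemma simple_braid {i j : Fin (n + 1)} (hij : i.val + 1 = j.val) (hi : 1 ≤ i.val) (hj : j.val < n) :
    𝐬 j * 𝐬 i * 𝐬 j = 𝐬 i * 𝐬 j * 𝐬 i := by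
  have h1 := (sys n).simple_mul_simple_pow j i
  have hne : j ≠ i := by rintro rfl; omega
  have h2 : (coxeterMatrix n) j i = 3 := by
    rw [coxeterMatrix_apply, if_neg hne]
    have e1 : cartan n j i = -1 := by
      simp only [cartan, Matrix.of_apply, if_neg hne]
      rw [if_pos (by omega), if_neg (by omega)]
    have e2 : cartan n i j = -1 := by
      simp only [cartan, Matrix.of_apply, if_neg hne.symm]
      rw [if_pos (by omega), if_neg (by omega)]
    simp [e1, e2, braidOrder]
  rw [h2, pow_succ, pow_two] at h1
  have h3 : 𝐬 j * 𝐬 i * 𝐬 j * (𝐬 i * 𝐬 j * 𝐬 i) = 1 := by simpa only [mul_assoc] using h1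
  rw [eq_inv_of_mul_eq_one_left h3]
  simp [mul_assoc]

/-- The nodes j, …, j+m avoid both ends of the diagram and span a symmetric group; both sides are
the transposition of its two extreme points. -/
lemma braid_up {j m : ℕ} (hj : 1 ≤ j) (hm : j + m < n) :
    (up (j + 1) m : Weyl n)⁻¹ * 𝐬 (node j) * up (j + 1) m =
      up j m * 𝐬 (node (j + m)) * (up j m)⁻¹ := by
  induction m with
  | zero => simp [up_zero]
  | succ m ih =>
    have v1 : (node (j + 1 + m) : Fin (n + 1)).val = j + 1 + m := node_val (by omega)
    have v2 : (node (j + m) : Fin (n + 1)).val = j + m := node_val (by omega)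
    have hc : Commute (𝐬 (node (j + 1 + m))) (up j m : Weyl n) := by
      refine InPar.commute (J := {node (j + 1 + m)}) ?_ (InPar.simple rfl) (inPar_up (by omega))
      rintro i rfl k ⟨-, hk⟩
      rw [v1]; omega
    rw [conj_up_succ, ih (by omega), up_succ]
    have hb := simple_braid (i := node (j + m)) (j := node (j + 1 + m)) (by omega) (by omega)
      (by omega)
    have e : j + (m + 1) = j + 1 + m := by ring
    rw [e, mul_inv_rev, CoxeterSystem.inv_simple]
    calc _ = (𝐬 (node (j + 1 + m)) * up j m) * 𝐬 (node (j + m)) *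
          ((up j m)⁻¹ * 𝐬 (node (j + 1 + m))) := by simp only [mul_assoc]
      _ = (up j m * 𝐬 (node (j + 1 + m))) * 𝐬 (node (j + m)) *
          (𝐬 (node (j + 1 + m)) * (up j m)⁻¹) := by rw [hc.eq, hc.symm.inv_left.eq]
      _ = up j m * (𝐬 (node (j + 1 + m)) * 𝐬 (node (j + m)) * 𝐬 (node (j + 1 + m))) *
          (up j m)⁻¹ := by simp only [mul_assoc]
      _ = _ := by rw [hb]; simp only [mul_assoc]

/-- Each conjugation adds two to the length and puts its node into the support, which is what the
next application of `InPar.length_conj` needs. -/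
lemma conj_up_of_inPar_below {p m : ℕ} (hm : p + m ≤ n + 1) {x : Weyl n} (h1 : 1 ≤ p)
    (hx : InPar (below p) x) (hpx : node (p - 1) ∈ support x) :
    InPar (below (p + m)) ((up p m)⁻¹ * x * up p m) ∧ ℓ ((up p m)⁻¹ * x * up p m) = ℓ x + 2 * m ∧
      node (p + m - 1) ∈ support ((up p m)⁻¹ * x * up p m) ∧
      support x ⊆ support ((up p m)⁻¹ * x * up p m) := by
  induction m with
  | zero => simpa [up_zero] using ⟨hx, hpx⟩
  | succ m ih =>
    obtain ⟨i1, i2, i3, i4⟩ := ih (by omega)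
    rw [conj_up_succ]
    have hs : InPar (below (p + (m + 1))) (𝐬 (node (p + m)) : Weyl n) :=
      InPar.simple (node_mem_below (by omega) (by omega))
    obtain ⟨k1, k2⟩ := i1.length_conj (node_notMem_below (by omega)) i3 (cartan_neg (by
      rw [node_val (by omega), node_val (by omega)]; omega))
    refine ⟨(hs.mul (i1.mono (below_mono (by omega)))).mul hs, by omega, ?_, ?_⟩
    · rw [k2]; exact Or.inr rfl
    · rw [k2]; exact i4.trans Set.subset_union_left

lemma node_mem_above {d e : ℕ} (he : e ≤ n) (h : d ≤ e) : (node e : Fin (n + 1)) ∈ above d := by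
  change d ≤ (node e : Fin (n + 1)).val; rwa [node_val he]

lemma node_notMem_above {d e : ℕ} (he : e ≤ n) (h : e < d) : (node e : Fin (n + 1)) ∉ above d := by
  change ¬ d ≤ (node e : Fin (n + 1)).val; rw [node_val he]; omega

lemma above_mono {d e : ℕ} (h : d ≤ e) : (above e : Set (Fin (n + 1))) ⊆ above d :=
  fun _ hi => h.trans hi

lemma conj_up_of_inPar_above {j m : ℕ} (hm : j + m ≤ n) {y : Weyl n}
    (hy : InPar (above (j + m)) y) (hpy : node (j + m) ∈ support y) :
    InPar (above j) (up j m * y * (up j m)⁻¹) ∧ ℓ (up j m * y * (up j m)⁻¹) = ℓ y + 2 * m ∧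
      node j ∈ support (up j m * y * (up j m)⁻¹) := by
  induction m generalizing j with
  | zero => simpa [up_zero] using ⟨hy, hpy⟩
  | succ m ih =>
    have e : j + (m + 1) = j + 1 + m := by ring
    rw [e] at hy hpy
    obtain ⟨i1, i2, i3⟩ := ih (by omega) hy hpy
    rw [conj_up_succ_left]
    have hs : InPar (above j) (𝐬 (node j) : Weyl n) := InPar.simple (node_mem_above (by omega)
        le_rfl)
    obtain ⟨k1, k2⟩ := i1.length_conj (node_notMem_above (e := j) (by omega) (by omega)) i3
        (cartan_neg (by
      rw [node_val (by omega), node_val (by omega)]; omega))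
    refine ⟨(hs.mul (i1.mono (above_mono (by omega)))).mul hs, by omega, ?_⟩
    rw [k2]; exact Or.inr rfl

lemma high_mono {d e : ℕ} (h : d ≤ e) : (high d : Set (Weyl n)) ⊆ high e :=
  fun _ hw => low_mono h hw

lemma mul_simple_mem_high {j : ℕ} (hj : j ≤ n) {y : Weyl n} (hy : y ∈ high (n + 1 - (j + 1))) :
    y * 𝐬 (node j) ∈ high (n + 1 - j) := by
  have e : n + 1 - j = (n + 1 - (j + 1)) + 1 := by omega
  change tau _ ∈ low _
  rw [e, map_mul, tau_simple, rev_node hj, show n - j = n + 1 - (j + 1) by omega]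
  exact ⟨_, hy, Or.inr (Or.inr (Or.inl rfl))⟩

lemma conj_simple_mem_high {j : ℕ} (hj : j < n) {y : Weyl n} (hy : y ∈ high (n + 1 - (j + 1)))
    (hjy : node (j + 1) ∈ support y) : 𝐬 (node j) * y * 𝐬 (node j) ∈ high (n + 1 - j) := by
  have e : n + 1 - j = (n + 1 - (j + 1)) + 1 := by omega
  change tau _ ∈ low _
  rw [e, map_mul, map_mul, tau_simple, rev_node hj.le, show n - j = n + 1 - (j + 1) by omega]
  refine ⟨_, hy, Or.inr (Or.inr (Or.inr ⟨rfl, node (n - (j + 1)), ?_, ?_⟩))⟩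
  · rw [mem_support_tau, rev_node (by omega), show n - (n - (j + 1)) = j + 1 by omega]
    exact hjy
  · rw [node_val (by omega)]; omega

lemma conj_up_mem_high {j m : ℕ} (hm : j + m ≤ n) {y : Weyl n}
    (hy : y ∈ high (n + 1 - (j + m))) (hpy : node (j + m) ∈ support y) :
    up j m * y * (up j m)⁻¹ ∈ high (n + 1 - j) := by
  induction m generalizing j with
  | zero => simpa [up_zero] using hy
  | succ m ih =>
    have e : j + (m + 1) = j + 1 + m := by ring
    rw [e] at hy hpy
    have hyp := inPar_above_of_mem_high (by omega) hy
    rw [show n + 1 - (n + 1 - (j + 1 + m)) = j + 1 + m by omega] at hyp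
    rw [conj_up_succ_left]
    exact conj_simple_mem_high (by omega) (ih (by omega) hy hpy)
      (conj_up_of_inPar_above (by omega) hyp hpy).2.2

/-! ### Changing the cut -/

/-- An element of `low i` arises from `low p` by conjugation, or from some `low j` with `p ≤ j`
by a one-sided multiplication followed by conjugation, or it lies in `low (i - 1)`. -/
lemma low_trichotomy {p i : ℕ} (h1 : 1 ≤ p) (hpi : p ≤ i) (hi : i ≤ n + 1) {x : Weyl n}
    (hx : x ∈ low i) :
    (∃ x' ∈ low p, x = (up p (i - p))⁻¹ * x' * up p (i - p) ∧ (p < i → node (p - 1) ∈ support x')) ∨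
    (∃ j, p ≤ j ∧ j < i ∧ ∃ x' ∈ low j,
      x = (up (j + 1) (i - 1 - j))⁻¹ * (𝐬 (node j) * x') * up (j + 1) (i - 1 - j) ∨
      x = (up (j + 1) (i - 1 - j))⁻¹ * (x' * 𝐬 (node j)) * up (j + 1) (i - 1 - j)) ∨
    (p < i ∧ x ∈ low (i - 1)) := by
  induction i, hpi using Nat.le_induction generalizing x with
  | base => exact Or.inl ⟨x, hx, by simp [up_zero], fun h => absurd h (lt_irrefl _)⟩
  | succ d hd ih =>
    -- Only a two-sided outermost letter needs the induction hypothesis: it prolongs a conjugation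
    -- found one level down. The third alternative for x' is then impossible, as the conjugation
    -- requires the node d - 1 in its support.
    obtain ⟨x', hx', h⟩ := hx
    rcases h with rfl | rfl | rfl | ⟨rfl, k, hk, hkd⟩
    · exact Or.inr (Or.inr ⟨by omega, hx'⟩)
    · exact Or.inr (Or.inl ⟨d, hd, by omega, x', hx', Or.inl (by simp [up_zero])⟩)
    · exact Or.inr (Or.inl ⟨d, hd, by omega, x', hx', Or.inr (by simp [up_zero])⟩)
    · rcases ih (by omega) hx' with ⟨z, hz, rfl, hz'⟩ | ⟨j, hj, hjd, z, hz, h⟩ | ⟨h2, h3⟩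
      · refine Or.inl ⟨z, hz, ?_, fun _ => ?_⟩
        · rw [show d + 1 - p = d - p + 1 by omega, conj_up_succ, show p + (d - p) = d by omega]
        · rcases hd.lt_or_eq with h | rfl
          · exact hz' h
          · have : k = node (p - 1) := by ext; rw [node_val (by omega)]; omega
            simpa [this, up_zero] using hk
      · refine Or.inr (Or.inl ⟨j, hj, by omega, z, hz, ?_⟩)
        rw [show d + 1 - 1 - j = d - 1 - j + 1 by omega, conj_up_succ, conj_up_succ,
          show j + 1 + (d - 1 - j) = d by omega]
        exact h.imp (fun h => by rw [h]) (fun h => by rw [h])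
      · have : k.val < d - 1 := inPar_iff_support.1 (inPar_of_mem_low (by omega) h3) hk
        omega

/-- Moving a conjugated simple reflection across the cut. -/
lemma mul_conj_up {j m : ℕ} (hj : 1 ≤ j) (hm : j + m < n) {x y : Weyl n}
    (hy : InPar (above (j + m + 1)) y) (hx : InPar (below j) x) :
    y * ((up (j + 1) m)⁻¹ * (𝐬 (node j) * x) * up (j + 1) m) =
      (up j m * (y * 𝐬 (node (j + m))) * (up j m)⁻¹) * x ∧
    y * ((up (j + 1) m)⁻¹ * (x * 𝐬 (node j)) * up (j + 1) m) =
      x * (up j m * (y * 𝐬 (node (j + m))) * (up j m)⁻¹) := by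
  have c1 : Commute x (up (j + 1) m : Weyl n) := by
    refine InPar.commute ?_ hx (inPar_up (by omega))
    rintro i hi k ⟨hk, -⟩
    have : i.val < j := hi
    omega
  have c2 : Commute y (up j m : Weyl n) := by
    refine InPar.commute ?_ hy (inPar_up (by omega))
    rintro i hi k ⟨-, hk⟩
    have : j + m + 1 ≤ i.val := hi
    omega
  have c3 : Commute y x := by
    refine InPar.commute ?_ hy hx
    intro i hi k hk
    have : j + m + 1 ≤ i.val := hi
    have : k.val < j := hk
    omega
  -- The braid identity turns the conjugate of s_j attached to x into a conjugate of s_{j+m}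
  -- attached to y; every other move is a commutation of distant nodes.
  have hb := braid_up hj hm
  constructor
  · calc _ = y * ((up (j + 1) m)⁻¹ * 𝐬 (node j) * (x * up (j + 1) m)) := by simp only [mul_assoc]
      _ = y * ((up (j + 1) m)⁻¹ * 𝐬 (node j) * up (j + 1) m) * x := by
        rw [c1.eq]; simp only [mul_assoc]
      _ = (y * up j m) * 𝐬 (node (j + m)) * (up j m)⁻¹ * x := by rw [hb]; simp only [mul_assoc]
      _ = _ := by rw [c2.eq]; simp only [mul_assoc]
  · calc _ = y * (((up (j + 1) m)⁻¹ * x) * 𝐬 (node j) * up (j + 1) m) := by simp only [mul_assoc]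
      _ = (y * x) * ((up (j + 1) m)⁻¹ * 𝐬 (node j) * up (j + 1) m) := by
        rw [c1.symm.inv_left.eq]; simp only [mul_assoc]
      _ = x * (y * up j m * 𝐬 (node (j + m)) * (up j m)⁻¹) := by
        rw [hb, c3.eq]; simp only [mul_assoc]
      _ = _ := by rw [c2.eq]; simp only [mul_assoc]

/-- The elements that fix `eps p`, all of whose cocovers involve both nodes next to the cut. -/
def Rigid (p : ℕ) (w : Weyl n) : Prop :=
  corootRep n w (eps p) = eps p ∧
    ∀ v, BruhatCovers v w → node (p - 1) ∈ support v ∧ node p ∈ support v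

lemma Rigid.inv {p : ℕ} {w : Weyl n} (h : Rigid p w) : Rigid p w⁻¹ := by
  refine ⟨?_, fun v hv => ?_⟩
  · conv_lhs => rw [← h.1, ReflRep.inv_apply]
  · have h1 := h.2 v⁻¹ (by simpa only [inv_inv] using hv.inv.1)
    rwa [support_inv] at h1

lemma Rigid.tau {p : ℕ} (h1 : 1 ≤ p) (hp : p ≤ n) {w : Weyl n} (h : Rigid p w) :
    Rigid (n + 1 - p) (tau w) := by
  refine ⟨?_, fun v hv => ?_⟩
  · have h2 := corootRep_tau w (eps p)
    rw [h.1, flip_eps (by omega), map_sub, corootRep_central (by omega)] at h2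
    exact sub_right_injective h2
  · have h2 := h.2 _ (by simpa using hv.tau.1)
    rw [mem_support_tau, mem_support_tau, rev_node (by omega), rev_node (by omega)] at h2
    rw [show n + 1 - p - 1 = n - p by omega, show n + 1 - p = n - (p - 1) by omega]
    exact h2.symm

/-- The words `p, ξ, p` with all letters of `ξ` smaller than `p - 1` are not reduced. -/
lemma not_isReduced_of_commute {p : ℕ} (hp : p ≤ n) {ξ : List (Fin (n + 1))}
    (h : ∀ i ∈ ξ, i.val + 1 < p) : ¬ (sys n).IsReduced ([node p] ++ ξ ++ [node p]) := by
  intro hr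
  have hc : Commute (𝐬 (node p)) (π ξ) := by
    refine InPar.commute (J := {node p}) (I := {i | i.val + 1 < p}) ?_ (InPar.simple rfl) ⟨ξ, h,
        rfl⟩
    rintro i rfl j hj
    rw [node_val hp]; exact Or.inr hj
  have h2 : π ([node p] ++ ξ ++ [node p]) = π ξ := by
    rw [CoxeterSystem.wordProd_append, CoxeterSystem.wordProd_append,
        CoxeterSystem.wordProd_singleton,
      hc.eq]
    simp
  have h3 := (sys n).length_wordProd_le ξ
  rw [CoxeterSystem.IsReduced, h2] at hr
  simp at hr
  omega

/-- The factor `up p (m + 1)` carries ε_p to ε_{p+1}, which x fixes. A reduced word has the shape …,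
p, ξ, p, …, and deleting one letter leaves at least one p. The node p - 1 could be lost only by a
deletion inside ξ, but then the two letters p would cancel. -/
lemma rigid_of_conj {p m : ℕ} (h1 : 1 ≤ p) (hm : p + m < n) {x y : Weyl n}
    (hy : InPar (above (p + (m + 1))) y) (hx : InPar (below p) x)
    (hpx : node (p - 1) ∈ support x) :
    Rigid p (y * ((up p (m + 1))⁻¹ * x * up p (m + 1))) := by
  constructor
  · have fix : ∀ w : Weyl n, InPar (above (p + 1)) w → corootRep n w (eps p) = eps p := by
      intro w hw
      refine (hw.mono fun i hi => ?_).fix_eps h1 (by omega)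
      have : p + 1 ≤ i.val := hi
      exact ⟨by omega, by omega⟩
    have hu : corootRep n (up p (m + 1)) (eps p) = eps (p + 1) := by
      rw [up_succ_left, map_mul, Module.End.mul_apply, fix, simple_eps_self h1 (by omega)]
      exact (inPar_up (by omega)).mono fun i hi => hi.1
    rw [map_mul, map_mul, map_mul, Module.End.mul_apply, Module.End.mul_apply,
        Module.End.mul_apply, hu,
      InPar.fix_eps (w := x) (by omega) (by omega) (hx.mono fun i hi => ?_), ← hu,
          ReflRep.inv_apply,
      fix _ (hy.mono (above_mono (by omega)))]
    have : i.val < p := hi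
    exact ⟨by omega, by omega⟩
  · intro v hv
    obtain ⟨η, hη, rfl⟩ := exists_isReducedWord y
    obtain ⟨ξ, hξ, rfl⟩ := exists_isReducedWord x
    obtain ⟨i1, i2, -, -⟩ := conj_up_of_inPar_below (m := m + 1) (by omega) h1 hx hpx
    let R : List (Fin (n + 1)) := (List.range' (p + 1) m).map node
    let L : List (Fin (n + 1)) := η ++ R.reverse
    have hprod : π η * ((up p (m + 1))⁻¹ * π ξ * up p (m + 1)) =
        π (L ++ [node p] ++ ξ ++ ([node p] ++ R)) := by
      simp only [L, R, CoxeterSystem.wordProd_append, CoxeterSystem.wordProd_reverse,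
        CoxeterSystem.wordProd_singleton]
      rw [up_succ_left]
      simp [mul_assoc, up]
    have hred : (sys n).IsReduced (L ++ [node p] ++ ξ ++ ([node p] ++ R)) := by
      rw [CoxeterSystem.IsReduced, ← hprod,
        length_mul_of_disjoint (disjoint_above_below (p + (m + 1))) hy i1, i2, hη, hξ]
      simp [L, R]; omega
    have hpξ : node (p - 1) ∈ ξ := (show IsReducedWord (π ξ) ξ from ⟨hξ, rfl⟩).mem_support.1 hpx
    rw [hprod] at hv
    obtain ⟨A, k, C, e, rfl, hAC, -⟩ := hv.exists_deletion hred
    rw [(show IsReducedWord (π (A ++ C)) (A ++ C) from ⟨hAC, rfl⟩).mem_support,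
      (show IsReducedWord (π (A ++ C)) (A ++ C) from ⟨hAC, rfl⟩).mem_support]
    rcases List.append_eq_append_iff.1 e with ⟨a, rfl, h2⟩ | ⟨c, h2, h3⟩
    · refine ⟨by simp [hpξ], by simp⟩
    · rcases List.cons_eq_append_iff.1 h3 with ⟨rfl, h4⟩ | ⟨c, rfl, rfl⟩
      · rw [List.append_nil] at h2
        subst h2
        refine ⟨by simp [hpξ], by simp⟩
      -- The case of a deletion inside ξ = a ++ k :: c; if no p - 1 remained, s_p would commute with
      -- a ++ c.
      · have key : ∀ a, A = L ++ [node p] ++ a → ξ = a ++ k :: c →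
            node (p - 1) ∈ A ++ (c ++ ([node p] ++ R)) ∧ node p ∈ A ++ (c ++ ([node p] ++ R)) := by
          rintro a rfl rfl
          refine ⟨?_, by simp⟩
          by_contra hcon
          have hlt : ∀ i ∈ a ++ c, i.val + 1 < p := by
            intro i hi
            have hi' : i ∈ a ++ k :: c := by
              rw [List.mem_append] at hi ⊢
              exact hi.imp id (List.mem_cons_of_mem _)
            have h6 : i.val < p := hx.subset_of_isReduced hξ i hi'
            have h7 : i ≠ node (p - 1) := by
              rintro rfl
              rw [List.mem_append] at hi
              apply hcon
              rcases hi with hi | hi <;> simp [hi]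
            have h8 : i.val ≠ p - 1 := fun h => h7 (Fin.ext (by rw [node_val (by omega), h]))
            omega
          refine not_isReduced_of_commute (by omega) hlt ?_
          have h9 : L ++ [node p] ++ a ++ (c ++ ([node p] ++ R)) =
            L ++ ([node p] ++ (a ++ c) ++ [node p]) ++ R := by simp
          rw [h9] at hAC
          exact (isReduced_append (isReduced_append hAC).1).2
        rcases List.append_eq_append_iff.1 h2 with ⟨a, h4, h5⟩ | ⟨b, h4, h5⟩
        · exact key a h4 h5
        · rcases List.cons_eq_append_iff.1 h5 with ⟨rfl, h6⟩ | ⟨b', rfl, rfl⟩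
          · exact key [] (by simpa using h4.symm) (by simpa using h6)
          · refine ⟨by simp [hpξ], by simp⟩

/-- The cut moves down from i towards p. By `low_trichotomy` the factor x is a full conjugate (rigid
unless i = p), or passes a simple reflection to y and so yields a factorization at a lower cut j in
one of the two orders, or already lies in `low (i - 1)`. Inversion takes care of the opposite order.
-/
lemma highLow_dichotomy_of_le {p : ℕ} (h1 : 1 ≤ p) {i : ℕ} (hpi : p ≤ i) (hi : i ≤ n) {w : Weyl n}
    (hw : w ∈ highLow i) : w ∈ highLow p ∨ w ∈ lowHigh p ∨ Rigid p w := by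
  induction i using Nat.strong_induction_on generalizing w with
  | _ i ih =>
  have ih' : ∀ j, j < i → p ≤ j → ∀ w : Weyl n, w ∈ highLow j ∨ w ∈ lowHigh j →
      w ∈ highLow p ∨ w ∈ lowHigh p ∨ Rigid p w := by
    rintro j hji hpj w (hw | hw)
    · exact ih j hji hpj (by omega) hw
    · rcases ih j hji hpj (by omega) (inv_mem_highLow.2 hw) with h | h | h
      · exact Or.inr (Or.inl (inv_mem_highLow.1 h))
      · exact Or.inl (inv_mem_lowHigh.1 h)
      · exact Or.inr (Or.inr (by simpa only [inv_inv] using h.inv))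
  obtain ⟨y, hy, x, hx, rfl⟩ := hw
  have hyp := (mem_par_of_mem (by omega) hy hx).1
  rcases low_trichotomy h1 hpi (by omega) hx with ⟨x', hx', rfl, hpx⟩ | ⟨j, hj, hji, x', hx', h⟩ |
      ⟨h, h2⟩
  · rcases hpi.lt_or_eq with hlt | rfl
    · obtain ⟨m, rfl⟩ : ∃ m, i = p + (m + 1) := ⟨i - p - 1, by omega⟩
      rw [show p + (m + 1) - p = m + 1 by omega]
      exact Or.inr (Or.inr (rigid_of_conj h1 (by omega) hyp (inPar_of_mem_low (by omega) hx')
        (hpx hlt)))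
    · exact Or.inl ⟨y, hy, _, by simpa [up_zero] using hx', rfl⟩
  · obtain ⟨m, rfl⟩ : ∃ m, i = j + m + 1 := ⟨i - j - 1, by omega⟩
    rw [show j + m + 1 - 1 - j = m by omega] at h
    obtain ⟨e1, e2⟩ := mul_conj_up (j := j) (m := m) (by omega) (by omega) hyp
      (inPar_of_mem_low (by omega) hx')
    have hz : up j m * (y * 𝐬 (node (j + m))) * (up j m)⁻¹ ∈ high (n + 1 - j) := by
      refine conj_up_mem_high (by omega) (mul_simple_mem_high (by omega) hy) ?_
      rw [(hyp.length_mul_simple (i := node (j + m)) (node_notMem_above (by omega) (by omega))).2]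
      exact Or.inr rfl
    refine ih' j (by omega) hj _ ?_
    rcases h with rfl | rfl
    · rw [e1]; exact Or.inl ⟨_, hz, _, hx', rfl⟩
    · rw [e2]; exact Or.inr ⟨_, hz, _, hx', rfl⟩
  · exact ih' (i - 1) (by omega) (by omega) _ (Or.inl ⟨y, high_mono (by omega) hy, x, h2, rfl⟩)

lemma dichotomy_of_le {p : ℕ} (h1 : 1 ≤ p) {i : ℕ} (hpi : p ≤ i) (hi : i ≤ n) {w : Weyl n}
    (hw : w ∈ highLow i ∨ w ∈ lowHigh i) : w ∈ highLow p ∨ w ∈ lowHigh p ∨ Rigid p w := by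
  rcases hw with hw | hw
  · exact highLow_dichotomy_of_le h1 hpi hi hw
  · rcases highLow_dichotomy_of_le h1 hpi hi (inv_mem_highLow.2 hw) with h | h | h
    · exact Or.inr (Or.inl (inv_mem_highLow.1 h))
    · exact Or.inl (inv_mem_lowHigh.1 h)
    · exact Or.inr (Or.inr (by simpa only [inv_inv] using h.inv))

/-- Every element of `zees n` arises from any given cut, unless it is rigid for it. -/
lemma zees_dichotomy {p : ℕ} (h1 : 1 ≤ p) (hp : p ≤ n) {w : Weyl n} (hw : w ∈ zees n) :
    w ∈ highLow p ∨ w ∈ lowHigh p ∨ Rigid p w := by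
  obtain ⟨i, hi1, hi, h⟩ := (mem_zees_iff (by omega)).1 hw
  rcases le_total p i with hpi | hpi
  · exact dichotomy_of_le h1 hpi hi h
  · have h2 : tau w ∈ highLow (n + 1 - i) ∨ tau w ∈ lowHigh (n + 1 - i) := by
      rw [tau_mem_highLow (by omega), tau_mem_lowHigh (by omega)]; exact h.symm
    rcases dichotomy_of_le (p := n + 1 - p) (by omega) (by omega) (by omega) h2 with h | h | h
    · exact Or.inr (Or.inl ((tau_mem_highLow (by omega)).1 h))
    · exact Or.inl ((tau_mem_lowHigh (by omega)).1 h)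
    · have h3 := h.tau (by omega) (by omega)
      rw [tau_tau, show n + 1 - (n + 1 - p) = p by omega] at h3
      exact Or.inr (Or.inr h3)

/-! ### Covers that fix `eps p` -/

/-- The coordinate p is where ε_p - v⁻¹ ε_p will be seen to be positive. -/
lemma eps_coord_lt {p : ℕ} (h1 : 1 ≤ p) (hp : p ≤ n) {y : Weyl n} (hy : InPar (above p) y)
    (hpy : node p ∈ support y) : corootRep n y (eps p) (node p) < 1 := by
  have hpn : (node p : Fin (n + 1)).val = p := node_val hp
  have := (hy.rep_sub_nonneg reflRep_coroot (μ := -eps p)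
    (c := fun i => pairing n (eps p) (basisVec i)) (fun i hi => by
      have hi' : p ≤ i.val := hi
      rw [pairing_eps h1 hp, if_neg (c := i.val + 1 = p) (by omega)]
      split_ifs <;> norm_num)
    (fun i _ => by rw [map_neg, corootRep_simple]; module)).2 (node p) hpy (by
      rw [pairing_eps h1 hp, hpn]; simp; split_ifs <;> norm_num)
  rw [map_neg] at this
  simp [eps, hpn] at this
  linarith

/-- Conjugates of `y s` and `s y s`, with `s` the node below the cut, form a cover fixing `eps p`. -/
lemma exists_conj_cover {p j m : ℕ} (hj : 1 ≤ j) (hp : p = j + m + 1) (hpn : p ≤ n) {y : Weyl n}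
    (hy : y ∈ high (n + 1 - p)) (hpy : node p ∈ support y) :
    ∃ z u : Weyl n, z ∈ high (n + 1 - j) ∧
      ℓ z = ℓ (up j m * (y * 𝐬 (node (j + m))) * (up j m)⁻¹) + 1 ∧
      (up j m * (y * 𝐬 (node (j + m))) * (up j m)⁻¹)⁻¹ * z = u * 𝐬 (node (j + m)) * u⁻¹ ∧
      corootRep n z (eps p) = eps p ∧
      eps p - corootRep n (up j m * (y * 𝐬 (node (j + m))) * (up j m)⁻¹)⁻¹ (eps p) =
        corootRep n u (basisVec (node (j + m))) := by
  have e : n + 1 - (n + 1 - p) = p := by omega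
  have hyp : InPar (above (j + m + 1)) y := by
    have := inPar_above_of_mem_high (by omega) hy
    rwa [e, hp] at this
  have hyp' : InPar (above (j + m)) y := hyp.mono (above_mono (by omega))
  have hs : InPar (above (j + m)) (𝐬 (node (j + m)) : Weyl n) :=
    InPar.simple (node_mem_above (by omega) le_rfl)
  subst hp
  obtain ⟨l1, s1⟩ := hyp.length_mul_simple (i := node (j + m))
    (node_notMem_above (by omega) (by omega))
  obtain ⟨l2, s2⟩ := hyp.length_conj (i := node (j + m))
    (node_notMem_above (by omega) (by omega)) hpy
    (cartan_neg (by rw [node_val (by omega), node_val (by omega)]; omega))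
  have k1 := conj_up_of_inPar_above (j := j) (m := m) (by omega) (hyp'.mul hs) (by
    rw [s1]; exact Or.inr rfl)
  have k2 := conj_up_of_inPar_above (j := j) (m := m) (by omega) ((hs.mul hyp').mul hs) (by
    rw [s2]; exact Or.inr rfl)
  have hu : ∀ w : Weyl n, InPar {i | j ≤ i.val ∧ i.val < j + m} w →
      corootRep n w (eps (j + m + 1)) = eps (j + m + 1) := by
    intro w hw
    refine (hw.mono fun i hi => ?_).fix_eps (by omega) hpn
    obtain ⟨h3, h4⟩ := hi
    exact ⟨by omega, by omega⟩
  have hyf : ∀ w : Weyl n, InPar (above (j + m + 1)) w →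
      corootRep n w (eps (j + m)) = eps (j + m) := by
    intro w hw
    refine (hw.mono fun i hi => ?_).fix_eps (by omega) (by omega)
    have : j + m + 1 ≤ i.val := hi
    exact ⟨by omega, by omega⟩
  have hup := inPar_up (n := n) (j := j) (m := m) (by omega)
  -- With s = s_{j+m}, the element u comes from (y s)⁻¹ (s y s) = (s y⁻¹) s (s y⁻¹)⁻¹, conjugated by
  -- `up j m`.
  refine ⟨up j m * (𝐬 (node (j + m)) * y * 𝐬 (node (j + m))) * (up j m)⁻¹,
    up j m * 𝐬 (node (j + m)) * y⁻¹, ?_, ?_, ?_, ?_, ?_⟩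
  · exact conj_up_mem_high (by omega) (conj_simple_mem_high (by omega) hy hpy) (by
      rw [s2]; exact Or.inr rfl)
  · rw [k2.2.1, k1.2.1, l1, l2]; ring
  · simp [mul_assoc]
  · simp only [map_mul, Module.End.mul_apply]
    rw [hu _ hup.inv, simple_eps_succ (by omega) (by omega), hyf _ hyp,
      simple_eps_self (by omega) (by omega), hu _ hup]
  · simp only [mul_inv_rev, inv_inv, CoxeterSystem.inv_simple, map_mul, Module.End.mul_apply]
    have e1 : (eps (j + m + 1) : Lattice n) = eps (j + m) - basisVec (node (j + m)) := by
      rw [eps_eq (p := j + m) (by omega)]; module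
    rw [hu _ hup.inv]
    nth_rw 2 [e1]
    rw [map_sub, map_sub, map_sub, hyf _ hyp.inv, simple_eps_self (by omega) (by omega), hu _ hup]
    module

/-- A full conjugate of s_0 has length 2p - 1, which the length bound excludes, and full support
below the cut excludes `low (p - 1)`. So x contains a one-sided letter, which `mul_conj_up` moves
over to y as y s; replacing y s by s y s produces the cover that fixes ε_p. -/
lemma exists_fixing_cover_of_low {p : ℕ} (h1 : 1 ≤ p) (hp : p ≤ n) {x y : Weyl n}
    (hy : y ∈ high (n + 1 - p)) (hx : x ∈ low p) (hpy : node p ∈ support y)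
    (hsup : ∀ i : Fin (n + 1), i.val < p → i ∈ support x) (hlen : ℓ x < 2 * p - 1) :
    ∃ w ∈ zees n, BruhatCovers (y * x) w ∧ corootRep n w (eps p) = eps p ∧
      coverCoroot (y * x) w = eps p - corootRep n (y * x)⁻¹ (eps p) := by
  obtain ⟨hyp, hxp⟩ := mem_par_of_mem (by omega) hy hx
  rcases low_trichotomy le_rfl h1 (by omega) hx with ⟨x', hx', h, hpx⟩ | ⟨j, hj, hjp, f, hf, h⟩ |
      ⟨h, h2⟩
  · exfalso
    have hne : x' ≠ 1 := by
      rintro rfl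
      have : x = 1 := by rw [h]; simp
      have h0 := hsup 0 (show 0 < p by omega)
      rw [this, support_one] at h0
      exact h0
    have hl : ℓ x' ≠ 0 := fun h => hne ((sys n).length_eq_zero_iff.1 h)
    rcases h1.lt_or_eq with hlt | rfl
    · have := (conj_up_of_inPar_below (m := p - 1) (by omega) le_rfl
        (inPar_of_mem_low (by omega) hx') (hpx hlt)).2.1
      rw [← h] at this; omega
    · have : x = x' := by rw [h]; simp [up_zero]
      rw [this] at hlen; omega
  · obtain ⟨m, rfl⟩ : ∃ m, p = j + m + 1 := ⟨p - j - 1, by omega⟩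
    rw [show j + m + 1 - 1 - j = m by omega] at h
    obtain ⟨z, u, hz, lz, ez, fz, cz⟩ := exists_conj_cover hj rfl hp hy hpy
    have hfp := inPar_of_mem_low (by omega) hf
    have hzp := (mem_par_of_mem (by omega) hz hf).1
    have hff : ∀ g : Weyl n, InPar (below j) g → corootRep n g (eps (j + m + 1)) = eps (j + m + 1)
        := by
      intro g hg
      refine (hg.mono fun i hi => ?_).fix_eps (by omega) hp
      have : i.val < j := hi
      exact ⟨by omega, by omega⟩
    obtain ⟨e1, e2⟩ := mul_conj_up (j := j) (m := m) (by omega) (by omega) hyp hfp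
    have hz0 := conj_up_of_inPar_above (j := j) (m := m) (by omega)
      (y := y * 𝐬 (node (j + m))) ((hyp.mono (above_mono (by omega))).mul
        (InPar.simple (node_mem_above (by omega) le_rfl))) (by
        rw [(hyp.length_mul_simple (i := node (j + m))
          (node_notMem_above (by omega) (by omega))).2]
        exact Or.inr rfl)
    -- The sign is decided at the coordinate p, where ε_p is 1 and v⁻¹ ε_p is smaller.
    have hpos : ∀ v : Weyl n, v = y * x → ∀ g : Weyl n,
        eps (j + m + 1) - corootRep n v⁻¹ (eps (j + m + 1)) =
          corootRep n g (basisVec (node (j + m))) → ¬ RD g (node (j + m)) := by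
      rintro v rfl g hg hRD
      have h3 := reflRep_coroot.nonpos g _ hRD (node (j + m + 1))
      have h4 := eps_coord_lt h1 hp hyp.inv (by rwa [support_inv])
      have nb : (node (j + m + 1) : Fin (n + 1)) ∉ below (j + m + 1) := node_notMem_below hp
      rw [← hg, Pi.sub_apply, mul_inv_rev, map_mul, Module.End.mul_apply,
        hxp.inv.rep_apply reflRep_coroot nb, Pi.zero_apply] at h3
      have h5 : (eps (j + m + 1) : Lattice n) (node (j + m + 1)) = 1 := by
        simp [eps, node_val hp]
      linarith
    generalize up j m * (y * 𝐬 (node (j + m))) * (up j m)⁻¹ = z₀ at *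
    rcases h with h | h
    · have hv : y * x = z₀ * f := by rw [h, e1]
      have hl : ℓ (z * f) = ℓ (z₀ * f) + 1 := by
        rw [length_mul_of_disjoint (disjoint_above_below j) hzp hfp,
          length_mul_of_disjoint (disjoint_above_below j) hz0.1 hfp, lz]; ring
      have ht : (z₀ * f)⁻¹ * (z * f) = (f⁻¹ * u) * 𝐬 (node (j + m)) * (f⁻¹ * u)⁻¹ := by
        calc _ = f⁻¹ * (z₀⁻¹ * z) * f := by simp only [mul_inv_rev, mul_assoc]
          _ = _ := by rw [ez]; simp only [mul_inv_rev, mul_assoc, inv_inv]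
      have hc : eps (j + m + 1) - corootRep n (z₀ * f)⁻¹ (eps (j + m + 1)) =
          corootRep n (f⁻¹ * u) (basisVec (node (j + m))) := by
        rw [map_mul, Module.End.mul_apply, ← cz, map_sub, hff _ hfp.inv, mul_inv_rev, map_mul,
          Module.End.mul_apply]
      refine ⟨z * f, (mem_zees_iff (by omega)).2 ⟨j, hj, by omega, Or.inl ⟨z, hz, f, hf, rfl⟩⟩, ?_⟩
      rw [hv]
      refine ⟨⟨⟨_, _, ht⟩, hl⟩, ?_, ?_⟩
      · rw [map_mul, Module.End.mul_apply, hff _ hfp, fz]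
      · exact coverCoroot_eq (isPosCoroot_iff.2 ⟨_, _, ht, hpos _ hv.symm _ hc, hc⟩)
    · have hv : y * x = f * z₀ := by rw [h, e2]
      have hl : ℓ (f * z) = ℓ (f * z₀) + 1 := by
        rw [length_mul_of_disjoint (disjoint_above_below j).symm hfp hzp,
          length_mul_of_disjoint (disjoint_above_below j).symm hfp hz0.1, lz]; ring
      have ht : (f * z₀)⁻¹ * (f * z) = u * 𝐬 (node (j + m)) * u⁻¹ := by
        rw [← ez]; simp [mul_assoc]
      have hc : eps (j + m + 1) - corootRep n (f * z₀)⁻¹ (eps (j + m + 1)) =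
          corootRep n u (basisVec (node (j + m))) := by
        rw [← cz, mul_inv_rev, map_mul, Module.End.mul_apply, hff _ hfp.inv]
      refine ⟨f * z, (mem_zees_iff (by omega)).2 ⟨j, hj, by omega, Or.inr ⟨z, hz, f, hf, rfl⟩⟩, ?_⟩
      rw [hv]
      refine ⟨⟨⟨_, _, ht⟩, hl⟩, ?_, ?_⟩
      · rw [map_mul, Module.End.mul_apply, fz, hff _ hfp]
      · exact coverCoroot_eq (isPosCoroot_iff.2 ⟨_, _, ht, hpos _ hv.symm _ hc, hc⟩)
  · have h3 : (node (p - 1) : Fin (n + 1)).val = p - 1 := node_val (by omega)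
    have h4 : (node (p - 1) : Fin (n + 1)).val < p - 1 :=
      inPar_iff_support.1 (inPar_of_mem_low (by omega) h2) (hsup _ (by omega))
    omega

/-- If ℓ(x) ≥ 2p - 1, then ℓ(v) < 2n forces ℓ(y) < 2(n + 1 - p) - 1. In that case the previous lemma
applies to the image of v⁻¹ under the symmetry, which is again a high factor times a low factor,
with the roles of x and y exchanged. -/
lemma exists_fixing_cover {p : ℕ} (h1 : 1 ≤ p) (hp : p ≤ n) {v : Weyl n} (hv : v ∈ highLow p)
    (hsup : ∀ i, i ∈ support v) (hlen : ℓ v < 2 * n) :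
    ∃ w ∈ zees n, BruhatCovers v w ∧ corootRep n w (eps p) = eps p ∧
      coverCoroot v w = eps p - corootRep n v⁻¹ (eps p) := by
  obtain ⟨y, hy, x, hx, rfl⟩ := hv
  obtain ⟨hyp, hxp⟩ := mem_par_of_mem (by omega) hy hx
  have hsup' : ∀ i, i ∈ support y ∪ support x := by
    rwa [support_mul_of_disjoint (disjoint_above_below p) hyp hxp] at hsup
  have hlow : ∀ i : Fin (n + 1), i.val < p → i ∈ support x := by
    intro i hi
    refine (hsup' i).resolve_left fun h => ?_
    have : p ≤ i.val := inPar_iff_support.1 hyp h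
    omega
  have hhigh : ∀ i : Fin (n + 1), p ≤ i.val → i ∈ support y := by
    intro i hi
    refine (hsup' i).resolve_right fun h => ?_
    have : i.val < p := inPar_iff_support.1 hxp h
    omega
  rw [length_mul_of_disjoint (disjoint_above_below p) hyp hxp] at hlen
  by_cases hl : ℓ x < 2 * p - 1
  · exact exists_fixing_cover_of_low h1 hp hy hx (hhigh _ (by rw [node_val hp])) hlow hl
  · have hx' : tau x⁻¹ ∈ high (n + 1 - (n + 1 - p)) := by
      rw [show n + 1 - (n + 1 - p) = p by omega]
      change tau (tau x⁻¹) ∈ low p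
      rw [tau_tau]; exact inv_mem_low hx
    have hy' : tau y⁻¹ ∈ low (n + 1 - p) := inv_mem_high hy
    obtain ⟨w, hw, hc, hf, hβ⟩ := exists_fixing_cover_of_low (p := n + 1 - p) (by omega) (by omega)
      hx' hy' (by
        rw [mem_support_tau, support_inv, rev_node (by omega)]
        exact hlow _ (by rw [node_val (by omega)]; omega)) (fun i hi => by
        rw [mem_support_tau, support_inv]
        exact hhigh _ (by rw [Fin.val_rev]; omega)) (by
        rw [length_tau, (sys n).length_inv]; omega)
    have e : (tau (tau x⁻¹ * tau y⁻¹))⁻¹ = y * x := by rw [map_mul, tau_tau, tau_tau]; simp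
    have hfl : flip (eps (n + 1 - p) : Lattice n) = central n - eps p := by
      rw [flip_eps (by omega)]; congr 2; omega
    have hfix : corootRep n (tau w) (eps p) = eps p := by
      have h2 := corootRep_tau w (eps (n + 1 - p))
      rw [hf, hfl, map_sub, corootRep_central (by omega)] at h2
      exact sub_right_injective h2
    obtain ⟨c1, b1⟩ := hc.tau
    obtain ⟨c2, b2⟩ := c1.inv
    rw [e] at c2 b2
    refine ⟨(tau w)⁻¹, inv_mem_zees (by omega) (tau_mem_zees (by omega) hw), c2, ?_, ?_⟩
    · conv_lhs => rw [← hfix, ReflRep.inv_apply]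
    · have e' : tau (tau x⁻¹ * tau y⁻¹) = (y * x)⁻¹ := by rw [← e, inv_inv]
      have e'' : tau (tau x⁻¹ * tau y⁻¹)⁻¹ = y * x := by rw [map_inv, e]
      rw [b2, b1, hβ, e', map_sub, hfl, ← corootRep_tau, e'', hfl]
      simp only [map_sub, corootRep_central (show 1 ≤ n by omega), ReflRep.inv_apply]
      module

/-! ### Summation over covers -/

/-- The set F may contain covers that ω does not reach, so one index set serves both words. -/
lemma coverSum_eq_sum {ω : List (Fin (n + 1))} {v : Weyl n} {F : Finset (Weyl n)}
    (hF : ∀ w ∈ F, BruhatCovers v w) (hF' : ∀ w, BruhatCovers v w → cnt ω w ≠ 0 → w ∈ F) :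
    coverSum ω v = ∑ w ∈ F, cnt ω w • coverCoroot v w := by
  classical
  have key : ∀ L : List (List (Fin (n + 1))),
      (∀ σ ∈ L, (sys n).IsReduced σ → BruhatCovers v (π σ) → π σ ∈ F) →
      (L.map fun σ => if (sys n).IsReduced σ ∧ BruhatCovers v (π σ) then coverCoroot v (π σ)
        else 0).sum =
      ∑ w ∈ F, (L.map fun σ => if IsReducedWord w σ then (1 : ℤ) else 0).sum • coverCoroot v w := by
    intro L hL
    induction L with
    | nil => simp
    | cons σ L ih =>
      simp only [List.map_cons, List.sum_cons, add_smul, Finset.sum_add_distrib]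
      rw [ih fun τ hτ => hL τ (List.mem_cons_of_mem _ hτ)]
      congr 1
      split_ifs with h
      · rw [Finset.sum_eq_single_of_mem (π σ) (hL σ List.mem_cons_self h.1 h.2)]
        · rw [if_pos ⟨h.1, rfl⟩, one_smul]
        · rintro w - hw
          rw [if_neg fun h' => hw h'.2.symm, zero_smul]
      · refine (Finset.sum_eq_zero fun w hw => ?_).symm
        rw [if_neg fun h' => h ⟨h'.1, by rw [h'.2]; exact hF w hw⟩, zero_smul]
  have h := key ω.sublists fun σ hσ h1 h2 =>
    hF' _ h2 ((cnt_ne_zero_iff _ _).2 ⟨σ, List.mem_sublists.1 hσ, h1, rfl⟩)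
  convert h using 1
  · unfold coverSum sublistSum; congr
  · unfold cnt sublistSum
    refine Finset.sum_congr rfl fun w _ => ?_
    congr

lemma one_le_numComponents {w : Weyl n} (hw : ℓ w ≠ 0) : 1 ≤ numComponents w := by
  rw [numComponents_eq, compNum_eq_ncard, Nat.one_le_iff_ne_zero, Ne,
    Set.ncard_eq_zero, ← Ne, ← Set.nonempty_iff_ne_empty]
  obtain ⟨ω, hω⟩ := exists_isReducedWord w
  obtain ⟨i, hi⟩ : (support w).Nonempty := by
    rcases ω with _ | ⟨i, ω⟩
    · refine absurd ?_ hw; rw [← hω.2]; simp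
    · exact ⟨i, hω.mem_support.2 List.mem_cons_self⟩
  obtain ⟨m, hm, hmax⟩ := (support w).toFinite.exists_maximalFor id _ ⟨i, hi⟩
  refine ⟨m, hm, fun j hj hjm => ?_⟩
  have h : j ≤ m := hmax hj (by change m ≤ j; rw [Fin.le_def]; omega)
  rw [Fin.le_def] at h; omega

/-! ### The identity for a missing node and for full support -/

section Main
variable {p : ℕ}

/-- If y x fixes ε_p, then x ε_p = y⁻¹ ε_p. At the coordinate p - 1 the left side has strictly
increased while y⁻¹ changes nothing. -/
lemma highLow_not_fix (h1 : 1 ≤ p) (hp : p ≤ n) {w : Weyl n} (hw : w ∈ highLow p)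
    (hs : node (p - 1) ∈ support w) : corootRep n w (eps p) ≠ eps p := by
  intro hf
  obtain ⟨y, hy, x, hx, rfl⟩ := hw
  obtain ⟨hyp, hxp⟩ := mem_par_of_mem (by omega) hy hx
  have hpn : (node (p - 1) : Fin (n + 1)).val = p - 1 := node_val (by omega)
  have na : (node (p - 1) : Fin (n + 1)) ∉ above p := node_notMem_above (by omega) (by omega)
  have hs' : node (p - 1) ∈ support x := by
    rw [support_mul_of_disjoint (disjoint_above_below p) hyp hxp] at hs
    exact hs.resolve_left fun h => na (inPar_iff_support.1 hyp h)
  have hx1 := (hxp.rep_sub_nonneg reflRep_coroot (μ := eps p)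
    (c := fun i => -pairing n (eps p) (basisVec i)) (fun i hi => by
        have hi' : i.val < p := hi
        rw [pairing_eps h1 hp, if_neg (c := i.val = p) (by omega)]
        split_ifs <;> norm_num)
    (fun i _ => by rw [corootRep_simple]; module)).2 (node (p - 1)) hs' (by
        rw [pairing_eps h1 hp, hpn, if_neg (by omega), if_pos (by omega)]
        split_ifs <;> norm_num)
  have e : corootRep n x (eps p) = corootRep n y⁻¹ (eps p) := by
    nth_rw 2 [← hf]
    rw [map_mul, Module.End.mul_apply, ReflRep.inv_apply]
  rw [e, Pi.sub_apply, hyp.inv.rep_apply reflRep_coroot na, sub_self] at hx1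
  exact lt_irrefl _ hx1

lemma lowHigh_not_fix (h1 : 1 ≤ p) (hp : p ≤ n) {w : Weyl n} (hw : w ∈ lowHigh p)
    (hs : node (p - 1) ∈ support w) : corootRep n w (eps p) ≠ eps p := by
  intro hf
  refine highLow_not_fix h1 hp (inv_mem_highLow.2 hw) (by rwa [support_inv]) ?_
  conv_lhs => rw [← hf, ReflRep.inv_apply]

/-- Covers of `v` fixing `eps p` are unique. -/
lemma eq_of_fix {v w w' : Weyl n} (h : BruhatCovers v w) (h' : BruhatCovers v w')
    (hf : corootRep n w (eps p) = eps p) {d : ℤ} (hd : d * d = 1)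
    (hT : coverCoroot v w' = d • (eps p - corootRep n v⁻¹ (eps p))) : w = w' := by
  -- Since w fixes ε_p, the vector ε_p - v⁻¹ ε_p is a multiple of the coroot of w. Up to sign it is
  -- also the coroot of w', so the two positive coroots agree.
  obtain ⟨c, hc⟩ := h.isPosCoroot.reflection (eps p)
  rw [map_mul, Module.End.mul_apply, hf] at hc
  have e : c • coverCoroot v w = d • coverCoroot v w' := by
    rw [hT, smul_smul, hd, one_smul, hc, sub_sub_cancel]
  have hd0 : d ≠ 0 := by rintro rfl; simp at hd
  have h2 : coverCoroot v w' = coverCoroot v w :=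
    h'.isPosCoroot.eq_of_smul h.isPosCoroot hd0 e.symm
  have h3 := h.isPosCoroot
  rw [← h2] at h3
  exact mul_left_cancel (h3.reflection_unique h'.isPosCoroot)

/-- Equal counts of v in the two orders cancel ε_p - v⁻¹ ε_p; unequal counts leave a multiple of it.
-/
lemma sum_cnt_smul (h1 : 1 ≤ p) (hp : p ≤ n) {v : Weyl n} {F : Finset (Weyl n)}
    (hF : ∀ w, w ∈ F ↔ w ∈ zeeCovers v) :
    ∑ w ∈ F, (cnt (highWord (n + 1 - p) ++ lowWord p) w +
        cnt (lowWord p ++ highWord (n + 1 - p)) w) • coverCoroot v w =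
      cnt (highWord (n + 1 - p) ++ lowWord p) v •
          ((2 : ℤ) • central n - (eps p - corootRep n v⁻¹ (eps p))) +
        cnt (lowWord p ++ highWord (n + 1 - p)) v •
          ((2 : ℤ) • central n + (eps p - corootRep n v⁻¹ (eps p))) := by
  have e1 := coverSum_eq_sum (ω := highWord (n + 1 - p) ++ lowWord p) (v := v) (F := F)
    (fun w hw => ((hF w).1 hw).2) (fun w hw h => (hF w).2 ⟨(mem_zees_iff (by omega)).2
      ⟨p, h1, hp, Or.inl ((cnt_highLow_ne_zero (by omega)).1 h)⟩, hw⟩)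
  have e2 := coverSum_eq_sum (ω := lowWord p ++ highWord (n + 1 - p)) (v := v) (F := F)
    (fun w hw => ((hF w).1 hw).2) (fun w hw h => (hF w).2 ⟨(mem_zees_iff (by omega)).2
      ⟨p, h1, hp, Or.inr ((cnt_lowHigh_ne_zero (by omega)).1 h)⟩, hw⟩)
  simp only [add_smul, Finset.sum_add_distrib]
  rw [← e1, ← e2, hasType_high_low h1 hp, hasType_low_high h1 hp, map_neg]
  congr 2 <;> module

/-- The identity when a node is missing from the support. -/
lemma sum_of_notMem_support (hn : 1 ≤ n) {v : Weyl n} (hv : v ∈ zees n) {F : Finset (Weyl n)}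
    (hF : ∀ w, w ∈ F ↔ w ∈ zeeCovers v) {m : Fin (n + 1)} (hm : m ∉ support v) :
    ∑ w ∈ F, (2 : ℤ) ^ (numComponents w + 1) • coverCoroot v w =
      (2 : ℤ) ^ (numComponents v + 2) • central n := by
  -- The cut is placed next to the missing node, just below it unless that node is 0.
  obtain ⟨p, h1, hp, hpm⟩ : ∃ p, 1 ≤ p ∧ p ≤ n ∧ (m = node (p - 1) ∨ m = node p) := by
    rcases Nat.eq_zero_or_pos m.val with h | h
    · exact ⟨1, le_rfl, hn, Or.inl (by rw [← node_self m, h])⟩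
    · exact ⟨m.val, h, by omega, Or.inr (node_self m).symm⟩
  have hbad : ∀ u : Weyl n, support u ⊆ support v →
      ¬ (node (p - 1) ∈ support u ∧ node p ∈ support u) := by
    rintro u hu ⟨h2, h3⟩
    rcases hpm with rfl | rfl
    · exact hm (hu h2)
    · exact hm (hu h3)
  have hvp : v ∈ highLow p ∨ v ∈ lowHigh p := by
    -- The identity has no cocovers, so rigidity alone would not exclude it.
    by_cases hv1 : v = 1
    · refine Or.inl ⟨1, ?_, 1, one_mem_low _, by simp [hv1]⟩
      change tau 1 ∈ low _
      rw [map_one]; exact one_mem_low _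
    · rcases zees_dichotomy h1 hp hv with h | h | h
      · exact Or.inl h
      · exact Or.inr h
      · exfalso
        obtain ⟨i, hi⟩ := (sys n).exists_rightDescent_of_ne_one hv1
        have hc := (bruhatCovers_mul_simple
          ((sys n).isRightDescent_iff_not_isRightDescent_mul.1 hi)).1
        rw [CoxeterSystem.simple_mul_simple_cancel_right] at hc
        exact hbad _ hc.support_subset (h.2 _ hc)
  have hsum := sum_cnt_smul h1 hp hF
  have e : ∑ w ∈ F, (2 : ℤ) ^ (numComponents w + 1) • coverCoroot v w =
      ∑ w ∈ F, (cnt (highWord (n + 1 - p) ++ lowWord p) w +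
        cnt (lowWord p ++ highWord (n + 1 - p)) w) • coverCoroot v w := by
    refine Finset.sum_congr rfl fun w hw => ?_
    obtain ⟨hwz, hc⟩ := (hF w).1 hw
    rw [cnt_add_cnt h1 hp]
    rcases zees_dichotomy h1 hp hwz with h | h | h
    · exact Or.inl h
    · exact Or.inr h
    · exact absurd (h.2 _ hc) (hbad v subset_rfl)
  have hcnt : cnt (highWord (n + 1 - p) ++ lowWord p) v = 2 ^ numComponents v ∧
      cnt (lowWord p ++ highWord (n + 1 - p)) v = 2 ^ numComponents v := by
    rcases hvp with h | h
    · rcases highLow_cases h1 hp h with ⟨h2, h3, -⟩ | ⟨-, -, h4⟩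
      · exact absurd ⟨h2, h3⟩ (hbad v subset_rfl)
      · exact h4
    · rcases lowHigh_cases h1 hp h with ⟨h2, h3, -⟩ | ⟨-, -, h4⟩
      · exact absurd ⟨h2, h3⟩ (hbad v subset_rfl)
      · exact h4
  rw [e, hsum, hcnt.1, hcnt.2, pow_add]
  module

/-- The contribution of the cover fixing `eps p`. -/
lemma sum_of_full_support (h1 : 1 ≤ p) (hp : p ≤ n) {v : Weyl n} {F : Finset (Weyl n)}
    (hF : ∀ w, w ∈ F ↔ w ∈ zeeCovers v) (hs : ∀ i, i ∈ support v) {w₀ : Weyl n}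
    (hw₀ : w₀ ∈ zees n) (hc₀ : BruhatCovers v w₀) (hf₀ : corootRep n w₀ (eps p) = eps p) {d : ℤ}
    (hd : d * d = 1) (hT : coverCoroot v w₀ = d • (eps p - corootRep n v⁻¹ (eps p))) :
    ∑ w ∈ F, (2 : ℤ) ^ (numComponents w + 1) • coverCoroot v w =
      cnt (highWord (n + 1 - p) ++ lowWord p) v •
          ((2 : ℤ) • central n - (eps p - corootRep n v⁻¹ (eps p))) +
        cnt (lowWord p ++ highWord (n + 1 - p)) v •
          ((2 : ℤ) • central n + (eps p - corootRep n v⁻¹ (eps p))) +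
        ((2 : ℤ) ^ (numComponents v + 1) * d) • (eps p - corootRep n v⁻¹ (eps p)) := by
  classical
  have hsup : support w₀ = support v := by
    ext i; exact ⟨fun _ => hs i, fun _ => hc₀.support_subset (hs i)⟩
  have hnum : numComponents w₀ = numComponents v := by rw [numComponents_eq, hsup,
      ← numComponents_eq]
  have hmem : node (p - 1) ∈ support w₀ := hc₀.support_subset (hs _)
  have n1 : cnt (highWord (n + 1 - p) ++ lowWord p) w₀ = 0 := by
    by_contra h
    exact highLow_not_fix h1 hp ((cnt_highLow_ne_zero (by omega)).1 h) hmem hf₀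
  have n2 : cnt (lowWord p ++ highWord (n + 1 - p)) w₀ = 0 := by
    by_contra h
    exact lowHigh_not_fix h1 hp ((cnt_lowHigh_ne_zero (by omega)).1 h) hmem hf₀
  have e : ∑ w ∈ F, (2 : ℤ) ^ (numComponents w + 1) • coverCoroot v w =
      ∑ w ∈ F, ((cnt (highWord (n + 1 - p) ++ lowWord p) w +
        cnt (lowWord p ++ highWord (n + 1 - p)) w) • coverCoroot v w +
        if w = w₀ then (2 : ℤ) ^ (numComponents w + 1) • coverCoroot v w else 0) := by
    refine Finset.sum_congr rfl fun w hw => ?_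
    obtain ⟨hwz, hc⟩ := (hF w).1 hw
    split_ifs with h
    · subst h; rw [n1, n2]; simp
    · rw [cnt_add_cnt h1 hp, add_zero]
      rcases zees_dichotomy h1 hp hwz with h2 | h2 | h2
      · exact Or.inl h2
      · exact Or.inr h2
      · exact absurd (eq_of_fix hc hc₀ h2.1 hd hT) h
  rw [e, Finset.sum_add_distrib, sum_cnt_smul h1 hp hF, Finset.sum_ite_eq',
    if_pos ((hF _).2 ⟨hw₀, hc₀⟩), hnum, hT, smul_smul]

lemma sum_four_mul (hn : 1 ≤ n) {v : Weyl n} (hv : v ∈ zees n) (hlen : ℓ v < 2 * n)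
    {F : Finset (Weyl n)} (hF : ∀ w, w ∈ F ↔ w ∈ zeeCovers v) :
    ∑ w ∈ F, (2 : ℤ) ^ (numComponents w + 1) • coverCoroot v w =
      (2 : ℤ) ^ (numComponents v + 2) • central n := by
  by_cases hs : ∀ i, i ∈ support v
  · obtain ⟨p, h1, hp, h | h⟩ := (mem_zees_iff hn).1 hv
    · obtain ⟨w₀, hw₀, hc₀, hf₀, hT⟩ := exists_fixing_cover h1 hp h hs hlen
      rw [sum_of_full_support h1 hp hF hs hw₀ hc₀ hf₀ (d := 1) (by norm_num) (by rw [hT, one_smul])]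
      rcases highLow_cases h1 hp h with ⟨-, -, h2, h3⟩ | ⟨h2, -⟩
      · rw [← cnt_lowHigh_ne_zero (by omega), not_not] at h2
        rw [h2, h3, pow_add, pow_add]
        module
      · exact absurd ⟨hs _, hs _⟩ h2
    · obtain ⟨w, hw, hc, hf, hT⟩ := exists_fixing_cover h1 hp (inv_mem_highLow.2 h)
        (by rwa [support_inv]) (by rwa [(sys n).length_inv])
      -- Returning from v⁻¹ to v applies v⁻¹ to the coroot ε_p - v ε_p and reverses the difference;
      -- hence d = -1.
      obtain ⟨hc₀, hT₀⟩ := hc.inv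
      rw [inv_inv] at hc₀ hT₀ hT
      rw [hT, map_sub, ReflRep.inv_apply] at hT₀
      have hf₀ : corootRep n w⁻¹ (eps p) = eps p := by
        conv_lhs => rw [← hf, ReflRep.inv_apply]
      rw [sum_of_full_support h1 hp hF hs (inv_mem_zees hn hw) hc₀ hf₀ (d := -1) (by norm_num)
        (by rw [hT₀]; module)]
      rcases lowHigh_cases h1 hp h with ⟨-, -, h2, h3⟩ | ⟨h2, -⟩
      · rw [← cnt_highLow_ne_zero (by omega), not_not] at h2
        rw [h2, h3, pow_add, pow_add]
        module
      · exact absurd ⟨hs _, hs _⟩ h2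
  · push Not at hs
    obtain ⟨m, hm⟩ := hs
    exact sum_of_notMem_support hn hv hF hm

end Main

end AffineC

theorem proposition6p1 (n : ℕ) (hn : 1 ≤ n) (v : AffineC.Weyl n) (hv : v ∈ AffineC.zees n)
    (hlen : (AffineC.sys n).length v < 2 * n) :
    (∀ w ∈ AffineC.zeeCovers v, ∃! β : AffineC.Lattice n, AffineC.IsPosCoroot (v⁻¹ * w) β) ∧
    ∃ hfin : (AffineC.zeeCovers v).Finite,
      ∑ w ∈ hfin.toFinset,
          (2 : ℤ) ^ (AffineC.numComponents w - 1) • AffineC.coverCoroot v w =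
        (2 : ℤ) ^ AffineC.numComponents v • AffineC.central n := by
  refine ⟨fun w hw => ⟨_, hw.2.isPosCoroot, fun β hβ => hβ.unique hw.2.isPosCoroot⟩,
    AffineC.finite_zees.subset fun w hw => hw.1, ?_⟩
  have h := AffineC.sum_four_mul hn hv hlen
    (F := (AffineC.finite_zees.subset fun w (hw : w ∈ AffineC.zeeCovers v) => hw.1).toFinset)
    (fun w => Set.Finite.mem_toFinset _)
  -- Multiplying by 4 turns the weight into 2^(c(w)+1); the truncated exponent c(w) - 1 is harmless
  -- because a cover is not the identity.
  refine smul_right_injective (AffineC.Lattice n) (four_ne_zero : (4 : ℤ) ≠ 0) ?_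
  change (4 : ℤ) • _ = (4 : ℤ) • _
  rw [smul_smul, show (4 : ℤ) * 2 ^ AffineC.numComponents v = 2 ^ (AffineC.numComponents v + 2) by
    rw [pow_add]; ring, ← h, Finset.smul_sum]
  refine Finset.sum_congr rfl fun w hw => ?_
  have hw' : w ∈ AffineC.zeeCovers v := (Set.Finite.mem_toFinset _).1 hw
  have h1 := AffineC.one_le_numComponents (w := w) (by rw [hw'.2.2]; omega)
  obtain ⟨c, hc⟩ := Nat.exists_eq_add_of_le' h1
  rw [hc, smul_smul, Nat.add_sub_cancel, show (2 : ℤ) ^ (c + 1 + 1) = 4 * 2 ^ c by ring]
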